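/- For $n\ge 0$ and a set $V\subset\mathbb{C}^n$, say that $f\in\mathbb{C}\{z_1,\dots,z_n\}$ is continuable avoiding $V$ if there is $\tau>0$ such that $f$ is holomorphic in the polydisc $\mathbb{D}_\tau^n=\{|z_i|<\tau\}$ and admits analytic continuation along every $C^1$ path $\gamma:[0,1]\to\mathbb{C}^n\setminus V$ with $\gamma(0)\in\mathbb{D}_\tau^n$. Let $\widehat{\mathcal Q}^{\mathcal A}_n$ (algebro-resurgent germs) be the set of $f\in\mathbb{C}\{z_1,\dots,z_n\}$ that are continuable avoiding some proper algebraic subvariety of $\mathbb{C}^n$ (possibly empty or reducible). Let $n\ge 1$ and let $F$ be a function on $\mathbb{C}^n$ (only its germ at $0$ matters). (A) If $F\in\widehat{\mathcal Q}^{\mathcal A}_n$, then for every polynomial $\overline P\in\mathbb{C}[z,z_2,\dots,z_n]$ with $\overline P(0)=0$, the germ at $0$ of $$f(z,z_2,\dots,z_n)=\int_0^{\overline P(z,z_2,\dots,z_n)}F(z_1,z_2,\dots,z_n)\,dz_1$$ belongs to $\widehat{\mathcal Q}^{\mathcal A}_n$; and for every $\overline P\in\mathbb{C}[z_2,\dots,z_n]$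 with $\overline P(0)=0$, the germ at $0$ of $$f(z_2,\dots,z_n)=\int_0^{\overline P(z_2,\dots,z_n)}F(z_1,z_2,\dots,z_n)\,dz_1$$ belongs to $\widehat{\mathcal Q}^{\mathcal A}_{n-1}$. (The integrals are along straight segments.) (B) The avoided variety is explicit. Call a nonzero polynomial $Q\in\mathbb{C}[z_2,\dots,z_n][z_1]$ $z_1$-simple if its roots in an algebraic closure of $\mathbb{C}(z_2,\dots,z_n)$ are pairwise distinct. Let $Q_1,\dots,Q_K$ ($K\ge1$) be $z_1$-simple polynomials such that $F$ is continuable avoiding $\bigcap_J Q_J^{-1}(0)$. For $\overline P\in\mathbb{C}[z,z_2,\dots,z_n]$ with $\overline P(0)=0$, let $V_J$ be the set of $(z,z_2,\dots,z_n)\in\mathbb{C}^n$ for which at least one of the following holds: 1. the leading coefficient of $Q_J$ in $z_1$ vanishes at $(z_2,\dots,z_n)$; 2. the polynomial $Q_J(\cdot,z_2,\dots,z_n)\in\mathbb{C}[z_1]$ has a multiple root or is $0$ (where the leading coefficient does not vanish, this means that the discriminant vanishes); 3. $Q_J(0,z_2,\dots,z_n)=0$, this condition being omitted if $Q_J(0,\cdot)$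 vanishes identically; 4. $Q_J(\overline P(z,z_2,\dots,z_n),z_2,\dots,z_n)=0$, this condition being omitted if this polynomial vanishes identically. Then $\bigcap_J V_J$ is a proper algebraic subvariety of $\mathbb{C}^n$, and $f$ is continuable avoiding it. If $\overline P\in\mathbb{C}[z_2,\dots,z_n]$, the same holds for the germ $f(z_2,\dots,z_n)$ in $\mathbb{C}^{n-1}$, with $V_J\subset\mathbb{C}^{n-1}$ defined by the same four conditions. -/

import Mathlib

open Filter Topology Set

/-- `V` is a proper algebraic subvariety of `ℂⁿ`: the common zero locus of an ideal of
polynomials, different from the whole space (it may be reducible or empty). -/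
def IsProperAlgebraicSubvariety {n : ℕ} (V : Set (Fin n → ℂ)) : Prop :=
  (∃ I : Ideal (MvPolynomial (Fin n) ℂ), V = MvPolynomial.zeroLocus ℂ I) ∧ V ≠ univ

/-- The function `f`, analytic near `γ 0`, admits analytic continuation along the path
`γ : [0,1] → ℂⁿ`: there is a family of analytic germs `g t` at `γ t`, locally coherent in `t`,
whose initial germ at `γ 0` is that of `f`. -/
def HasAnalyticContinuationAlong {n : ℕ} (f : (Fin n → ℂ) → ℂ) (γ : ℝ → Fin n → ℂ) : Prop :=
  ∃ g : ℝ → (Fin n → ℂ) → ℂ,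
    (∀ t ∈ Icc (0 : ℝ) 1, AnalyticAt ℂ (g t) (γ t)) ∧
    g 0 =ᶠ[𝓝 (γ 0)] f ∧
    ∀ t ∈ Icc (0 : ℝ) 1, ∀ᶠ s in 𝓝[Icc (0 : ℝ) 1] t, g s =ᶠ[𝓝 (γ s)] g t

/-- The germ at `0` of `f` is holomorphic on some polydisc `𝔻_τⁿ` (the ball of radius `τ` for the
sup norm of `Fin n → ℂ`), and admits analytic continuation along every `C¹` path contained in
`ℂⁿ ∖ V` whose initial point lies in this polydisc. -/
def IsContinuableAvoiding {n : ℕ} (f : (Fin n → ℂ) → ℂ) (V : Set (Fin n → ℂ)) : Prop :=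
  ∃ τ : ℝ, 0 < τ ∧ AnalyticOnNhd ℂ f (Metric.ball 0 τ) ∧
    ∀ γ : ℝ → Fin n → ℂ, ContDiffOn ℝ 1 γ (Icc 0 1) → γ 0 ∈ Metric.ball 0 τ →
      (∀ t ∈ Icc (0 : ℝ) 1, γ t ∉ V) → HasAnalyticContinuationAlong f γ

/-- The germ at `0` of `f : ℂⁿ → ℂ` is algebro-resurgent. -/
def IsAlgebroResurgent {n : ℕ} (f : (Fin n → ℂ) → ℂ) : Prop :=
  ∃ V : Set (Fin n → ℂ), IsProperAlgebraicSubvariety V ∧ IsContinuableAvoiding f V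

/-- `∫₀ᶜ F(z₁, w) dz₁`, along the straight segment from `0` to `c`. -/
noncomputable def firstVarIntegral {m : ℕ} (F : (Fin (m + 1) → ℂ) → ℂ) (c : ℂ)
    (w : Fin m → ℂ) : ℂ :=
  ∫ t in (0 : ℝ)..1, F (Fin.cons ((t : ℂ) * c) w) * c

/-- `f(z, z₂, …, zₙ) = ∫₀^{P(z, z₂, …, zₙ)} F(z₁, z₂, …, zₙ) dz₁`, with `n = m + 1`. -/
noncomputable def convolution {m : ℕ} (F : (Fin (m + 1) → ℂ) → ℂ)
    (P : MvPolynomial (Fin (m + 1)) ℂ) (z : Fin (m + 1) → ℂ) : ℂ :=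
  firstVarIntegral F (MvPolynomial.eval z P) (Fin.tail z)

/-- `f(z₂, …, zₙ) = ∫₀^{P(z₂, …, zₙ)} F(z₁, z₂, …, zₙ) dz₁`, with `n = m + 1`. -/
noncomputable def convolutionTail {m : ℕ} (F : (Fin (m + 1) → ℂ) → ℂ)
    (P : MvPolynomial (Fin m) ℂ) (w : Fin m → ℂ) : ℂ :=
  firstVarIntegral F (MvPolynomial.eval w P) w

/-- The hypersurface `Q⁻¹(0)`. -/
def polyZeros {n : ℕ} (Q : MvPolynomial (Fin n) ℂ) : Set (Fin n → ℂ) :=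
  {z | MvPolynomial.eval z Q = 0}

/-- `Q ≠ 0` is `z₁`-simple: viewed as a polynomial in `z₁` with coefficients in `ℂ[z₂, …, zₙ]`, it
has pairwise distinct roots in an algebraic closure of the fraction field of `ℂ[z₂, …, zₙ]`. -/
def IsFirstVarSimple {m : ℕ} (Q : MvPolynomial (Fin (m + 1)) ℂ) : Prop :=
  Q ≠ 0 ∧ ((MvPolynomial.finSuccEquiv ℂ m Q).aroots
    (AlgebraicClosure (FractionRing (MvPolynomial (Fin m) ℂ)))).Nodup

/-- The one-variable polynomial `Q(·, w) ∈ ℂ[z₁]` for fixed `w = (z₂, …, zₙ)`. -/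
noncomputable def specialize {m : ℕ} (Q : MvPolynomial (Fin (m + 1)) ℂ) (w : Fin m → ℂ) :
    Polynomial ℂ :=
  (MvPolynomial.finSuccEquiv ℂ m Q).map (MvPolynomial.eval w)

/-- The points `w = (z₂, …, zₙ)` where the leading coefficient of `Q` in `z₁` vanishes, or
`Q(·, w)` has a multiple root, or `Q(0, w) = 0` (the last condition being dropped when `Q(0, ·)` is
the zero polynomial). -/
def rootDegeneracyLocus {m : ℕ} (Q : MvPolynomial (Fin (m + 1)) ℂ) : Set (Fin m → ℂ) :=
  {w | MvPolynomial.eval w (MvPolynomial.finSuccEquiv ℂ m Q).leadingCoeff = 0 ∨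
    (∃ x : ℂ, (specialize Q w).IsRoot x ∧ (specialize Q w).derivative.IsRoot x) ∨
    ((∃ y : Fin m → ℂ, (specialize Q y).eval 0 ≠ 0) ∧ (specialize Q w).eval 0 = 0)}

/-- The variety to be avoided in `ℂⁿ`: the points `(z, w)` with `w` in `rootDegeneracyLocus Q`, or
with `Q(P(z, w), w) = 0` (dropped when `Q(P, ·)` is the zero polynomial). -/
def avoidedVariety {m : ℕ} (Q P : MvPolynomial (Fin (m + 1)) ℂ) : Set (Fin (m + 1) → ℂ) :=
  {z | Fin.tail z ∈ rootDegeneracyLocus Q ∨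
    ((∃ y : Fin (m + 1) → ℂ, (specialize Q (Fin.tail y)).eval (MvPolynomial.eval y P) ≠ 0) ∧
      (specialize Q (Fin.tail z)).eval (MvPolynomial.eval z P) = 0)}

/-- The variety to be avoided in `ℂⁿ⁻¹` when `P` depends only on `(z₂, …, zₙ)`. -/
def avoidedVarietyTail {m : ℕ} (Q : MvPolynomial (Fin (m + 1)) ℂ) (P : MvPolynomial (Fin m) ℂ) :
    Set (Fin m → ℂ) :=
  {w | w ∈ rootDegeneracyLocus Q ∨
    ((∃ y : Fin m → ℂ, (specialize Q y).eval (MvPolynomial.eval y P) ≠ 0) ∧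
      (specialize Q w).eval (MvPolynomial.eval w P) = 0)}

/-! Put `G(x, w) = ∫₀ˣ F(·, w)`. Both germs `f` are pull-backs of `G` by a polynomial map `p` with
`p 0 = 0`, namely `(P, tail)` or `(P, id)`, so it is enough to continue the germ of `G` along `δ = p
∘ γ`. Classically one drags the integration path along with its endpoint. Over `w` outside
`rootDegeneracyLocus (Q J)` the roots of `Q J (·, w)` are simple and move continuously, so a path
from `0` to `x` that stays off them still does so for nearby `w`. This can fail only if a root runs
into an end of the path. Off `V_J` an end meets a root only if it is a root identically. In that
case the current branch of `F` is holomorphic at that end, and a Hartogs figure shows that it stays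
so (`exists_extension_of_hasSimpleFibers`).

The index `J` may change with time, and a path suited to one `Q J` may cross roots of another. The
induction therefore carries a property that does not mention `J`: over the fixed `w`, the germ at `δ
t` is joined to the base germ `b t` (the primitive at `(0, w)` vanishing on `{0} × W`) inside
`verticalGerms`. The derivatives of these germs are branches of `F`, possibly at points of `S = ⋂ J,
Z J` where the branch happens to be holomorphic; this is the role of `germClosure`. Once a `J` is
given, `joinedIn_verticalGerms_avoiding` and `exists_lift_radialPush` move the joining path to a
definite distance from the roots of `Q J`. It can then be lifted for all nearby `w` at once, with no
isotopy of the plane. The neighbourhood produced by `exists_extension_of_joinedIn` does not depend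
on the germ, so finitely many steps cover `[0,1]` (`exists_lift_segmentPrimitive`).

Continuations are handled as continuous lifts to the étalé space of analytic germs, which is a
separated local homeomorphism over the base. This supplies uniqueness and the lifting of homotopies.

On the algebraic side, each `V_J` is the zero set of the product of the leading coefficient, a
resultant, `Q J (0, ·)` and `Q J (P, ·)`, where identically vanishing factors are replaced by `1`.
Part (A) follows from (B), because any proper subvariety lies in a `z₁`-simple hypersurface,
obtained from a radical over the fraction field. -/

section AnalyticGerms

/-! ### The étalé space of analytic germs. -/

variable (E : Type*) [NormedAddCommGroup E] [NormedSpace ℂ E]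

/-- Pairs of a point and a function analytic there, up to equality of germs. -/
def analyticGermSetoid : Setoid {a : (E → ℂ) × E // AnalyticAt ℂ a.1 a.2} where
  r a b := a.1.2 = b.1.2 ∧ a.1.1 =ᶠ[𝓝 a.1.2] b.1.1
  iseqv :=
    ⟨fun _ => ⟨rfl, EventuallyEq.rfl⟩, fun h => ⟨h.1.symm, h.1 ▸ h.2.symm⟩,
      fun h h' => ⟨h.1.trans h'.1, h.2.trans (h.1 ▸ h'.2)⟩⟩

/-- The étalé space of the sheaf of analytic functions on `E`. -/
def AnalyticGerm : Type _ := Quotient (analyticGermSetoid E)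

variable {E}

namespace AnalyticGerm

/-- The base point of a germ. -/
def pt : AnalyticGerm E → E := Quotient.lift (fun a => a.1.2) fun _ _ h => h.1

/-- The germ of `f` at `p`, for `f` analytic at `p`. -/
def mk (f : E → ℂ) (p : E) (h : AnalyticAt ℂ f p) : AnalyticGerm E :=
  Quotient.mk (analyticGermSetoid E) ⟨(f, p), h⟩

open Classical in
/-- The germ of `f` at `p` (the zero germ if `f` is not analytic at `p`). -/
noncomputable def sec (f : E → ℂ) (p : E) : AnalyticGerm E :=
  if h : AnalyticAt ℂ f p then mk f p h else mk (fun _ => 0) p analyticAt_const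

/-- A function representing a germ. -/
noncomputable def rep (e : AnalyticGerm E) : E → ℂ := (Quotient.out e).1.1

@[simp] lemma pt_sec (f : E → ℂ) (p : E) : pt (sec f p) = p := by
  unfold sec; split_ifs <;> rfl

lemma pt_eq_out (e : AnalyticGerm E) : e.pt = (Quotient.out e).1.2 := by
  conv_lhs => rw [← Quotient.out_eq e]
  rfl

lemma analyticAt_rep (e : AnalyticGerm E) : AnalyticAt ℂ e.rep e.pt := by
  rw [pt_eq_out]; exact (Quotient.out e).2

@[simp] lemma sec_rep (e : AnalyticGerm E) : sec e.rep e.pt = e := by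
  unfold sec
  rw [dif_pos e.analyticAt_rep]
  conv_rhs => rw [← Quotient.out_eq e]
  refine Quotient.sound ⟨pt_eq_out e, EventuallyEq.rfl⟩

lemma sec_eq_sec {f g : E → ℂ} {p : E} (hf : AnalyticAt ℂ f p) (hg : AnalyticAt ℂ g p) :
    sec f p = sec g p ↔ f =ᶠ[𝓝 p] g := by
  unfold sec
  rw [dif_pos hf, dif_pos hg]
  constructor
  · intro h; exact (Quotient.exact h).2
  · intro h; exact Quotient.sound ⟨rfl, h⟩

lemma sec_congr {f g : E → ℂ} {p : E} (h : f =ᶠ[𝓝 p] g) : sec f p = sec g p := by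
  by_cases hf : AnalyticAt ℂ f p
  · exact (sec_eq_sec hf (hf.congr h)).2 h
  · have hg : ¬ AnalyticAt ℂ g p := fun hg => hf (hg.congr h.symm)
    unfold sec
    rw [dif_neg hf, dif_neg hg]

lemma exists_sec (e : AnalyticGerm E) : ∃ f, AnalyticAt ℂ f e.pt ∧ sec f e.pt = e :=
  ⟨e.rep, e.analyticAt_rep, e.sec_rep⟩

/-- The value of a germ at its base point. -/
noncomputable def val (e : AnalyticGerm E) : ℂ := e.rep e.pt

lemma val_sec {f : E → ℂ} {p : E} (hf : AnalyticAt ℂ f p) : val (sec f p) = f p := by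
  have h : sec (sec f p).rep p = sec f p := by
    simpa using (sec f p).sec_rep
  have h1 : AnalyticAt ℂ (sec f p).rep p := by
    simpa using (sec f p).analyticAt_rep
  have := ((sec_eq_sec h1 hf).1 h).eq_of_nhds
  simpa [val] using this

/-- A set of germs is open if it contains, with the germ of `f` at `p`, the germs of `f` at all
points near `p`. -/
instance : TopologicalSpace (AnalyticGerm E) where
  IsOpen O := ∀ f p, AnalyticAt ℂ f p → sec f p ∈ O → ∀ᶠ q in 𝓝 p, sec f q ∈ O
  isOpen_univ := fun _ _ _ _ => Eventually.of_forall fun _ => mem_univ _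
  isOpen_inter := fun _ _ h h' f p hf hp => (h f p hf hp.1).and (h' f p hf hp.2)
  isOpen_sUnion := fun _ h f p hf ⟨s, hs, hp⟩ =>
    (h s hs f p hf hp).mono fun _ hq => ⟨s, hs, hq⟩

lemma isOpen_iff {O : Set (AnalyticGerm E)} :
    IsOpen O ↔ ∀ f p, AnalyticAt ℂ f p → sec f p ∈ O → ∀ᶠ q in 𝓝 p, sec f q ∈ O := Iff.rfl

lemma continuousAt_sec {f : E → ℂ} {p : E} (hf : AnalyticAt ℂ f p) : ContinuousAt (sec f) p := by
  intro O hO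
  obtain ⟨O', hO', ho, hp⟩ := mem_nhds_iff.1 hO
  exact (ho f p hf hp).mono fun q hq => hO' hq

lemma continuous_pt : Continuous (pt : AnalyticGerm E → E) := by
  refine continuous_def.2 fun U hU => isOpen_iff.2 fun f p _ hp => ?_
  rw [mem_preimage, pt_sec] at hp
  filter_upwards [hU.mem_nhds hp] with q hq
  rwa [mem_preimage, pt_sec]

lemma isOpenMap_pt : IsOpenMap (pt : AnalyticGerm E → E) := by
  intro O hO
  rw [isOpen_iff_mem_nhds]
  rintro _ ⟨e, he, rfl⟩
  obtain ⟨f, hf, hfe⟩ := e.exists_sec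
  have := isOpen_iff.1 hO f e.pt hf (by rwa [hfe])
  filter_upwards [this] with q hq
  exact ⟨_, hq, pt_sec f q⟩

lemma isOpen_sec_image {f : E → ℂ} {U : Set E} (hU : IsOpen U) (hf : AnalyticOnNhd ℂ f U) :
    IsOpen (sec f '' U) := by
  refine isOpen_iff.2 fun g p hg => ?_
  rintro ⟨q, hq, h⟩
  obtain rfl : q = p := by simpa using congrArg pt h
  have h' := (sec_eq_sec (hf q hq) hg).1 h
  filter_upwards [h'.eventuallyEq_nhds, hU.mem_nhds hq] with r hr hrU
  exact ⟨r, hrU, sec_congr hr⟩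

/-- This is how continuity of a family of germs gets used: one representative serves for the whole
family locally. -/
lemma eventually_eq_sec {f : E → ℂ} {e : AnalyticGerm E} (hf : AnalyticAt ℂ f e.pt)
    (he : sec f e.pt = e) : ∀ᶠ e' in 𝓝 e, e' = sec f e'.pt ∧ AnalyticAt ℂ f e'.pt := by
  obtain ⟨U, hUf, hU, hpU⟩ := eventually_nhds_iff.1 hf.eventually_analyticAt
  have := (isOpen_sec_image hU (f := f) hUf).mem_nhds ⟨e.pt, hpU, he⟩
  filter_upwards [this]
  rintro _ ⟨q, hq, rfl⟩
  simp [hUf q hq]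

lemma isLocalHomeomorph_pt : IsLocalHomeomorph (pt : AnalyticGerm E → E) := by
  rw [isLocalHomeomorph_iff_isOpenEmbedding_restrict]
  intro e
  obtain ⟨f, hf, hfe⟩ := e.exists_sec
  obtain ⟨U, hUf, hU, hpU⟩ := eventually_nhds_iff.1 hf.eventually_analyticAt
  have ho := isOpen_sec_image hU (f := f) hUf
  refine ⟨_, ho.mem_nhds ⟨e.pt, hpU, hfe⟩, ?_⟩
  refine Topology.IsOpenEmbedding.of_continuous_injective_isOpenMap
    (continuous_pt.comp continuous_subtype_val) ?_ (isOpenMap_pt.comp ho.isOpenMap_subtype_val)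
  rintro ⟨_, a, _, rfl⟩ ⟨_, b, _, rfl⟩ h
  simp only [Set.domRestrict_apply, pt_sec] at h
  subst h; rfl

/-- By the identity theorem on a common ball, two functions sharing a germ at one point of the ball
share it at the centre. -/
lemma isSeparatedMap_pt : IsSeparatedMap (pt : AnalyticGerm E → E) := by
  intro e e' hp hne
  obtain ⟨f, hf, hfe⟩ := e.exists_sec
  obtain ⟨g, hg, hge⟩ := e'.exists_sec
  rw [← hp] at hg hge
  obtain ⟨r, hr, hball⟩ := Metric.eventually_nhds_iff_ball.1
    (hf.eventually_analyticAt.and hg.eventually_analyticAt)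
  have hpc : IsPreconnected (Metric.ball e.pt r) := (convex_ball _ _).isPreconnected
  refine ⟨_, _, isOpen_sec_image Metric.isOpen_ball fun q hq => (hball q hq).1,
    isOpen_sec_image Metric.isOpen_ball fun q hq => (hball q hq).2,
    ⟨e.pt, Metric.mem_ball_self hr, hfe⟩, ⟨e.pt, Metric.mem_ball_self hr, hge⟩, ?_⟩
  rw [Set.disjoint_left]
  rintro _ ⟨a, ha, rfl⟩ ⟨b, hb, h⟩
  obtain rfl : b = a := by simpa using congrArg pt h
  have h' := (sec_eq_sec (hball b ha).2 (hball b ha).1).1 h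
  have h2 := AnalyticOnNhd.eqOn_of_preconnected_of_eventuallyEq
    (fun q hq => (hball q hq).2) (fun q hq => (hball q hq).1) hpc ha h'
  apply hne
  rw [← hfe, ← hge]
  refine sec_congr ?_
  filter_upwards [Metric.ball_mem_nhds e.pt hr] with q hq
  exact (h2 hq).symm

/-- Two continuous families of germs with the same base points agree on a preconnected set if they
agree somewhere. -/
lemma eqOn_of_preconnected {A : Type*} [TopologicalSpace A] {s : Set A} (hs : IsPreconnected s)
    {g h : A → AnalyticGerm E} (hg : ContinuousOn g s) (hh : ContinuousOn h s)
    (hp : ∀ a ∈ s, (g a).pt = (h a).pt) {a : A} (ha : a ∈ s) (hgh : g a = h a) : EqOn g h s :=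
  isSeparatedMap_pt.eqOn_of_comp_eqOn isLocalHomeomorph_pt.isLocallyInjective hs hg hh
    (fun a ha => hp a ha) ha hgh

/-- A continuous section of the étalé space over an open set comes from an analytic function. -/
lemma analyticAt_val_section {U : Set E} (hU : IsOpen U) {σ : E → AnalyticGerm E}
    (hσ : ContinuousOn σ U) (hp : ∀ q ∈ U, (σ q).pt = q) :
    ∀ q ∈ U, AnalyticAt ℂ (fun q => (σ q).val) q ∧ sec (fun q => (σ q).val) q = σ q := by
  intro q hq
  obtain ⟨f, hf, hfe⟩ := (σ q).exists_sec
  have h1 := (hσ.continuousAt (hU.mem_nhds hq)).eventually (eventually_eq_sec hf hfe)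
  rw [hp q hq] at hf hfe
  have h2 : (fun q => (σ q).val) =ᶠ[𝓝 q] f := by
    filter_upwards [h1, hU.mem_nhds hq] with r hr hrU
    rw [hp r hrU] at hr
    rw [hr.1, val_sec hr.2]
  exact ⟨hf.congr h2.symm, by rw [sec_congr h2, hfe]⟩

end AnalyticGerm

end AnalyticGerms

/-! ### Path lifting and homotopy lifting. -/

section Lifting

open unitInterval

/-- Local extension with a uniform domain implies extension along `[0,1]`. -/
lemma exists_continuousMap_of_local_extension {G : Type*} [TopologicalSpace G] (A : I → Set G)
    (h : ∀ t : I, ∃ T ∈ 𝓝 t, ∀ t₀ ∈ T, ∀ e ∈ A t₀,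
      ∃ u : I → G, ContinuousOn u T ∧ u t₀ = e ∧ ∀ s ∈ T, u s ∈ A s)
    {e : G} (he : e ∈ A 0) : ∃ Γ : C(I, G), Γ 0 = e ∧ ∀ s, Γ s ∈ A s := by
  choose T hT hTu using h
  -- Each `T` is fixed before the starting time `t₀` and the value `e`, so the subdivision can be
  -- chosen before any lift exists.
  obtain ⟨t, t_0, t_mono, ⟨n_max, h_max⟩, t_sub⟩ :=
    exists_monotone_Icc_subset_open_cover_unitInterval
      (c := fun s => interior (T s)) (fun s => isOpen_interior)
      (fun s _ => mem_iUnion.2 ⟨s, mem_interior_iff_mem_nhds.2 (hT s)⟩)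
  have key : ∀ n, ∃ g : I → G, ContinuousOn g (Icc 0 (t n)) ∧ g 0 = e ∧ ∀ s ≤ t n, g s ∈ A s := by
    intro n
    induction n with
    | zero =>
      refine ⟨fun _ => e, continuousOn_const, rfl, fun s hs => ?_⟩
      rw [t_0] at hs
      obtain rfl : s = 0 := le_antisymm hs unitInterval.nonneg'
      exact he
    | succ n ih =>
      obtain ⟨g, hg, hg0, hgA⟩ := ih
      obtain ⟨i, hi⟩ := t_sub n
      have hi' : Icc (t n) (t (n + 1)) ⊆ T i := hi.trans interior_subset
      obtain ⟨u, hu, hu0, huA⟩ := hTu i (t n) (hi' ⟨le_rfl, t_mono n.le_succ⟩) _ (hgA _ le_rfl)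
      refine ⟨fun s => if s ≤ t n then g s else u s, ?_, ?_, ?_⟩
      · refine ContinuousOn.if ?_ ?_ ?_
        · rintro s ⟨_, hs⟩
          have := frontier_le_subset_eq continuous_id continuous_const hs
          simp only [id, mem_ofPred_eq] at this
          rw [this, hu0]
        · refine hg.mono ?_
          rintro s ⟨hs, hs'⟩
          exact ⟨hs.1, (isClosed_Iic (a := t n)).closure_subset hs'⟩
        · refine hu.mono ?_
          rintro s ⟨hs, hs'⟩
          refine hi' ⟨?_, hs.2⟩
          simp only [not_le] at hs'
          exact (isClosed_Ici (a := t n)).closure_subset_iff.2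
            (show {a | t n < a} ⊆ Ici (t n) from fun x (hx : t n < x) => mem_Ici.2 hx.le) hs'
      · simp [hg0]
      · intro s hs
        by_cases hsn : s ≤ t n
        · simpa [hsn] using hgA s hsn
        · simpa [hsn] using huA s (hi' ⟨(not_le.1 hsn).le, hs⟩)
  obtain ⟨g, hg, hg0, hgA⟩ := key n_max
  rw [h_max _ le_rfl] at hg hgA
  have huniv : Icc (0 : I) 1 = univ := eq_univ_of_forall fun s => ⟨unitInterval.nonneg', unitInterval.le_one'⟩
  rw [huniv, continuousOn_univ] at hg
  exact ⟨⟨g, hg⟩, hg0, fun s => hgA s unitInterval.le_one'⟩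

variable {E : Type*} [NormedAddCommGroup E] [NormedSpace ℂ E]

/-- Lifting of a homotopy to the étalé space, given lifts of its paths. -/
lemma AnalyticGerm.exists_homotopy_lift {Y : Type*} [TopologicalSpace Y] (A : Set (AnalyticGerm E))
    (K : C(I × Y, E)) (e₀ : Y → AnalyticGerm E) (h₀ : Continuous e₀)
    (h : ∀ y, ∃ Γ : C(I, AnalyticGerm E), Γ 0 = e₀ y ∧ ∀ s, (Γ s).pt = K (s, y) ∧ Γ s ∈ A) :
    ∃ G : C(I × Y, AnalyticGerm E), (∀ y, G (0, y) = e₀ y) ∧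
      ∀ x, (G x).pt = K x ∧ G x ∈ A := by
  choose Γ hΓ0 hΓ using h
  have := isLocalHomeomorph_pt.continuous_lift isSeparatedMap_pt K (g := fun x => Γ x.2 x.1)
    (by ext x; exact (hΓ x.2 x.1).1) (by simpa [hΓ0] using h₀) (fun y => (Γ y).continuous)
  exact ⟨⟨_, this⟩, fun y => hΓ0 y, fun x => hΓ x.2 x.1⟩

end Lifting

/-! ### Germs reached by `C¹` continuation. -/

section Reachable

open AnalyticGerm unitInterval

variable {E : Type*} [NormedAddCommGroup E] [NormedSpace ℂ E]

/-- Analytic continuation of `f` along `γ : [0,1] → E`. -/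
def ContinuesAlong (f : E → ℂ) (γ : ℝ → E) : Prop :=
  ∃ g : ℝ → E → ℂ,
    (∀ t ∈ Icc (0 : ℝ) 1, AnalyticAt ℂ (g t) (γ t)) ∧
    g 0 =ᶠ[𝓝 (γ 0)] f ∧
    ∀ t ∈ Icc (0 : ℝ) 1, ∀ᶠ s in 𝓝[Icc (0 : ℝ) 1] t, g s =ᶠ[𝓝 (γ s)] g t

lemma ContinuesAlong.exists_lift {f : E → ℂ} {γ : ℝ → E} (h : ContinuesAlong f γ)
    (hγ : ContinuousOn γ (Icc 0 1)) :
    ∃ Γ : ℝ → AnalyticGerm E, ContinuousOn Γ (Icc 0 1) ∧ Γ 0 = sec f (γ 0) ∧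
      ∀ t ∈ Icc (0 : ℝ) 1, (Γ t).pt = γ t := by
  obtain ⟨g, hg, hg0, hgc⟩ := h
  refine ⟨fun t => sec (g t) (γ t), fun t ht => ?_, sec_congr hg0, fun t _ => pt_sec _ _⟩
  have h1 : ContinuousWithinAt (fun s => sec (g t) (γ s)) (Icc 0 1) t :=
    (continuousAt_sec (hg t ht)).comp_continuousWithinAt (hγ t ht)
  refine h1.congr_of_eventuallyEq ?_ rfl
  filter_upwards [hgc t ht] with s hs using sec_congr hs

lemma ContinuesAlong.of_lift {f : E → ℂ} {γ : ℝ → E} {Γ : ℝ → AnalyticGerm E}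
    (hΓ : ContinuousOn Γ (Icc 0 1)) (h0 : Γ 0 = sec f (γ 0)) (hf : AnalyticAt ℂ f (γ 0))
    (hp : ∀ t ∈ Icc (0 : ℝ) 1, (Γ t).pt = γ t) : ContinuesAlong f γ := by
  have ha : ∀ t ∈ Icc (0 : ℝ) 1, AnalyticAt ℂ (Γ t).rep (γ t) := fun t ht => by
    rw [← hp t ht]; exact (Γ t).analyticAt_rep
  have hs : ∀ t ∈ Icc (0 : ℝ) 1, sec (Γ t).rep (γ t) = Γ t := fun t ht => by
    rw [← hp t ht]; exact (Γ t).sec_rep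
  refine ⟨fun t => (Γ t).rep, ha, ?_, fun t ht => ?_⟩
  · have h01 : (0 : ℝ) ∈ Icc (0 : ℝ) 1 := ⟨le_rfl, zero_le_one⟩
    exact (sec_eq_sec (ha 0 h01) hf).1 ((hs 0 h01).trans h0)
  · have h1 := (hΓ t ht).eventually (eventually_eq_sec (Γ t).analyticAt_rep (Γ t).sec_rep)
    filter_upwards [h1, self_mem_nhdsWithin] with s hs1 hs2
    rw [hp s hs2] at hs1
    exact (sec_eq_sec (ha s hs2) hs1.2).1 ((hs s hs2).trans hs1.1)

/-- The germs obtained by continuing `F` along `C¹` paths from the ball of radius `τ`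
avoiding `S`. -/
def reachableGerms (F : E → ℂ) (τ : ℝ) (S : Set E) : Set (AnalyticGerm E) :=
  {e | ∃ γ : ℝ → E, ContDiffOn ℝ 1 γ (Icc 0 1) ∧ γ 0 ∈ Metric.ball 0 τ ∧
    (∀ t ∈ Icc (0 : ℝ) 1, γ t ∉ S) ∧ ∃ Γ : ℝ → AnalyticGerm E, ContinuousOn Γ (Icc 0 1) ∧
      Γ 0 = sec F (γ 0) ∧ (∀ t ∈ Icc (0 : ℝ) 1, (Γ t).pt = γ t) ∧ Γ 1 = e}

variable {F : E → ℂ} {τ : ℝ} {S : Set E}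

lemma pt_notMem_of_mem_reachableGerms {e : AnalyticGerm E} (he : e ∈ reachableGerms F τ S) :
    e.pt ∉ S := by
  obtain ⟨γ, -, -, hS, Γ, -, -, hp, rfl⟩ := he
  rw [hp 1 ⟨zero_le_one, le_rfl⟩]
  exact hS 1 ⟨zero_le_one, le_rfl⟩

lemma sec_mem_reachableGerms {p : E}
    (hp : p ∈ Metric.ball 0 τ) (hpS : p ∉ S) : sec F p ∈ reachableGerms F τ S :=
  ⟨fun _ => p, contDiffOn_const, hp, fun _ _ => hpS, fun _ => sec F p, continuousOn_const, rfl,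
    fun _ _ => pt_sec _ _, rfl⟩

/-- A `C¹` path leading to `e`, followed by the segment, is again an admissible path, and uniqueness
of lifts identifies its germ at the junction with `e`. -/
lemma exists_lift_segment
    (hcont : ∀ γ : ℝ → E, ContDiffOn ℝ 1 γ (Icc 0 1) → γ 0 ∈ Metric.ball 0 τ →
      (∀ t ∈ Icc (0 : ℝ) 1, γ t ∉ S) → ContinuesAlong F γ)
    {e : AnalyticGerm E} (he : e ∈ reachableGerms F τ S) {q : E}
    (hq : ∀ s ∈ Icc (0 : ℝ) 1, e.pt + s • (q - e.pt) ∉ S) :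
    ∃ Γ : C(I, AnalyticGerm E), Γ 0 = e ∧
      ∀ s, (Γ s).pt = e.pt + Real.smoothTransition s • (q - e.pt) ∧
        Γ s ∈ reachableGerms F τ S := by
  obtain ⟨γ, hγ, hγ0, hS, Γ, hΓ, hΓ0, hp, hΓ1⟩ := he
  have h11 : (1 : ℝ) ∈ Icc (0 : ℝ) 1 := ⟨zero_le_one, le_rfl⟩
  have hγ1 : γ 1 = e.pt := by rw [← hp 1 h11, hΓ1]
  have hsm : ∀ x : ℝ, Real.smoothTransition x ∈ Icc (0 : ℝ) 1 := fun x =>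
    ⟨Real.smoothTransition.nonneg x, Real.smoothTransition.le_one x⟩
  -- `smoothTransition` is flat at both ends, so the concatenation stays `C¹` at `t = 1/2`.
  let θ : ℝ → E := fun t => γ (Real.smoothTransition (2 * t)) +
    Real.smoothTransition (2 * t - 1) • (q - e.pt)
  have hθ : ContDiffOn ℝ 1 θ (Icc 0 1) := by
    have hc : ContDiff ℝ 1 Real.smoothTransition := Real.smoothTransition.contDiff
    refine ContDiffOn.add ?_ ?_
    · refine hγ.comp (ContDiff.contDiffOn ?_) fun x _ => hsm _
      exact hc.comp (contDiff_const.mul contDiff_id)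
    · refine ContDiff.contDiffOn ?_
      exact (hc.comp ((contDiff_const.mul contDiff_id).sub contDiff_const)).smul contDiff_const
  have hθl : ∀ t, t ≤ 1 / 2 → θ t = γ (Real.smoothTransition (2 * t)) := fun t ht => by
    simp only [θ]
    rw [Real.smoothTransition.zero_of_nonpos (x := 2 * t - 1) (by linarith), zero_smul, add_zero]
  have hθr : ∀ t, 1 / 2 ≤ t → θ t = e.pt + Real.smoothTransition (2 * t - 1) • (q - e.pt) :=
    fun t ht => by
      simp only [θ]
      rw [Real.smoothTransition.one_of_one_le (x := 2 * t) (by linarith), hγ1]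
  have hθ0 : θ 0 = γ 0 := by
    rw [hθl 0 (by norm_num)]; simp
  have hθS : ∀ t, θ t ∉ S := fun t => by
    rcases le_total t (1 / 2) with h | h
    · rw [hθl t h]; exact hS _ (hsm _)
    · rw [hθr t h]; exact hq _ (hsm _)
  obtain ⟨Λ, hΛ, hΛ0, hΛp⟩ := (hcont θ hθ (hθ0 ▸ hγ0) fun t _ => hθS t).exists_lift hθ.continuousOn
  have hhalf : Λ (1 / 2) = e := by
    have h1 : EqOn Λ (fun t => Γ (Real.smoothTransition (2 * t))) (Icc 0 (1 / 2)) := by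
      refine eqOn_of_preconnected isPreconnected_Icc
        (hΛ.mono (Icc_subset_Icc le_rfl (by norm_num))) ?_ ?_ (a := 0) ⟨le_rfl, by norm_num⟩ ?_
      · refine hΓ.comp ?_ fun t _ => hsm _
        exact (Real.smoothTransition.continuous.comp (by fun_prop)).continuousOn
      · intro t ht
        rw [hΛp t ⟨ht.1, ht.2.trans (by norm_num)⟩, hp _ (hsm _), hθl t ht.2]
      · simp [hΛ0, hΓ0, hθ0]
    have h2 := h1 (show (1 / 2 : ℝ) ∈ Icc (0 : ℝ) (1 / 2) from ⟨by norm_num, le_rfl⟩)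
    simp only at h2
    rw [h2, Real.smoothTransition.one_of_one_le (by norm_num), hΓ1]
  have hmem : ∀ s : I, (1 + (s : ℝ)) / 2 ∈ Icc (0 : ℝ) 1 := fun s =>
    ⟨by linarith [s.2.1], by linarith [s.2.2]⟩
  refine ⟨⟨fun s => Λ ((1 + s) / 2), hΛ.comp_continuous (by fun_prop) hmem⟩, ?_, fun s => ⟨?_, ?_⟩⟩
  · simpa using hhalf
  · simp only [ContinuousMap.coe_mk]
    rw [hΛp _ (hmem s), hθr _ (by linarith [s.2.1])]
    congr 3; ring
  -- Stopping `θ` at time `(1 + s) / 2` and rescaling shows that the intermediate germ is reachable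
  -- too.
  · have hm : ∀ t ∈ Icc (0 : ℝ) 1, (1 + (s : ℝ)) / 2 * t ∈ Icc (0 : ℝ) 1 := fun t ht =>
      ⟨mul_nonneg (hmem s).1 ht.1, mul_le_one₀ (hmem s).2 ht.1 ht.2⟩
    refine ⟨fun t => θ ((1 + s) / 2 * t), ?_, by simpa [hθ0] using hγ0, fun t _ => hθS _,
      fun t => Λ ((1 + s) / 2 * t), ?_, by simp [hΛ0], fun t ht => hΛp _ (hm t ht), by simp⟩
    · exact hθ.comp (ContDiff.contDiffOn (contDiff_const.mul contDiff_id)) hm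
    · exact hΛ.comp (by fun_prop) hm

/-- The germ continues along every segment from its base point inside the ball. Homotopy lifting
makes the final germs depend continuously on the endpoint, and a continuous section over an open set
is an analytic function. -/
lemma exists_extension_of_mem_reachableGerms
    (hcont : ∀ γ : ℝ → E, ContDiffOn ℝ 1 γ (Icc 0 1) → γ 0 ∈ Metric.ball 0 τ →
      (∀ t ∈ Icc (0 : ℝ) 1, γ t ∉ S) → ContinuesAlong F γ)
    {e : AnalyticGerm E} (he : e ∈ reachableGerms F τ S) {p : E} {r : ℝ}
    (hball : Metric.ball p r ⊆ Sᶜ) (hep : e.pt ∈ Metric.ball p r) :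
    ∃ f : E → ℂ, AnalyticOnNhd ℂ f (Metric.ball p r) ∧ sec f e.pt = e ∧
      ∀ q ∈ Metric.ball p r, sec f q ∈ reachableGerms F τ S := by
  classical
  let K : C(I × Metric.ball p r, E) :=
    ⟨fun x => e.pt + Real.smoothTransition x.1 • ((x.2 : E) - e.pt), by
      have := Real.smoothTransition.continuous
      fun_prop⟩
  have hseg : ∀ q ∈ Metric.ball p r, ∀ s ∈ Icc (0 : ℝ) 1, e.pt + s • (q - e.pt) ∉ S :=
    fun q hq s hs => hball ((convex_ball p r).add_smul_sub_mem hep hq hs)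
  obtain ⟨G, hG0, hG⟩ := exists_homotopy_lift (reachableGerms F τ S) K (fun _ => e)
    continuous_const fun q => by
      obtain ⟨Γ, h0, h1⟩ := exists_lift_segment hcont he (hseg q q.2)
      exact ⟨Γ, h0, h1⟩
  let u : E → AnalyticGerm E := fun q => if h : q ∈ Metric.ball p r then G (1, ⟨q, h⟩) else e
  have hu : ∀ q : Metric.ball p r, u q = G (1, q) := fun q => dif_pos q.2
  have huc : ContinuousOn u (Metric.ball p r) := by
    rw [continuousOn_iff_continuous_domRestrict]
    have : (Metric.ball p r).domRestrict u = fun q => G (1, q) := by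
      ext q; exact hu q
    rw [this]; fun_prop
  have hup : ∀ q ∈ Metric.ball p r, (u q).pt = q := fun q hq => by
    rw [hu ⟨q, hq⟩, (hG _).1]
    simp [K]
  have hval := analyticAt_val_section Metric.isOpen_ball huc hup
  refine ⟨fun q => (u q).val, fun q hq => (hval q hq).1, ?_, fun q hq => ?_⟩
  · rw [(hval _ hep).2, hu ⟨_, hep⟩]
    have h1 : EqOn (fun s : I => G (s, ⟨e.pt, hep⟩)) (fun _ => e) univ := by
      refine eqOn_of_preconnected isPreconnected_univ (by fun_prop) continuousOn_const ?_
        (mem_univ 0) (hG0 _)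
      intro s _
      simp [(hG _).1, K]
    exact h1 (mem_univ 1)
  · rw [(hval _ hq).2, hu ⟨_, hq⟩]
    exact (hG _).2

end Reachable

/-! ### Analytic dependence of integrals on parameters. -/

section ParametricIntegral

open MeasureTheory intervalIntegral

variable {E E' : Type*} [NormedAddCommGroup E] [NormedSpace ℂ E]
  [NormedAddCommGroup E'] [NormedSpace ℂ E']

-- The joint power series is recentred at `(c θ, w₀)` and integrated coefficient by coefficient;
-- dominated convergence sums the result. No finite dimensionality is needed.
open ContinuousLinearMap in
lemma analyticAt_integral_of_hasFPowerSeriesOnBall {G : E' × E → ℂ}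
    {p : FormalMultilinearSeries ℂ (E' × E) ℂ} {u₀ : E'} {w₀ : E} {ρ : NNReal} (hρ : 0 < ρ)
    (hG : HasFPowerSeriesOnBall G p (u₀, w₀) (2 * ρ + ρ : NNReal)) {a b : ℝ} (hab : a ≤ b) {c : ℝ → E'}
    (hc : ContinuousOn c (Icc a b)) (hcu : ∀ θ ∈ Icc a b, ‖c θ - u₀‖₊ < ρ) :
    AnalyticAt ℂ (fun w => ∫ θ in a..b, G (c θ, w)) w₀ := by
  -- Radius `3ρ` leaves room for a recentring by less than `ρ` and an increment less than `ρ`, with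
  -- total strictly inside the disc of convergence.
  have hrad : ((ρ + ρ : NNReal) : ENNReal) < p.radius := by
    refine lt_of_lt_of_le ?_ hG.r_le
    exact_mod_cast (by linarith [show (0 : ℝ) < ρ from hρ] : (ρ + ρ : ℝ) < 2 * ρ + ρ)
  have hrad0 : 0 < p.radius := bot_lt_of_lt hrad
  let y : ℝ → E' × E := fun θ => (c θ - u₀, 0)
  have hy : ∀ θ ∈ Icc a b, ‖y θ‖₊ < ρ := fun θ hθ => by
    have : ‖y θ‖₊ = ‖c θ - u₀‖₊ := by simp [y, Prod.nnnorm_def]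
    rw [this]; exact hcu θ hθ
  have hyc : ContinuousOn y (Icc a b) := (hc.sub continuousOn_const).prodMk continuousOn_const
  -- A bound for the `k`-th recentred coefficient that is uniform in `θ`.
  let B : ℕ → NNReal := fun k =>
    ∑' s : Σ l : ℕ, { s : Finset (Fin (k + l)) // s.card = l }, ‖p (k + s.1)‖₊ * ρ ^ s.1
  have hs1 := p.changeOriginSeries_summable_aux₁ (r := ρ) (r' := ρ) (by exact_mod_cast hrad)
  have hB : Summable fun k => B k * ρ ^ k := by
    refine (NNReal.summable_sigma.1 hs1).2.congr fun k => ?_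
    rw [← NNReal.tsum_mul_right]
  have hs2 : ∀ k, Summable fun s : Σ l : ℕ, { s : Finset (Fin (k + l)) // s.card = l } =>
      ‖p (k + s.1)‖₊ * ρ ^ s.1 := fun k =>
    p.changeOriginSeries_summable_aux₂ (lt_of_le_of_lt (by simp) hrad) k
  have hyr : ∀ θ ∈ Icc a b, (‖y θ‖₊ : ENNReal) < p.radius := fun θ hθ =>
    lt_trans (b := (ρ : ENNReal)) (by exact_mod_cast hy θ hθ) (lt_of_le_of_lt (by simp) hrad)
  have hbound : ∀ θ ∈ Icc a b, ∀ k, ‖p.changeOrigin (y θ) k‖₊ ≤ B k := fun θ hθ k => by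
    have h1 := hyr θ hθ
    refine (p.nnnorm_changeOrigin_le k h1).trans ?_
    refine Summable.tsum_le_tsum (fun s => ?_) (p.changeOriginSeries_summable_aux₂ h1 k) (hs2 k)
    gcongr
    exact (hy θ hθ).le
  have hcont : ∀ k, ContinuousOn (fun θ => p.changeOrigin (y θ) k) (Icc a b) := fun k => by
    refine (p.hasFPowerSeriesOnBall_changeOrigin k hrad0).continuousOn.comp hyc fun θ hθ => ?_
    rw [mem_eball_zero_iff]
    exact hyr θ hθ
  have hint : ∀ k, IntervalIntegrable (fun θ => p.changeOrigin (y θ) k) volume a b := fun k =>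
    ContinuousOn.intervalIntegrable (by rw [uIcc_of_le hab]; exact hcont k)
  have hsum : ∀ θ ∈ Icc a b, ∀ v : E, ‖v‖₊ < ρ →
      HasSum (fun k => p.changeOrigin (y θ) k fun _ => ((0 : E'), v)) (G (c θ, w₀ + v)) :=
    fun θ hθ v hv => by
      have h1 : (‖y θ‖₊ : ENNReal) < (2 * ρ + ρ : NNReal) := by
        have := hy θ hθ
        exact_mod_cast lt_of_lt_of_le this (by simp)
      have h2 := (hG.changeOrigin h1).hasSum (y := ((0 : E'), v)) (by
        rw [mem_eball_zero_iff, lt_tsub_iff_right]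
        have h3 : ‖((0 : E'), v)‖ₑ = ‖v‖₊ := by
          simp [enorm_eq_nnnorm, Prod.nnnorm_def]
        rw [h3]
        have h4 := add_lt_add hv (hy θ hθ)
        have h5 : ‖v‖₊ + ‖y θ‖₊ < 2 * ρ + ρ := lt_of_lt_of_le h4 (by rw [two_mul]; simp)
        exact_mod_cast h5)
      simpa [y] using h2
  let PF : FormalMultilinearSeries ℂ E ℂ := fun k =>
    (∫ θ in a..b, p.changeOrigin (y θ) k).compContinuousLinearMap fun _ => inr ℂ E' E
  have hPF : ∀ k, ‖PF k‖ * (ρ : ℝ) ^ k ≤ (b - a) * (B k * ρ ^ k : NNReal) := fun k => by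
    have h1 : ‖∫ θ in a..b, p.changeOrigin (y θ) k‖ ≤ B k * |b - a| :=
      norm_integral_le_of_norm_le_const fun θ hθ => by
        rw [uIoc_of_le hab] at hθ
        exact_mod_cast hbound θ ⟨hθ.1.le, hθ.2⟩ k
    have h2 : ‖PF k‖ ≤ ‖∫ θ in a..b, p.changeOrigin (y θ) k‖ := by
      refine (ContinuousMultilinearMap.norm_compContinuousLinearMap_le _ _).trans ?_
      refine mul_le_of_le_one_right (norm_nonneg _) ?_
      exact Finset.prod_le_one (fun _ _ => norm_nonneg _) fun _ _ => norm_inr_le_one ℂ E' E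
    rw [abs_of_nonneg (sub_nonneg.2 hab)] at h1
    push_cast
    calc ‖PF k‖ * (ρ : ℝ) ^ k ≤ (B k * (b - a)) * (ρ : ℝ) ^ k := by gcongr; exact h2.trans h1
      _ = _ := by ring
  refine ⟨PF, ρ, ?_⟩
  refine ⟨?_, by exact_mod_cast hρ, fun {v} hv => ?_⟩
  · refine PF.le_radius_of_summable_norm ?_
    refine Summable.of_nonneg_of_le (fun k => by positivity) hPF ?_
    exact (NNReal.summable_coe.2 hB).mul_left _
  · have hv' : ‖v‖₊ < ρ := by
      rw [mem_eball_zero_iff] at hv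
      exact_mod_cast hv
    have h1 := hasSum_integral_of_dominated_convergence (a := a) (b := b) (μ := volume)
      (F := fun k θ => p.changeOrigin (y θ) k fun _ => ((0 : E'), v))
      (f := fun θ => G (c θ, w₀ + v)) (fun k _ => ((B k * ρ ^ k : NNReal) : ℝ))
      (fun k => by
        have := (ContinuousMultilinearMap.apply ℂ (fun _ : Fin k => E' × E) ℂ
          (fun _ => ((0 : E'), v))).continuous.comp_continuousOn (hcont k)
        rw [uIoc_of_le hab]
        exact (this.mono Ioc_subset_Icc_self).aestronglyMeasurable measurableSet_Ioc)
      (fun k => Eventually.of_forall fun θ hθ => by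
        rw [uIoc_of_le hab] at hθ
        have h2 := (p.changeOrigin (y θ) k).le_opNorm fun _ => ((0 : E'), v)
        refine h2.trans ?_
        simp only [Finset.prod_const, Finset.card_univ, Fintype.card_fin]
        have h3 : ‖((0 : E'), v)‖ = ‖v‖ := by simp [Prod.norm_def]
        rw [h3]
        push_cast
        have h4 : ‖p.changeOrigin (y θ) k‖ ≤ B k := hbound θ ⟨hθ.1.le, hθ.2⟩ k
        have h5 : ‖v‖ ≤ ρ := hv'.le
        gcongr)
      (Eventually.of_forall fun θ _ => NNReal.summable_coe.2 hB)
      (by simp)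
      (Eventually.of_forall fun θ hθ => by
        rw [uIoc_of_le hab] at hθ
        exact hsum θ ⟨hθ.1.le, hθ.2⟩ v hv')
    convert h1 using 2 with k
    simp only [PF, ContinuousMultilinearMap.compContinuousLinearMap_apply, inr_apply]
    exact ((ContinuousMultilinearMap.apply ℂ (fun _ : Fin k => E' × E) ℂ
          (fun _ => ((0 : E'), v))).intervalIntegral_comp_comm (hint k)).symm

/-- Integrals of analytic functions depend analytically on parameters. -/
lemma analyticAt_integral_of_local {g : ℝ → E → ℂ} {c : ℝ → E'} {a b : ℝ} (hab : a ≤ b)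
    (hc : ContinuousOn c (Icc a b)) {w₀ : E}
    (hg : ∀ θ₀ ∈ Icc a b, ∃ G : E' × E → ℂ, AnalyticAt ℂ G (c θ₀, w₀) ∧
      ∀ᶠ x : ℝ × E in 𝓝 (θ₀, w₀), x.1 ∈ Icc a b → g x.1 x.2 = G (c x.1, x.2)) :
    AnalyticAt ℂ (fun w => ∫ θ in a..b, g θ w) w₀ := by
  have hloc : ∀ θ₀ : Icc a b, ∃ U : Set ℝ, IsOpen U ∧ (θ₀ : ℝ) ∈ U ∧ ∀ a' b', a' ≤ b' →
      Icc a' b' ⊆ Icc a b → Icc a' b' ⊆ U →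
      AnalyticAt ℂ (fun w => ∫ θ in a'..b', g θ w) w₀ ∧
        ∀ᶠ w in 𝓝 w₀, IntervalIntegrable (fun θ => g θ w) volume a' b' := by
    rintro ⟨θ₀, hθ₀⟩
    obtain ⟨G, ⟨p, r, hG⟩, hgG⟩ := hg θ₀ hθ₀
    obtain ⟨r', hr'0, hr'⟩ := ENNReal.lt_iff_exists_nnreal_btwn.1 hG.r_pos
    have hr'0 : 0 < r' := by exact_mod_cast hr'0
    have h3 : 2 * (r' / 3) + r' / 3 = r' := by
      rw [← NNReal.coe_inj]; push_cast; ring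
    have hG' : HasFPowerSeriesOnBall G p (c θ₀, w₀) (2 * (r' / 3) + r' / 3 : NNReal) := by
      rw [h3]; exact hG.mono (by exact_mod_cast hr'0) hr'.le
    have hρ : 0 < r' / 3 := by positivity
    have hcw : ∀ᶠ θ in 𝓝 θ₀, θ ∈ Icc a b → ‖c θ - c θ₀‖₊ < r' / 3 := by
      have h4 := (hc θ₀ hθ₀).eventually (Metric.ball_mem_nhds (c θ₀) (show 0 < ((r' / 3 : NNReal) : ℝ) from hρ))
      rw [eventually_nhdsWithin_iff] at h4
      filter_upwards [h4] with θ hθ hm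
      have := hθ hm
      rwa [dist_eq_norm] at this
    rw [nhds_prod_eq, Filter.eventually_prod_iff] at hgG
    obtain ⟨pa, hpa, pb, hpb, hpp⟩ := hgG
    obtain ⟨U, hU, hUo, hθU⟩ := eventually_nhds_iff.1 (hcw.and hpa)
    refine ⟨U, hUo, hθU, fun a' b' hab' hsub hsubU => ⟨?_, ?_⟩⟩
    · have h5 := analyticAt_integral_of_hasFPowerSeriesOnBall hρ hG' hab' (hc.mono hsub)
        fun θ hθ => (hU θ (hsubU hθ)).1 (hsub hθ)
      refine h5.congr ?_
      filter_upwards [hpb] with w hw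
      refine integral_congr fun θ hθ => ?_
      rw [uIcc_of_le hab'] at hθ
      exact (hpp (hU θ (hsubU hθ)).2 hw (hsub hθ)).symm
    · filter_upwards [hpb, Metric.ball_mem_nhds w₀ (show 0 < ((r' / 3 : NNReal) : ℝ) from hρ)] with w hw hwb
      refine ContinuousOn.intervalIntegrable ?_
      rw [uIcc_of_le hab']
      have h6 : ContinuousOn (fun θ => G (c θ, w)) (Icc a' b') := by
        refine hG'.continuousOn.comp ((hc.mono hsub).prodMk continuousOn_const) fun θ hθ => ?_
        rw [Metric.mem_eball, edist_eq_enorm_sub]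
        have h7 := (hU θ (hsubU hθ)).1 (hsub hθ)
        have h8 : ‖w - w₀‖₊ < r' / 3 := by
          rw [mem_ball_iff_norm] at hwb; exact hwb
        have h9 : ‖((c θ, w) : E' × E) - (c θ₀, w₀)‖₊ < 2 * (r' / 3) + r' / 3 := by
          rw [Prod.nnnorm_def]
          simp only [Prod.fst_sub, Prod.snd_sub, sup_lt_iff]
          have : r' / 3 ≤ 2 * (r' / 3) + r' / 3 := by simp
          exact ⟨h7.trans_le this, h8.trans_le this⟩
        rw [enorm_eq_nnnorm]
        exact_mod_cast h9
      exact h6.congr fun θ hθ => hpp (hU θ (hsubU hθ)).2 hw (hsub hθ)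
  choose U hUo hUm hU using hloc
  obtain ⟨t, t_0, t_mono, ⟨n_max, h_max⟩, t_sub⟩ :=
    exists_monotone_Icc_subset_open_cover_Icc (c := fun θ : Icc a b => Subtype.val ⁻¹' U θ) hab
      (fun θ => (hUo θ).preimage continuous_subtype_val)
      (fun θ _ => mem_iUnion.2 ⟨θ, hUm θ⟩)
  -- Integrability for nearby `w` is carried through the induction because adding adjacent integrals
  -- requires it.
  have key : ∀ n, AnalyticAt ℂ (fun w => ∫ θ in a..(t n : ℝ), g θ w) w₀ ∧
      ∀ᶠ w in 𝓝 w₀, IntervalIntegrable (fun θ => g θ w) volume a (t n) := by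
    intro n
    induction n with
    | zero => simp [t_0, analyticAt_const]
    | succ n ih =>
      obtain ⟨i, hi⟩ := t_sub n
      have hsub : Icc (t n : ℝ) (t (n + 1)) ⊆ Icc a b := Icc_subset_Icc (t n).2.1 (t (n + 1)).2.2
      obtain ⟨h1, h2⟩ := hU i (t n) (t (n + 1)) (t_mono n.le_succ) hsub fun θ hθ =>
        hi (show (⟨θ, hsub hθ⟩ : Icc a b) ∈ Icc (t n) (t (n + 1)) from hθ)
      refine ⟨(ih.1.add h1).congr ?_, ?_⟩
      · filter_upwards [ih.2, h2] with w hw1 hw2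
        exact integral_add_adjacent_intervals hw1 hw2
      · filter_upwards [ih.2, h2] with w hw1 hw2
        exact hw1.trans hw2
  have := (key n_max).1
  rwa [h_max _ le_rfl] at this

end ParametricIntegral

/-! ### Primitives in the first variable and the Hartogs figure. -/

section FirstVariable

open AnalyticGerm intervalIntegral

variable {W : Type*} [NormedAddCommGroup W] [NormedSpace ℂ W]

/-- The partial derivative in the first variable. -/
noncomputable def firstDeriv (f : ℂ × W → ℂ) (q : ℂ × W) : ℂ := fderiv ℂ f q (1, 0)

lemma AnalyticAt.firstDeriv {f : ℂ × W → ℂ} {q : ℂ × W} (hf : AnalyticAt ℂ f q) :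
    AnalyticAt ℂ (firstDeriv f) q :=
  ((ContinuousLinearMap.apply ℂ ℂ ((1, 0) : ℂ × W)).analyticAt _).comp hf.fderiv

lemma AnalyticAt.hasDerivAt_slice {f : ℂ × W → ℂ} {x : ℂ} {w : W} (hf : AnalyticAt ℂ f (x, w)) :
    HasDerivAt (fun x => f (x, w)) (_root_.firstDeriv f (x, w)) x := by
  have h1 : HasDerivAt (fun x : ℂ => (x, w)) ((1, 0) : ℂ × W) x :=
    (hasDerivAt_id x).prodMk (hasDerivAt_const x w)
  exact hf.differentiableAt.hasFDerivAt.comp_hasDerivAt x h1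

lemma Filter.EventuallyEq.firstDeriv {f g : ℂ × W → ℂ} {q : ℂ × W} (h : f =ᶠ[𝓝 q] g) :
    firstDeriv f =ᶠ[𝓝 q] firstDeriv g := by
  filter_upwards [h.fderiv (𝕜 := ℂ)] with r hr
  simp only [_root_.firstDeriv, hr]

/-- The primitive `∫_c^x f(·, w)` along a segment. -/
noncomputable def segmentPrimitive {W : Type*} (c : ℂ) (f : ℂ × W → ℂ) (q : ℂ × W) : ℂ :=
  ∫ t in (0 : ℝ)..1, f (c + t * (q.1 - c), q.2) * (q.1 - c)

@[simp] lemma segmentPrimitive_self {W : Type*} (c : ℂ) (f : ℂ × W → ℂ) (w : W) :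
    segmentPrimitive c f (c, w) = 0 := by
  simp [segmentPrimitive]

lemma add_mul_sub_mem_ball {c x : ℂ} {r : ℝ} (hx : x ∈ Metric.ball c r) {t : ℝ}
    (ht : t ∈ Icc (0 : ℝ) 1) : c + t * (x - c) ∈ Metric.ball c r := by
  have hr : 0 < r := dist_nonneg.trans_lt hx
  have := (convex_ball c r).add_smul_sub_mem (Metric.mem_ball_self hr) hx ht
  simpa using this

lemma analyticAt_segmentPrimitive {c : ℂ} {r : ℝ} {N : Set W} {f : ℂ × W → ℂ}
    (hf : AnalyticOnNhd ℂ f (Metric.ball c r ×ˢ N)) :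
    AnalyticOnNhd ℂ (segmentPrimitive c f) (Metric.ball c r ×ˢ N) := by
  rintro ⟨x₀, w₀⟩ ⟨hx, hw⟩
  refine analyticAt_integral_of_local (E' := ℂ)
    (g := fun (t : ℝ) (q : ℂ × W) => f (c + t * (q.1 - c), q.2) * (q.1 - c))
    (c := fun t => (t : ℂ)) zero_le_one (by fun_prop) fun θ hθ => ?_
  refine ⟨fun y => f (c + y.1 * (y.2.1 - c), y.2.2) * (y.2.1 - c), ?_,
    Eventually.of_forall fun _ _ => rfl⟩
  have h1 := hf (c + θ * (x₀ - c), w₀) ⟨add_mul_sub_mem_ball hx hθ, hw⟩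
  have a1 : AnalyticAt ℂ (fun y : ℂ × ℂ × W => y.1) ((θ : ℂ), x₀, w₀) := analyticAt_fst
  have a2 : AnalyticAt ℂ (fun y : ℂ × ℂ × W => y.2.1 - c) ((θ : ℂ), x₀, w₀) :=
    (((ContinuousLinearMap.fst ℂ ℂ W).comp
      (ContinuousLinearMap.snd ℂ ℂ (ℂ × W))).analyticAt _).sub analyticAt_const
  have a3 : AnalyticAt ℂ (fun y : ℂ × ℂ × W => y.2.2) ((θ : ℂ), x₀, w₀) :=
    ((ContinuousLinearMap.snd ℂ ℂ W).comp (ContinuousLinearMap.snd ℂ ℂ (ℂ × W))).analyticAt _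
  exact (AnalyticAt.fun_comp (g := f)
    (f := fun y : ℂ × ℂ × W => (c + y.1 * (y.2.1 - c), y.2.2)) h1 ((analyticAt_const.add (a1.mul a2)).prod a3)).mul a2

/-- On each slice the holomorphic function has a primitive on the disc, and the fundamental theorem
of calculus along the segment identifies the two up to a constant. -/
lemma firstDeriv_segmentPrimitive {c : ℂ} {r : ℝ} {N : Set W} {f : ℂ × W → ℂ}
    (hf : AnalyticOnNhd ℂ f (Metric.ball c r ×ˢ N)) {q : ℂ × W}
    (hq : q ∈ Metric.ball c r ×ˢ N) : firstDeriv (segmentPrimitive c f) q = f q := by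
  obtain ⟨x₀, w₀⟩ := q
  obtain ⟨hx, hw⟩ := hq
  have hd : DifferentiableOn ℂ (fun x => f (x, w₀)) (Metric.ball c r) := fun x hx =>
    (hf (x, w₀) ⟨hx, hw⟩).hasDerivAt_slice.differentiableAt.differentiableWithinAt
  obtain ⟨g, hg⟩ := hd.isExactOn_ball
  have heq : ∀ x ∈ Metric.ball c r, segmentPrimitive c f (x, w₀) = g x - g c := fun x hx => by
    have h1 : ∀ t ∈ uIcc (0 : ℝ) 1, HasDerivAt (fun t : ℝ => g (c + t * (x - c)))
        (f (c + t * (x - c), w₀) * (x - c)) t := fun t ht => by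
      rw [uIcc_of_le zero_le_one] at ht
      have h2 := hg _ (add_mul_sub_mem_ball hx ht)
      have h3 : HasDerivAt (fun t : ℝ => c + (t : ℂ) * (x - c)) (x - c) t := by
        have := ((Complex.ofRealCLM.hasDerivAt (x := t)).mul_const (x - c)).const_add c
        simpa using this
      exact h2.comp t h3
    have hci : ContinuousOn (fun t : ℝ => f (c + t * (x - c), w₀) * (x - c)) (uIcc 0 1) := by
      refine ContinuousOn.mul ?_ continuousOn_const
      refine hd.continuousOn.comp (f := fun t : ℝ => c + (t : ℂ) * (x - c)) (by fun_prop) fun t ht => ?_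
      rw [uIcc_of_le zero_le_one] at ht
      exact add_mul_sub_mem_ball hx ht
    have := integral_eq_sub_of_hasDerivAt h1 hci.intervalIntegrable
    simpa [segmentPrimitive] using this
  have h1 := (analyticAt_segmentPrimitive hf (x₀, w₀) ⟨hx, hw⟩).hasDerivAt_slice
  have h2 : HasDerivAt (fun x => segmentPrimitive c f (x, w₀)) (f (x₀, w₀)) x₀ := by
    refine ((hg x₀ hx).sub_const (g c)).congr_of_eventuallyEq ?_
    filter_upwards [Metric.isOpen_ball.mem_nhds hx] with x hx using heq x hx
  exact h1.unique h2

lemma eq_of_firstDeriv_eq {c x₀ : ℂ} {r : ℝ} {w : W} {f g : ℂ × W → ℂ}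
    (hf : ∀ x ∈ Metric.ball c r, AnalyticAt ℂ f (x, w))
    (hg : ∀ x ∈ Metric.ball c r, AnalyticAt ℂ g (x, w))
    (hfg : ∀ x ∈ Metric.ball c r, firstDeriv f (x, w) = firstDeriv g (x, w))
    (hx₀ : x₀ ∈ Metric.ball c r) (h : f (x₀, w) = g (x₀, w)) :
    ∀ x ∈ Metric.ball c r, f (x, w) = g (x, w) := by
  have := Metric.isOpen_ball.eqOn_of_deriv_eq (convex_ball c r).isPreconnected
    (f := fun x => f (x, w)) (g := fun x => g (x, w))
    (fun x hx => (hf x hx).hasDerivAt_slice.differentiableAt.differentiableWithinAt)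
    (fun x hx => (hg x hx).hasDerivAt_slice.differentiableAt.differentiableWithinAt)
    (fun x hx => by
      rw [(hf x hx).hasDerivAt_slice.deriv, (hg x hx).hasDerivAt_slice.deriv, hfg x hx]) hx₀ h
  exact this

/-- A primitive in `x` is determined up to a function of `w`, which the values on `{x₀} × W` fix. -/
lemma eventuallyEq_of_firstDeriv {x₀ : ℂ} {w₀ : W} {f g : ℂ × W → ℂ}
    (hf : AnalyticAt ℂ f (x₀, w₀)) (hg : AnalyticAt ℂ g (x₀, w₀))
    (hfg : firstDeriv f =ᶠ[𝓝 (x₀, w₀)] firstDeriv g)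
    (h : ∀ᶠ w in 𝓝 w₀, f (x₀, w) = g (x₀, w)) : f =ᶠ[𝓝 (x₀, w₀)] g := by
  obtain ⟨r, hr, hball⟩ := Metric.eventually_nhds_iff_ball.1
    (hf.eventually_analyticAt.and (hg.eventually_analyticAt.and hfg))
  have hmem : ∀ x ∈ Metric.ball x₀ r, ∀ w ∈ Metric.ball w₀ r,
      (x, w) ∈ Metric.ball (x₀, w₀) r := fun x hx w hw => by
    rw [← ball_prod_same]; exact ⟨hx, hw⟩
  have h1 : ∀ᶠ q : ℂ × W in 𝓝 (x₀, w₀), f (x₀, q.2) = g (x₀, q.2) :=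
    (continuous_snd.tendsto' (x₀, w₀) w₀ rfl).eventually h
  filter_upwards [h1, Metric.ball_mem_nhds _ hr] with q hq hqb
  rw [← ball_prod_same] at hqb
  exact eq_of_firstDeriv_eq (fun x hx => (hball _ (hmem x hx q.2 hqb.2)).1)
    (fun x hx => (hball _ (hmem x hx q.2 hqb.2)).2.1)
    (fun x hx => (hball _ (hmem x hx q.2 hqb.2)).2.2) (Metric.mem_ball_self hr) hq q.1 hqb.1

namespace AnalyticGerm

/-- The derivative of a germ in the first variable. -/
noncomputable def dx (e : AnalyticGerm (ℂ × W)) : AnalyticGerm (ℂ × W) := sec (firstDeriv e.rep) e.pt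

@[simp] lemma pt_dx (e : AnalyticGerm (ℂ × W)) : e.dx.pt = e.pt := pt_sec _ _

lemma dx_sec {f : ℂ × W → ℂ} {q : ℂ × W} (hf : AnalyticAt ℂ f q) :
    dx (sec f q) = sec (firstDeriv f) q := by
  obtain ⟨x, w⟩ := q
  unfold dx
  rw [pt_sec]
  have h1 : AnalyticAt ℂ (sec f (x, w)).rep (x, w) := by simpa using (sec f (x, w)).analyticAt_rep
  have h2 : sec (sec f (x, w)).rep (x, w) = sec f (x, w) := by simpa using (sec f (x, w)).sec_rep
  exact sec_congr ((sec_eq_sec h1 hf).1 h2).firstDeriv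

/-- A germ whose derivative in the first variable extends to `f` on a product extends itself to a
product with the same first factor. -/
lemma exists_primitive_extending {c : ℂ} {r : ℝ} {N : Set W} (hN : IsOpen N) {f : ℂ × W → ℂ}
    (hf : AnalyticOnNhd ℂ f (Metric.ball c r ×ˢ N)) {e : AnalyticGerm (ℂ × W)} {x₀ : ℂ} {w₀ : W}
    (hx₀ : x₀ ∈ Metric.ball c r) (hw₀ : w₀ ∈ N) (hp : e.pt = (x₀, w₀))
    (he : e.dx = sec f (x₀, w₀)) :
    ∃ (N' : Set W) (Φ : ℂ × W → ℂ), IsOpen N' ∧ w₀ ∈ N' ∧ N' ⊆ N ∧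
      AnalyticOnNhd ℂ Φ (Metric.ball c r ×ˢ N') ∧
      (∀ q ∈ Metric.ball c r ×ˢ N', firstDeriv Φ q = f q) ∧ sec Φ (x₀, w₀) = e := by
  have hΨ := analyticAt_segmentPrimitive hf
  have her : AnalyticAt ℂ e.rep (x₀, w₀) := hp ▸ e.analyticAt_rep
  have hsl : Continuous fun w : W => (x₀, w) := by fun_prop
  have hsla : ∀ (g : ℂ × W → ℂ) (q : ℂ × W), AnalyticAt ℂ g (x₀, q.2) →
      AnalyticAt ℂ (fun q => g (x₀, q.2)) q := fun g q hg =>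
    AnalyticAt.fun_comp (f := fun q : ℂ × W => (x₀, q.2)) hg (analyticAt_const.prod analyticAt_snd)
  -- The bracket is the constant of integration, a function of `w`, chosen to match `e` on `{x₀} ×
  -- W`.
  let Φ : ℂ × W → ℂ := fun q =>
    segmentPrimitive c f q + (e.rep (x₀, q.2) - segmentPrimitive c f (x₀, q.2))
  -- Only the `W` factor shrinks, since `e.rep` is used on the slice `{x₀} × W` alone; the disc
  -- keeps its radius.
  let N' : Set W := N ∩ (fun w : W => (x₀, w)) ⁻¹' {q | AnalyticAt ℂ e.rep q}
  have hN' : IsOpen N' := hN.inter ((isOpen_analyticAt ℂ e.rep).preimage hsl)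
  have hconst : ∀ q ∈ Metric.ball c r ×ˢ N', AnalyticAt ℂ
      (fun q : ℂ × W => e.rep (x₀, q.2) - segmentPrimitive c f (x₀, q.2)) q := fun q hq =>
    (hsla _ q hq.2.2).sub (hsla _ q (hΨ _ ⟨hx₀, hq.2.1⟩))
  have hΦ : AnalyticOnNhd ℂ Φ (Metric.ball c r ×ˢ N') := fun q hq =>
    (hΨ q ⟨hq.1, hq.2.1⟩).add (hconst q hq)
  have hd : ∀ q ∈ Metric.ball c r ×ˢ N', firstDeriv Φ q = f q := fun q hq => by
    rw [← firstDeriv_segmentPrimitive hf (q := q) ⟨hq.1, hq.2.1⟩]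
    have h1 := (hΦ q hq).hasDerivAt_slice
    have h2 := (hΨ q ⟨hq.1, hq.2.1⟩).hasDerivAt_slice.add_const
      (e.rep (x₀, q.2) - segmentPrimitive c f (x₀, q.2))
    exact h1.unique h2
  refine ⟨N', Φ, hN', ⟨hw₀, her⟩, inter_subset_left, hΦ, hd, ?_⟩
  have hmem : (x₀, w₀) ∈ Metric.ball c r ×ˢ N' := ⟨hx₀, hw₀, her⟩
  rw [← e.sec_rep, hp]
  refine sec_congr (eventuallyEq_of_firstDeriv (hΦ _ hmem) her ?_ ?_)
  · have h1 : firstDeriv Φ =ᶠ[𝓝 (x₀, w₀)] f := by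
      filter_upwards [(Metric.isOpen_ball.prod hN').mem_nhds hmem] with q hq using hd q hq
    have h2 : firstDeriv e.rep =ᶠ[𝓝 (x₀, w₀)] f := by
      refine (sec_eq_sec her.firstDeriv (hf _ ⟨hx₀, hw₀⟩)).1 ?_
      rw [← he, dx, hp]
    exact h1.trans h2.symm
  · exact Eventually.of_forall fun w => by simp [Φ]

end AnalyticGerm

/-- A continuous section over a disc at fixed `w₀` is induced, on a smaller closed disc, by a
single function. -/
lemma exists_function_of_section {c : ℂ} {ρ R : ℝ} (hρR : ρ < R) {w₀ : W}
    {u : ℂ → AnalyticGerm (ℂ × W)} (hu : ContinuousOn u (Metric.ball c R))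
    (hp : ∀ x ∈ Metric.ball c R, (u x).pt = (x, w₀)) :
    ∃ f : ℂ × W → ℂ, ∀ x ∈ Metric.closedBall c ρ,
      AnalyticAt ℂ f (x, w₀) ∧ sec f (x, w₀) = u x := by
  obtain ⟨ρ', hρ', hρ'R⟩ := exists_between hρR
  have hsub : Metric.closedBall c ρ' ⊆ Metric.ball c R := Metric.closedBall_subset_ball hρ'R
  have hloc : ∀ x ∈ Metric.closedBall c ρ', ∃ δ > 0,
      AnalyticOnNhd ℂ (u x).rep (Metric.ball (x, w₀) δ) ∧
      ∀ y ∈ Metric.ball x δ, y ∈ Metric.ball c R → sec (u x).rep (y, w₀) = u y := fun x hx => by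
    have hxR := hsub hx
    have h1 : AnalyticAt ℂ (u x).rep (x, w₀) := by rw [← hp x hxR]; exact (u x).analyticAt_rep
    obtain ⟨δ₁, hδ₁, h2⟩ := Metric.eventually_nhds_iff_ball.1 h1.eventually_analyticAt
    have h3 := (hu.continuousAt (Metric.isOpen_ball.mem_nhds hxR)).eventually
      (eventually_eq_sec (u x).analyticAt_rep (u x).sec_rep)
    obtain ⟨δ₂, hδ₂, h4⟩ := Metric.eventually_nhds_iff_ball.1 h3
    refine ⟨min δ₁ δ₂, lt_min hδ₁ hδ₂, fun q hq => h2 q (Metric.ball_subset_ball (min_le_left _ _) hq),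
      fun y hy hyR => ?_⟩
    rw [← hp y hyR]
    exact ((h4 y (Metric.ball_subset_ball (min_le_right _ _) hy)).1).symm
  -- Compactness gives a common radius, after which overlapping representatives agree by the
  -- identity theorem.
  have hunif : ∃ δ > 0, ∀ x ∈ Metric.closedBall c ρ', ∃ g : ℂ × W → ℂ,
      AnalyticOnNhd ℂ g (Metric.ball (x, w₀) δ) ∧
      ∀ y ∈ Metric.ball x δ, y ∈ Metric.ball c R → sec g (y, w₀) = u y := by
    choose! δ hδ h1 h2 using hloc
    obtain ⟨s, hs, hcov⟩ := (isCompact_closedBall c ρ').elim_nhds_subcover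
      (fun x => Metric.ball x (δ x / 2))
      fun x hx => Metric.ball_mem_nhds x (half_pos (hδ x hx))
    obtain ⟨η, hη, hηs⟩ : ∃ η > 0, ∀ i ∈ s, η ≤ δ i / 2 := by
      have hfin : ∀ᶠ η : ℝ in 𝓝[>] 0, ∀ i ∈ s, η ≤ δ i / 2 := by
        rw [Finset.eventually_all]
        intro i hi
        filter_upwards [Ioo_mem_nhdsGT (half_pos (hδ i (hs i hi)))] with η hη using hη.2.le
      obtain ⟨η, h1, h2⟩ := (hfin.and self_mem_nhdsWithin).exists
      exact ⟨η, h2, h1⟩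
    refine ⟨η, hη, fun x hx => ?_⟩
    obtain ⟨i, hi, hxi⟩ := mem_iUnion₂.1 (hcov hx)
    have hdist : ∀ {z : ℝ}, z < η → dist x i + z < δ i := fun hz => by
      have := hηs i hi
      have := Metric.mem_ball.1 hxi
      linarith
    refine ⟨(u i).rep, fun q hq => h1 i (hs i hi) q ?_, fun y hy hyR => h2 i (hs i hi) y ?_ hyR⟩
    · rw [← ball_prod_same] at hq ⊢
      refine ⟨?_, ?_⟩
      · have := hdist (Metric.mem_ball.1 hq.1)
        rw [Metric.mem_ball]
        linarith [dist_triangle q.1 x i]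
      · have := hdist (Metric.mem_ball.1 hq.2)
        rw [Metric.mem_ball]
        linarith [dist_nonneg (x := x) (y := i)]
    · have := hdist (Metric.mem_ball.1 hy)
      rw [Metric.mem_ball]
      linarith [dist_triangle y x i]
  obtain ⟨δ, hδ, hg⟩ := hunif
  choose! g hga hgu using hg
  -- At `(y, w)` the representative chosen for the centre `y` is evaluated; near `(x, w₀)` this
  -- coincides with the single function `g x`.
  refine ⟨fun q => g q.1 q, fun x hx => ?_⟩
  have hx' : x ∈ Metric.closedBall c ρ' := Metric.closedBall_subset_closedBall hρ'.le hx
  have hmem0 : (x, w₀) ∈ Metric.ball (x, w₀) δ := Metric.mem_ball_self hδ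
  have heq : (fun q => g q.1 q) =ᶠ[𝓝 (x, w₀)] g x := by
    filter_upwards [Metric.ball_mem_nhds (x, w₀) (lt_min hδ (sub_pos.2 hρ'))] with q hq
    obtain ⟨y, w⟩ := q
    rw [← ball_prod_same] at hq
    obtain ⟨hy, hw⟩ := hq
    simp only [Metric.mem_ball, lt_min_iff] at hy hw hx
    have hyK : y ∈ Metric.closedBall c ρ' := by
      rw [Metric.mem_closedBall] at hx ⊢
      linarith [dist_triangle y x c]
    have hyx : (y, w₀) ∈ Metric.ball (x, w₀) δ := by
      rw [← ball_prod_same]; exact ⟨hy.1, Metric.mem_ball_self hδ⟩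
    have hpre : IsPreconnected (Metric.ball (y, w₀) δ ∩ Metric.ball (x, w₀) δ) :=
      ((convex_ball _ _).inter (convex_ball _ _)).isPreconnected
    have hge : g y =ᶠ[𝓝 (y, w₀)] g x := by
      refine (sec_eq_sec (hga y hyK _ (Metric.mem_ball_self hδ)) (hga x hx' _ hyx)).1 ?_
      rw [hgu y hyK y (Metric.mem_ball_self hδ) (hsub hyK), hgu x hx' y hy.1 (hsub hyK)]
    have := AnalyticOnNhd.eqOn_of_preconnected_of_eventuallyEq
      (fun q hq => hga y hyK q hq.1) (fun q hq => hga x hx' q hq.2) hpre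
      ⟨Metric.mem_ball_self hδ, hyx⟩ hge
    refine this (x := (y, w)) ⟨?_, ?_⟩
    · rw [← ball_prod_same]; exact ⟨Metric.mem_ball_self hδ, hw.1⟩
    · rw [← ball_prod_same]; exact ⟨hy.1, hw.1⟩
  have hgx := hga x hx' _ hmem0
  exact ⟨hgx.congr heq.symm, by
    rw [sec_congr heq, hgu x hx' x (Metric.mem_ball_self hδ) (hsub hx')]⟩

/-- Hartogs' figure: a section over a disc at fixed `w₀` extends to the disc times `N` if its
restriction to the boundary circle does. -/
lemma exists_extension_of_circle {c : ℂ} {ρ R : ℝ} (hρ : 0 < ρ) (hρR : ρ < R) {N : Set W}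
    (hN : IsOpen N) {w₀ : W} (hw₀ : w₀ ∈ N) {u : ℂ → AnalyticGerm (ℂ × W)}
    (hu : ContinuousOn u (Metric.ball c R)) (hp : ∀ x ∈ Metric.ball c R, (u x).pt = (x, w₀))
    {Γ : ℝ × W → AnalyticGerm (ℂ × W)} (hΓ : ContinuousOn Γ (Icc 0 (2 * Real.pi) ×ˢ N))
    (hΓp : ∀ q ∈ Icc 0 (2 * Real.pi) ×ˢ N, (Γ q).pt = (circleMap c ρ q.1, q.2))
    (hΓu : ∀ θ ∈ Icc 0 (2 * Real.pi), Γ (θ, w₀) = u (circleMap c ρ θ)) :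
    ∃ f : ℂ × W → ℂ, AnalyticOnNhd ℂ f (Metric.ball c ρ ×ˢ N) ∧
      ∀ x ∈ Metric.ball c ρ, sec f (x, w₀) = u x := by
  obtain ⟨g, hg⟩ := exists_function_of_section hρR hu hp
  have h2π : (0 : ℝ) ≤ 2 * Real.pi := by positivity
  -- The Cauchy integrand on the circle, with the values of the boundary germs `Γ` in place of those
  -- of a function.
  let k : ℝ → ℂ × W → ℂ := fun θ q =>
    ((circleMap c ρ θ - c) * Complex.I) * ((circleMap c ρ θ - q.1)⁻¹ * (Γ (θ, q.2)).val)
  let f : ℂ × W → ℂ := fun q => (2 * Real.pi * Complex.I)⁻¹ * ∫ θ in 0..2 * Real.pi, k θ q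
  have hloc : ∀ θ ∈ Icc 0 (2 * Real.pi), ∀ w ∈ N, ∃ h : ℂ × W → ℂ,
      AnalyticAt ℂ h (circleMap c ρ θ, w) ∧ sec h (circleMap c ρ θ, w) = Γ (θ, w) ∧
      ∀ᶠ y : ℝ × W in 𝓝 (θ, w), y.1 ∈ Icc 0 (2 * Real.pi) →
        Γ y = sec h (circleMap c ρ y.1, y.2) ∧ AnalyticAt ℂ h (circleMap c ρ y.1, y.2) := by
    intro θ hθ w hw
    have hpt := hΓp (θ, w) ⟨hθ, hw⟩
    have h1 := (hΓ (θ, w) ⟨hθ, hw⟩).eventually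
      (eventually_eq_sec (Γ (θ, w)).analyticAt_rep (Γ (θ, w)).sec_rep)
    rw [eventually_nhdsWithin_iff] at h1
    have h2 : ∀ᶠ y : ℝ × W in 𝓝 (θ, w), y.2 ∈ N :=
      (continuous_snd.tendsto' (θ, w) w rfl).eventually (hN.mem_nhds hw)
    refine ⟨(Γ (θ, w)).rep, hpt ▸ (Γ (θ, w)).analyticAt_rep, ?_, ?_⟩
    · conv_rhs => rw [← (Γ (θ, w)).sec_rep, hpt]
    · filter_upwards [h1, h2] with y hy hyN hyI
      have := hy ⟨hyI, hyN⟩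
      rwa [hΓp y ⟨hyI, hyN⟩] at this
  have hne : ∀ x ∈ Metric.ball c ρ, ∀ θ, circleMap c ρ θ - x ≠ 0 := fun x hx θ h => by
    have h1 : circleMap c ρ θ = x := sub_eq_zero.1 h
    have h2 := circleMap_mem_sphere c hρ.le θ
    rw [h1] at h2
    exact absurd (Metric.mem_sphere.1 h2) (Metric.mem_ball.1 hx).ne
  have hf : AnalyticOnNhd ℂ f (Metric.ball c ρ ×ˢ N) := by
    rintro ⟨x₀, w₁⟩ ⟨hx, hw⟩
    refine analyticAt_const.mul (analyticAt_integral_of_local (E' := ℂ) (g := k)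
      (c := circleMap c ρ) h2π (continuous_circleMap c ρ).continuousOn fun θ hθ => ?_)
    obtain ⟨h, hh, -, hΓh⟩ := hloc θ hθ w₁ hw
    refine ⟨fun y => ((y.1 - c) * Complex.I) * ((y.1 - y.2.1)⁻¹ * h (y.1, y.2.2)), ?_, ?_⟩
    · have a1 : AnalyticAt ℂ (fun y : ℂ × ℂ × W => y.1) (circleMap c ρ θ, x₀, w₁) := analyticAt_fst
      have a2 : AnalyticAt ℂ (fun y : ℂ × ℂ × W => y.2.1) (circleMap c ρ θ, x₀, w₁) :=
        ((ContinuousLinearMap.fst ℂ ℂ W).comp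
          (ContinuousLinearMap.snd ℂ ℂ (ℂ × W))).analyticAt _
      have a3 : AnalyticAt ℂ (fun y : ℂ × ℂ × W => y.2.2) (circleMap c ρ θ, x₀, w₁) :=
        ((ContinuousLinearMap.snd ℂ ℂ W).comp (ContinuousLinearMap.snd ℂ ℂ (ℂ × W))).analyticAt _
      exact ((a1.sub analyticAt_const).mul analyticAt_const).mul
        (((a1.sub a2).inv (hne x₀ hx θ)).mul (AnalyticAt.fun_comp (g := h) hh (a1.prod a3)))
    · have ht : Tendsto (fun y : ℝ × ℂ × W => (y.1, y.2.2)) (𝓝 (θ, x₀, w₁)) (𝓝 (θ, w₁)) :=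
        Continuous.tendsto' (by fun_prop) _ _ rfl
      filter_upwards [ht.eventually hΓh] with y hy hyI
      obtain ⟨hy1, hy2⟩ := hy hyI
      simp only [k]
      rw [hy1, val_sec hy2]
  refine ⟨f, hf, fun x hx => ?_⟩
  have hev1 : ∀ᶠ w in 𝓝 w₀, ∀ x ∈ Metric.closedBall c ρ, AnalyticAt ℂ g (x, w) := by
    refine (isCompact_closedBall c ρ).eventually_forall_of_forall_eventually fun x hx => ?_
    have ht : Tendsto (fun y : W × ℂ => (y.2, y.1)) (𝓝 (w₀, x)) (𝓝 (x, w₀)) :=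
      Continuous.tendsto' (by fun_prop) _ _ rfl
    exact ht.eventually (hg x hx).1.eventually_analyticAt
  -- Membership is repeated inside the predicate because the compactness lemma tests a full
  -- neighbourhood of each `θ`, while `Γ` is controlled only over the interval.
  have hev2 : ∀ᶠ w in 𝓝 w₀, ∀ θ ∈ Icc 0 (2 * Real.pi), θ ∈ Icc 0 (2 * Real.pi) →
      (Γ (θ, w)).val = g (circleMap c ρ θ, w) := by
    refine isCompact_Icc.eventually_forall_of_forall_eventually fun θ hθ => ?_
    obtain ⟨h, hh, hhΓ, hΓh⟩ := hloc θ hθ w₀ hw₀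
    have hcm : circleMap c ρ θ ∈ Metric.closedBall c ρ := circleMap_mem_closedBall c hρ.le θ
    have h1 : h =ᶠ[𝓝 (circleMap c ρ θ, w₀)] g := by
      refine (sec_eq_sec hh (hg _ hcm).1).1 ?_
      rw [hhΓ, hΓu θ hθ, (hg _ hcm).2]
    have ht : Tendsto (fun y : W × ℝ => (y.2, y.1)) (𝓝 (w₀, θ)) (𝓝 (θ, w₀)) :=
      Continuous.tendsto' (by fun_prop) _ _ rfl
    have ht' : Tendsto (fun y : W × ℝ => (circleMap c ρ y.2, y.1)) (𝓝 (w₀, θ))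
        (𝓝 (circleMap c ρ θ, w₀)) :=
      Continuous.tendsto' (by have := continuous_circleMap c ρ; fun_prop) _ _ rfl
    filter_upwards [ht.eventually hΓh, ht'.eventually h1] with y hy1 hy2 hyI
    obtain ⟨hy3, hy4⟩ := hy1 hyI
    rw [hy3, val_sec hy4, hy2]
  -- For `w` near `w₀` the function `g (·, w)` is holomorphic on the closed disc with boundary
  -- values given by `Γ`, so Cauchy's formula returns it.
  have heq : f =ᶠ[𝓝 (x, w₀)] g := by
    have ht : Tendsto (fun y : ℂ × W => y.2) (𝓝 (x, w₀)) (𝓝 w₀) :=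
      Continuous.tendsto' (by fun_prop) _ _ rfl
    filter_upwards [ht.eventually (hev1.and hev2),
      (continuous_fst.tendsto' (x, w₀) x rfl).eventually (Metric.isOpen_ball.mem_nhds hx)]
      with q hq hqx
    obtain ⟨y, w⟩ := q
    obtain ⟨hq1, hq2⟩ := hq
    have hd : DiffContOnCl ℂ (fun x => g (x, w)) (Metric.ball c ρ) := by
      refine DifferentiableOn.diffContOnCl fun x hx => ?_
      have := hq1 x (Metric.closure_ball_subset_closedBall hx)
      exact this.hasDerivAt_slice.differentiableAt.differentiableWithinAt
    have hC := hd.circleIntegral_sub_inv_smul hqx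
    have : ∫ θ in 0..2 * Real.pi, k θ (y, w) = ∮ z in C(c, ρ), (z - y)⁻¹ • g (z, w) := by
      rw [circleIntegral]
      refine integral_congr fun θ hθ => ?_
      rw [uIcc_of_le h2π] at hθ
      simp only [k, smul_eq_mul, deriv_circleMap]
      rw [hq2 θ hθ hθ]
      simp [circleMap]
    simp only [f]
    rw [this, hC, smul_eq_mul, ← mul_assoc, inv_mul_cancel₀ Complex.two_pi_I_ne_zero, one_mul]
  rw [sec_congr heq, (hg x (Metric.ball_subset_closedBall hx)).2]

end FirstVariable

/-! ### Systems of branches and extension across simple fibres. -/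

section ContinuationSystems

open AnalyticGerm unitInterval

/-- Version of `exists_homotopy_lift` with parameters in a subset. -/
lemma AnalyticGerm.exists_homotopy_lift_on {E : Type*} [NormedAddCommGroup E] [NormedSpace ℂ E]
    {Y : Type*} [TopologicalSpace Y] {Y₀ : Set Y} (A : Set (AnalyticGerm E))
    (K : I × Y → E) (hK : ContinuousOn K (univ ×ˢ Y₀)) (e₀ : Y → AnalyticGerm E)
    (h₀ : ContinuousOn e₀ Y₀)
    (h : ∀ y ∈ Y₀, ∃ Γ : C(I, AnalyticGerm E), Γ 0 = e₀ y ∧ ∀ s, (Γ s).pt = K (s, y) ∧ Γ s ∈ A) :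
    ∃ G : I × Y → AnalyticGerm E, ContinuousOn G (univ ×ˢ Y₀) ∧ (∀ y ∈ Y₀, G (0, y) = e₀ y) ∧
      ∀ s, ∀ y ∈ Y₀, (G (s, y)).pt = K (s, y) ∧ G (s, y) ∈ A := by
  classical
  have hi : Continuous fun x : I × Y₀ => (x.1, (x.2 : Y)) := by fun_prop
  obtain ⟨G, hG0, hG⟩ := exists_homotopy_lift A
    (⟨fun x => K (x.1, x.2), hK.comp_continuous hi fun x => ⟨mem_univ _, x.2.2⟩⟩ : C(I × Y₀, E))
    (fun y => e₀ y) (h₀.comp_continuous continuous_subtype_val fun y => y.2)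
    (fun y => h y y.2)
  let G' : I × Y → AnalyticGerm E := fun x =>
    if hx : x.2 ∈ Y₀ then G (x.1, ⟨x.2, hx⟩) else e₀ x.2
  have hG' : ∀ s y (hy : y ∈ Y₀), G' (s, y) = G (s, ⟨y, hy⟩) := fun s y hy => dif_pos hy
  refine ⟨G', ?_, fun y hy => by rw [hG' _ _ hy, hG0], fun s y hy => ?_⟩
  · rw [continuousOn_iff_continuous_domRestrict]
    have : (univ ×ˢ Y₀).domRestrict G' = fun x => G (x.1.1, ⟨x.1.2, x.2.2⟩) := by
      ext x; exact hG' _ _ x.2.2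
    rw [this]; fun_prop
  · rw [hG' _ _ hy]; exact hG (s, ⟨y, hy⟩)

section General

variable {E : Type*} [NormedAddCommGroup E] [NormedSpace ℂ E]

/-- A set `X` of germs at points off the closed set `S`, which extend (within `X`) to every ball
disjoint from `S` around a point near the base point. -/
structure IsContinuationSystem (S : Set E) (X : Set (AnalyticGerm E)) : Prop where
  isClosed : IsClosed S
  pt_notMem : ∀ e ∈ X, e.pt ∉ S
  exists_extension : ∀ e ∈ X, ∀ p r, Metric.ball p r ⊆ Sᶜ → e.pt ∈ Metric.ball p r →
    ∃ f : E → ℂ, AnalyticOnNhd ℂ f (Metric.ball p r) ∧ sec f e.pt = e ∧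
      ∀ q ∈ Metric.ball p r, sec f q ∈ X

/-- The germs that belong to `X` at all nearby points off `S`. -/
def germClosure (S : Set E) (X : Set (AnalyticGerm E)) : Set (AnalyticGerm E) :=
  {e | ∀ᶠ q in 𝓝 e.pt, q ∉ S → sec e.rep q ∈ X}

variable {S : Set E} {X : Set (AnalyticGerm E)}

lemma sec_mem_germClosure {f : E → ℂ} {p : E} (hf : AnalyticAt ℂ f p) :
    sec f p ∈ germClosure S X ↔ ∀ᶠ q in 𝓝 p, q ∉ S → sec f q ∈ X := by
  have h1 : AnalyticAt ℂ (sec f p).rep p := by simpa using (sec f p).analyticAt_rep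
  have h2 : sec (sec f p).rep p = sec f p := by simpa using (sec f p).sec_rep
  have h3 := ((sec_eq_sec h1 hf).1 h2).eventuallyEq_nhds
  simp only [germClosure, mem_ofPred_eq, pt_sec]
  refine eventually_congr (h3.mono fun q hq => ?_)
  rw [sec_congr hq]

lemma isOpen_germClosure : IsOpen (germClosure S X) := by
  refine isOpen_iff.2 fun f p hf hfp => ?_
  rw [sec_mem_germClosure hf] at hfp
  filter_upwards [hfp.eventually_nhds, hf.eventually_analyticAt] with q hq hfq
  exact (sec_mem_germClosure hfq).2 hq

lemma mem_of_mem_germClosure {e : AnalyticGerm E} (he : e ∈ germClosure S X) (hp : e.pt ∉ S) :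
    e ∈ X := by
  have := he.self_of_nhds hp
  rwa [sec_rep] at this

namespace IsContinuationSystem

variable (hX : IsContinuationSystem S X)
include hX

lemma exists_ball {p : E} (hp : p ∉ S) : ∃ r > 0, Metric.ball p r ⊆ Sᶜ :=
  Metric.isOpen_iff.1 hX.isClosed.isOpen_compl p hp

lemma isOpen : IsOpen X := by
  refine isOpen_iff.2 fun g p hg hgp => ?_
  have hpS : p ∉ S := by simpa using hX.pt_notMem _ hgp
  obtain ⟨r, hr, hball⟩ := hX.exists_ball hpS
  obtain ⟨f, hf, hfg, hfX⟩ := hX.exists_extension _ hgp p r hball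
    (by rw [pt_sec]; exact Metric.mem_ball_self hr)
  rw [pt_sec] at hfg
  have h1 := ((sec_eq_sec (hf p (Metric.mem_ball_self hr)) hg).1 hfg).eventuallyEq_nhds
  filter_upwards [h1, Metric.ball_mem_nhds p hr] with q hq hqb
  rw [← sec_congr hq]
  exact hfX q hqb

lemma subset_germClosure : X ⊆ germClosure S X := fun e he => by
  have := isOpen_iff.1 hX.isOpen e.rep e.pt e.analyticAt_rep (by rwa [sec_rep])
  exact this.mono fun q hq _ => hq

/-- If a germ of `g` near `p` were in `X`, extending it over a ball containing `p` would put the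
germ of `g` at `p` in `X`. With `isOpen`, this makes `X` clopen among germs off `S`. -/
lemma isOpen_diff : IsOpen {e : AnalyticGerm E | e.pt ∉ S ∧ e ∉ X} := by
  refine isOpen_iff.2 fun g p hg ⟨hpS, hgX⟩ => ?_
  rw [pt_sec] at hpS
  obtain ⟨r₁, hr₁, hball⟩ := hX.exists_ball hpS
  obtain ⟨r₂, hr₂, hg₂⟩ := Metric.eventually_nhds_iff_ball.1 hg.eventually_analyticAt
  have hr : 0 < min r₁ r₂ := lt_min hr₁ hr₂
  filter_upwards [Metric.ball_mem_nhds p hr] with q hq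
  have hb : Metric.ball p (min r₁ r₂) ⊆ Sᶜ :=
    (Metric.ball_subset_ball (min_le_left _ _)).trans hball
  refine ⟨by simpa using hb hq, fun hqX => hgX ?_⟩
  obtain ⟨f, hf, hfg, hfX⟩ := hX.exists_extension _ hqX p _ hb (by simpa using hq)
  rw [pt_sec] at hfg
  have hga : AnalyticOnNhd ℂ g (Metric.ball p (min r₁ r₂)) := fun y hy =>
    hg₂ y (Metric.ball_subset_ball (min_le_right _ _) hy)
  have := AnalyticOnNhd.eqOn_of_preconnected_of_eventuallyEq hf hga
    (convex_ball _ _).isPreconnected hq ((sec_eq_sec (hf q hq) (hga q hq)).1 hfg)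
  have h2 : f =ᶠ[𝓝 p] g := by
    filter_upwards [Metric.ball_mem_nhds p hr] with y hy using this hy
  rw [← sec_congr h2]
  exact hfX p (Metric.mem_ball_self hr)

lemma mem_of_preconnected {A : Type*} [TopologicalSpace A] {s : Set A} (hs : IsPreconnected s)
    {u : A → AnalyticGerm E} (hu : ContinuousOn u s) (huS : ∀ a ∈ s, (u a).pt ∉ S) {a₀ : A}
    (ha₀ : a₀ ∈ s) (h₀ : u a₀ ∈ X) : ∀ a ∈ s, u a ∈ X := by
  have := (hs.image u hu).subset_left_of_subset_union hX.isOpen hX.isOpen_diff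
    (Set.disjoint_left.2 fun e he (he' : e.pt ∉ S ∧ e ∉ X) => he'.2 he)
    (by
      rintro _ ⟨a, ha, rfl⟩
      by_cases h : u a ∈ X
      · exact Or.inl h
      · exact Or.inr ⟨huS a ha, h⟩) ⟨u a₀, mem_image_of_mem u ha₀, h₀⟩
  exact fun a ha => this (mem_image_of_mem u ha)

lemma exists_lift (γ : C(I, E)) (hγ : ∀ s, γ s ∉ S) {e : AnalyticGerm E} (he : e ∈ X)
    (hp : e.pt = γ 0) :
    ∃ Γ : C(I, AnalyticGerm E), Γ 0 = e ∧ ∀ s, (Γ s).pt = γ s ∧ Γ s ∈ X := by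
  refine exists_continuousMap_of_local_extension (fun s => {g | g.pt = γ s ∧ g ∈ X})
    (fun t => ?_) ⟨hp, he⟩
  obtain ⟨r, hr, hball⟩ := hX.exists_ball (hγ t)
  refine ⟨γ ⁻¹' Metric.ball (γ t) r, γ.continuous.continuousAt (Metric.ball_mem_nhds _ hr),
    fun t₀ ht₀ g hg => ?_⟩
  obtain ⟨f, hf, hfg, hfX⟩ := hX.exists_extension g hg.2 _ _ hball (by rw [hg.1]; exact ht₀)
  refine ⟨fun s => sec f (γ s), fun s hs => ?_, by rw [← hfg, hg.1], fun s hs => ⟨pt_sec _ _, hfX _ hs⟩⟩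
  exact ((continuousAt_sec (hf _ hs)).comp γ.continuous.continuousAt).continuousWithinAt

end IsContinuationSystem

end General

/-- The disc is homeomorphic to the plane, which stays path connected after removal of a countable
set. -/
lemma isPathConnected_ball_diff_finite {c : ℂ} {r : ℝ} (hr : 0 < r) {R : Set ℂ} (hR : R.Finite) :
    IsPathConnected (Metric.ball c r \ R) := by
  let φ := OpenPartialHomeomorph.univBall c r
  have hsrc : φ.source = univ := OpenPartialHomeomorph.univBall_source c r
  have htgt : φ.target = Metric.ball c r := OpenPartialHomeomorph.univBall_target c hr
  have hinj : Function.Injective φ := fun x y h =>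
    φ.injOn (by simp [hsrc]) (by simp [hsrc]) h
  have h1 : IsPathConnected (φ ⁻¹' R)ᶜ :=
    Set.Countable.isPathConnected_compl_of_one_lt_rank
      (by rw [Complex.rank_real_complex]; norm_num)
      (hR.preimage hinj.injOn).countable
  have h2 : φ '' (φ ⁻¹' R)ᶜ = Metric.ball c r \ R := by
    ext x
    constructor
    · rintro ⟨y, hy, rfl⟩
      refine ⟨?_, hy⟩
      rw [← htgt]; exact φ.map_source (by simp [hsrc])
    · rintro ⟨hx, hxR⟩
      rw [← htgt] at hx
      exact ⟨φ.symm x, by simpa [φ.right_inv hx] using hxR, φ.right_inv hx⟩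
  rw [← h2]
  exact h1.image' (φ.continuousOn.mono (by simp [hsrc]))

variable {W : Type*} [NormedAddCommGroup W] [NormedSpace ℂ W]

/-- Near `w₀` the fibres of `Z` over `w` consist of finitely many points, each of which moves
continuously at `w₀`, and which are distinct at `w₀`. -/
def HasSimpleFibers (Z : Set (ℂ × W)) (w₀ : W) : Prop :=
  ∃ C : Finset ℂ, ∀ r > 0, ∃ ξ : ℂ → W → ℂ, ∀ᶠ w in 𝓝 w₀,
    (∀ c ∈ C, dist (ξ c w) c < r) ∧ ∀ x, (x, w) ∈ Z ↔ ∃ c ∈ C, x = ξ c w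

/-- A small disc about `x₁` contains at most one point of each nearby fibre of `Z`. If there is one
over `w₁`, the hypothesis makes `x₀` that point over `w₀`, and the germ is already holomorphic
there. It therefore extends over the disc at `w₀`. The boundary circle stays off `Z` for all nearby
`w`, so the extension spreads in `w` there, and Cauchy's formula fills in the disc. The radii depend
only on `(x₁, w₁)`. -/
lemma IsContinuationSystem.exists_extension_of_hasSimpleFibers {S : Set (ℂ × W)}
    {X : Set (AnalyticGerm (ℂ × W))} (hX : IsContinuationSystem S X) {Z : Set (ℂ × W)}
    (hZ : IsClosed Z) (hSZ : S ⊆ Z) {w₁ : W} (hw₁ : HasSimpleFibers Z w₁) (x₁ : ℂ) :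
    ∃ ρ > 0, ∃ η > 0, ∀ x₀ ∈ Metric.ball x₁ ρ, ∀ w₀ ∈ Metric.ball w₁ η,
      ((x₁, w₁) ∈ Z → (x₀, w₀) ∈ Z) → ∀ e ∈ germClosure S X, e.pt = (x₀, w₀) →
      ∃ f : ℂ × W → ℂ, AnalyticOnNhd ℂ f (Metric.ball x₁ ρ ×ˢ Metric.ball w₁ η) ∧
        sec f (x₀, w₀) = e ∧
        ∀ q ∈ Metric.ball x₁ ρ ×ˢ Metric.ball w₁ η, sec f q ∈ germClosure S X := by
  obtain ⟨C, hC⟩ := hw₁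
  -- `HasSimpleFibers` only places points of the fibre over `w₁` arbitrarily near `c`; closedness of
  -- `Z` puts `c` itself in the fibre.
  have hCZ : ∀ c ∈ C, (c, w₁) ∈ Z := fun c hc => by
    have hsl : Continuous fun x : ℂ => (x, w₁) := by fun_prop
    have : c ∈ closure ((fun x : ℂ => (x, w₁)) ⁻¹' Z) := by
      refine Metric.mem_closure_iff.2 fun r hr => ?_
      obtain ⟨ξ, hξ⟩ := hC r hr
      obtain ⟨h1, h2⟩ := hξ.self_of_nhds
      exact ⟨ξ c w₁, (h2 _).2 ⟨c, hc, rfl⟩, by rw [dist_comm]; exact h1 c hc⟩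
    rwa [(hZ.preimage hsl).closure_eq] at this
  -- Fibre points will move by less than `ρ / 2`, so those starting at `c ≠ x₁` never enter the disc
  -- of radius `2ρ`.
  obtain ⟨ρ, hρ, hρC⟩ : ∃ ρ > 0, ∀ c ∈ C, c ≠ x₁ → 4 * ρ ≤ dist c x₁ := by
    have hfin : ∀ᶠ ρ : ℝ in 𝓝[>] 0, ∀ c ∈ C, c ≠ x₁ → 4 * ρ ≤ dist c x₁ := by
      rw [Finset.eventually_all]
      intro c _
      by_cases h : c = x₁
      · simp [h]
      · filter_upwards [Ioo_mem_nhdsGT (show 0 < dist c x₁ / 4 by have := dist_pos.2 h; positivity)]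
          with η hη _
        linarith [hη.2]
    obtain ⟨ρ, h1, h2⟩ := (hfin.and self_mem_nhdsWithin).exists
    exact ⟨ρ, h2, h1⟩
  obtain ⟨ξ, hξ⟩ := hC (ρ / 2) (half_pos hρ)
  obtain ⟨η, hη, hN⟩ := Metric.eventually_nhds_iff_ball.1 hξ
  have hroot : ∀ w ∈ Metric.ball w₁ η, ∀ x ∈ Metric.ball x₁ (2 * ρ), (x, w) ∈ Z →
      x₁ ∈ C ∧ x = ξ x₁ w ∧ dist x x₁ < ρ / 2 := fun w hw x hx hxZ => by
    obtain ⟨h1, h2⟩ := hN w hw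
    obtain ⟨c, hc, rfl⟩ := (h2 x).1 hxZ
    have hcx : c = x₁ := by
      by_contra hne
      have h3 := hρC c hc hne
      have h4 := h1 c hc
      rw [Metric.mem_ball] at hx
      have := dist_triangle c (ξ c w) x₁
      rw [dist_comm c (ξ c w)] at this
      linarith
    subst hcx
    exact ⟨hc, rfl, h1 _ hc⟩
  have hfar : ∀ w ∈ Metric.ball w₁ η, ∀ x ∈ Metric.ball x₁ (2 * ρ), ρ / 2 ≤ dist x x₁ →
      (x, w) ∉ Z := fun w hw x hx hd hxZ => absurd (hroot w hw x hx hxZ).2.2 (not_lt.2 hd)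
  refine ⟨ρ, hρ, η, hη, fun x₀ hx₀ w₀ hw₀ hx₀Z e he hep => ?_⟩
  have hsub : Metric.ball x₁ ρ ⊆ Metric.ball x₁ (2 * ρ) := Metric.ball_subset_ball (by linarith)
  have hx₀' := hsub hx₀
  have huniq : ∀ x ∈ Metric.ball x₁ (2 * ρ), x ≠ x₀ → (x, w₀) ∉ Z := fun x hx hne hxZ => by
    obtain ⟨h1, h2, -⟩ := hroot w₀ hw₀ x hx hxZ
    obtain ⟨-, h3, -⟩ := hroot w₀ hw₀ x₀ hx₀' (hx₀Z (hCZ _ h1))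
    exact hne (h2.trans h3.symm)
  -- the germ extends to the disc at `w₀`
  obtain ⟨u, huc, hup, huX, hu₀⟩ : ∃ u : ℂ → AnalyticGerm (ℂ × W),
      ContinuousOn u (Metric.ball x₁ (2 * ρ)) ∧
      (∀ x ∈ Metric.ball x₁ (2 * ρ), (u x).pt = (x, w₀)) ∧
      (∀ x ∈ Metric.ball x₁ (2 * ρ), u x ∈ germClosure S X) ∧ u x₀ = e := by
    have hea : AnalyticAt ℂ e.rep (x₀, w₀) := hep ▸ e.analyticAt_rep
    have hes : sec e.rep (x₀, w₀) = e := by rw [← hep, sec_rep]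
    have heX : ∀ᶠ q in 𝓝 (x₀, w₀), q ∉ S → sec e.rep q ∈ X := by
      rw [← sec_mem_germClosure hea, hes]; exact he
    obtain ⟨δ, hδ, hδb⟩ := Metric.eventually_nhds_iff_ball.1 (hea.eventually_analyticAt.and heX)
    -- Each segment from `x₀` to `x` is started at the fraction `κ` of its length. There `e.rep` is
    -- still defined, while the point differs from `x₀` and so lies off `Z` when `x ≠ x₀`.
    obtain ⟨κ, hκ, hκ1, hκδ⟩ : ∃ κ : ℝ, 0 < κ ∧ κ ≤ 1 ∧ κ * (4 * ρ) < δ := by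
      refine ⟨min 1 (δ / (8 * ρ)), by positivity, min_le_left _ _, ?_⟩
      calc min 1 (δ / (8 * ρ)) * (4 * ρ) ≤ δ / (8 * ρ) * (4 * ρ) := by
            gcongr; exact min_le_right _ _
        _ = δ / 2 := by field_simp; norm_num
        _ < δ := by linarith
    have hl : ∀ s : I, (1 - (s : ℝ)) * κ + s ∈ Ioc (0 : ℝ) 1 := fun s => by
      have h1 := s.2.1; have h2 := s.2.2
      constructor
      · rcases h1.eq_or_lt with h | h
        · rw [← h]; simpa using hκ
        · have := mul_nonneg (sub_nonneg.2 h2) hκ.le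
          linarith
      · nlinarith
    let K : I × ℂ → ℂ × W := fun y =>
      (x₀ + ((1 - (y.1 : ℝ)) * κ + y.1 : ℝ) • (y.2 - x₀), w₀)
    have hKc : Continuous K := by fun_prop
    have hKb : ∀ s, ∀ x ∈ Metric.ball x₁ (2 * ρ), (K (s, x)).1 ∈ Metric.ball x₁ (2 * ρ) :=
      fun s x hx => (convex_ball _ _).add_smul_sub_mem hx₀' hx ⟨(hl s).1.le, (hl s).2⟩
    have hK0 : ∀ x ∈ Metric.ball x₁ (2 * ρ), K (0, x) ∈ Metric.ball (x₀, w₀) δ := fun x hx => by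
      have hd : dist x x₀ < 4 * ρ := by
        rw [Metric.mem_ball] at hx hx₀'
        have := dist_triangle_right x x₀ x₁
        linarith
      rw [← ball_prod_same]
      refine ⟨?_, Metric.mem_ball_self hδ⟩
      simp only [K]
      rw [mem_ball_iff_norm, add_sub_cancel_left, norm_smul, ← dist_eq_norm]
      simp only [Icc.coe_zero, sub_zero, one_mul, add_zero, Real.norm_eq_abs, abs_of_pos hκ]
      calc κ * dist x x₀ ≤ κ * (4 * ρ) := by gcongr
        _ < δ := hκδ
    obtain ⟨G, hGc, hG0, hG⟩ := exists_homotopy_lift_on (Y₀ := Metric.ball x₁ (2 * ρ))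
      (germClosure S X) K hKc.continuousOn (fun x => sec e.rep (K (0, x)))
      (fun x hx => ((continuousAt_sec (hδb _ (hK0 x hx)).1).comp
        (f := fun x => K (0, x)) (by fun_prop)).continuousWithinAt)
      (fun x hx => by
        by_cases hxx : x = x₀
        · subst hxx
          refine ⟨ContinuousMap.const I e, ?_, fun s => ⟨?_, he⟩⟩
          · simp [K, hes]
          · simp [K, hep]
        · have hKS : ∀ s, K (s, x) ∉ S := fun s hs => by
            refine huniq _ (hKb s x hx) ?_ (hSZ hs)
            simp only [K, ne_eq, add_eq_left, smul_eq_zero, not_or]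
            exact ⟨(hl s).1.ne', sub_ne_zero.2 hxx⟩
          obtain ⟨Γ, hΓ0, hΓ⟩ := hX.exists_lift ⟨fun s => K (s, x), by fun_prop⟩ hKS
            ((hδb _ (hK0 x hx)).2 (hKS 0)) (pt_sec _ _)
          exact ⟨Γ, hΓ0, fun s => ⟨(hΓ s).1, hX.subset_germClosure (hΓ s).2⟩⟩)
    refine ⟨fun x => G (1, x), ?_, fun x hx => ?_, fun x hx => (hG 1 x hx).2, ?_⟩
    · exact hGc.comp (by fun_prop) fun x hx => ⟨mem_univ _, hx⟩
    · rw [(hG 1 x hx).1]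
      simp [K]
    · have h1 : EqOn (fun s : I => G (s, x₀)) (fun _ => e) univ := by
        refine eqOn_of_preconnected isPreconnected_univ
          (hGc.comp (by fun_prop) fun s _ => ⟨mem_univ _, hx₀'⟩) continuousOn_const ?_
          (mem_univ 0) ?_
        · intro s _
          simp [(hG s x₀ hx₀').1, K, hep]
        · simp [hG0 x₀ hx₀', K, hes]
      exact h1 (mem_univ 1)
  have huX' : ∀ x ∈ Metric.ball x₁ (2 * ρ), (x, w₀) ∉ Z → u x ∈ X := fun x hx hxZ =>
    mem_of_mem_germClosure (huX x hx) (by rw [hup x hx]; exact fun h => hxZ (hSZ h))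
  -- extension from the boundary circle in the direction of `W`
  have hcirc : ∀ θ, circleMap x₁ ρ θ ∈ Metric.ball x₁ (2 * ρ) ∧ dist (circleMap x₁ ρ θ) x₁ = ρ :=
    fun θ => by
      have h1 : dist (circleMap x₁ ρ θ) x₁ = ρ := circleMap_mem_sphere x₁ hρ.le θ
      exact ⟨by rw [Metric.mem_ball, h1]; linarith, h1⟩
  obtain ⟨f, hf, hfu⟩ : ∃ f : ℂ × W → ℂ,
      AnalyticOnNhd ℂ f (Metric.ball x₁ ρ ×ˢ Metric.ball w₁ η) ∧
      ∀ x ∈ Metric.ball x₁ ρ, sec f (x, w₀) = u x := by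
    let K : I × (ℝ × W) → ℂ × W := fun y =>
      (circleMap x₁ ρ y.2.1, w₀ + (y.1 : ℝ) • (y.2.2 - w₀))
    have hcm := continuous_circleMap x₁ ρ
    have hKc : Continuous K := by fun_prop
    have hKS : ∀ s θ, ∀ w ∈ Metric.ball w₁ η, K (s, (θ, w)) ∉ S := fun s θ w hw hS =>
      hfar _ ((convex_ball _ _).add_smul_sub_mem hw₀ hw s.2) _ (hcirc θ).1
        (by rw [(hcirc θ).2]; linarith) (hSZ hS)
    obtain ⟨G, hGc, hG0, hG⟩ := exists_homotopy_lift_on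
      (Y₀ := Icc 0 (2 * Real.pi) ×ˢ Metric.ball w₁ η) X K hKc.continuousOn
      (fun y => u (circleMap x₁ ρ y.1))
      (huc.comp (f := fun y : ℝ × W => circleMap x₁ ρ y.1) (by fun_prop) fun y _ => (hcirc y.1).1)
      (fun y hy => hX.exists_lift ⟨fun s => K (s, y), by fun_prop⟩ (fun s => hKS s _ _ hy.2)
        (huX' _ (hcirc _).1 (hfar _ hw₀ _ (hcirc _).1 (by rw [(hcirc _).2]; linarith)))
        (by simp [K, hup _ (hcirc _).1]))
    refine exists_extension_of_circle (R := 2 * ρ) hρ (by linarith) Metric.isOpen_ball hw₀ huc hup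
      (Γ := fun y => G (1, y)) (hGc.comp (by fun_prop) fun y hy => ⟨mem_univ _, hy⟩) ?_ ?_
    · intro y hy
      rw [(hG 1 y hy).1]
      simp [K]
    · intro θ hθ
      have hy : (θ, w₀) ∈ Icc 0 (2 * Real.pi) ×ˢ Metric.ball w₁ η := ⟨hθ, hw₀⟩
      have h1 : EqOn (fun s : I => G (s, (θ, w₀))) (fun _ => u (circleMap x₁ ρ θ)) univ := by
        refine eqOn_of_preconnected isPreconnected_univ
          (hGc.comp (by fun_prop) fun s _ => ⟨mem_univ _, hy⟩) continuousOn_const ?_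
          (mem_univ 0) (hG0 _ hy)
        intro s _
        simp [(hG s _ hy).1, K, hup _ (hcirc θ).1]
      exact h1 (mem_univ 1)
  refine ⟨f, hf, by rw [hfu _ hx₀, hu₀], ?_⟩
  -- the extension belongs to the system
  have hsecc : ∀ w ∈ Metric.ball w₁ η, ContinuousOn (fun x => sec f (x, w)) (Metric.ball x₁ ρ) :=
    fun w hw x hx => ((continuousAt_sec (hf (x, w) ⟨hx, hw⟩)).comp
      (f := fun x => (x, w)) (by fun_prop)).continuousWithinAt
  -- A point of the annulus that is off `Z` for every `w`: membership in `X` spreads from `w₀` along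
  -- `{x₂} × W`, then within each slice.
  obtain ⟨x₂, hx₂, hx₂d⟩ : ∃ x₂ ∈ Metric.ball x₁ ρ, ρ / 2 ≤ dist x₂ x₁ := by
    have h1 : dist (x₁ + (3 / 4 * ρ : ℝ)) x₁ = 3 / 4 * ρ := by
      rw [dist_self_add_left, Complex.norm_real, Real.norm_eq_abs, abs_of_pos (by positivity)]
    exact ⟨x₁ + (3 / 4 * ρ : ℝ), by rw [Metric.mem_ball, h1]; linarith, by rw [h1]; linarith⟩
  have hx₂X : ∀ w ∈ Metric.ball w₁ η, sec f (x₂, w) ∈ X := by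
    refine hX.mem_of_preconnected (convex_ball w₁ η).isPreconnected
      (u := fun w => sec f (x₂, w)) (fun w hw => ((continuousAt_sec (hf (x₂, w) ⟨hx₂, hw⟩)).comp
      (f := fun w => (x₂, w)) (by fun_prop)).continuousWithinAt) (fun w hw => ?_) hw₀ ?_
    · rw [pt_sec]; exact fun h => hfar w hw x₂ (hsub hx₂) hx₂d (hSZ h)
    · rw [hfu x₂ hx₂]
      exact huX' x₂ (hsub hx₂) (hfar w₀ hw₀ x₂ (hsub hx₂) hx₂d)
  have hoff : ∀ w ∈ Metric.ball w₁ η, ∀ x ∈ Metric.ball x₁ ρ, x ≠ ξ x₁ w ∨ (x, w) ∉ Z →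
      sec f (x, w) ∈ X := by
    intro w hw
    have key : ∀ R : Set ℂ, R.Finite → (∀ x ∈ Metric.ball x₁ ρ, x ∉ R → (x, w) ∉ Z) → x₂ ∉ R →
        ∀ x ∈ Metric.ball x₁ ρ \ R, sec f (x, w) ∈ X := fun R hR hRZ hx₂R =>
      hX.mem_of_preconnected (isPathConnected_ball_diff_finite hρ hR).isConnected.isPreconnected
        ((hsecc w hw).mono sdiff_subset) (fun x hx => by
          rw [pt_sec]; exact fun h => hRZ x hx.1 hx.2 (hSZ h)) ⟨hx₂, hx₂R⟩ (hx₂X w hw)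
    by_cases hζ : (ξ x₁ w, w) ∈ Z ∧ x₁ ∈ C
    · intro x hx hxx
      have hxx' : x ≠ ξ x₁ w := by
        rcases hxx with h | h
        · exact h
        · rintro rfl; exact h hζ.1
      refine key {ξ x₁ w} (finite_singleton _) (fun x hx hxR hxZ => ?_) ?_ x ⟨hx, hxx'⟩
      · exact hxR (hroot w hw x (hsub hx) hxZ).2.1
      · intro h
        rw [mem_singleton_iff] at h
        exact hfar w hw x₂ (hsub hx₂) hx₂d (h ▸ hζ.1)
    · intro x hx _
      refine key ∅ finite_empty (fun x hx _ hxZ => hζ ?_) (notMem_empty _) x ⟨hx, notMem_empty _⟩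
      obtain ⟨h1, h2, -⟩ := hroot w hw x (hsub hx) hxZ
      exact ⟨h2 ▸ hxZ, h1⟩
  have hΩ : IsOpen (Metric.ball x₁ ρ ×ˢ Metric.ball w₁ η) :=
    Metric.isOpen_ball.prod Metric.isOpen_ball
  have hall : ∀ q ∈ Metric.ball x₁ ρ ×ˢ Metric.ball w₁ η, q ∉ S → sec f q ∈ X := by
    rintro ⟨x, w⟩ hq hqS
    by_cases hxx : x ≠ ξ x₁ w
    · exact hoff w hq.2 x hq.1 (Or.inl hxx)
    -- The point `ξ x₁ w` may lie in `Z` though not in `S`; a ball off `S` connects it to a point of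
    -- the same slice already treated.
    · obtain ⟨r, hr, hrb⟩ := Metric.isOpen_iff.1 (hΩ.inter hX.isClosed.isOpen_compl) (x, w) ⟨hq, hqS⟩
      have hd : dist (x + (r / 2 : ℝ)) x = r / 2 := by
        rw [dist_self_add_left, Complex.norm_real, Real.norm_eq_abs, abs_of_pos (by positivity)]
      have hm : (x + (r / 2 : ℝ), w) ∈ Metric.ball (x, w) r := by
        rw [← ball_prod_same]
        exact ⟨by rw [Metric.mem_ball, hd]; linarith, Metric.mem_ball_self hr⟩
      refine hX.mem_of_preconnected (convex_ball (x, w) r).isPreconnected (u := sec f)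
        (fun q hq => (continuousAt_sec (hf q (hrb hq).1)).continuousWithinAt)
        (fun q hq => by rw [pt_sec]; exact (hrb hq).2) hm ?_ _ (Metric.mem_ball_self hr)
      refine hoff w hq.2 _ (hrb hm).1.1 (Or.inl fun h => ?_)
      rw [not_not] at hxx
      rw [h, ← hxx, dist_self] at hd
      linarith
  intro q hq
  exact (sec_mem_germClosure (hf q hq)).2 (by
    filter_upwards [hΩ.mem_nhds hq] with q' hq' using hall q' hq')

end ContinuationSystems

/-! ### Continuation of primitives over a fixed `w`. -/

section VerticalContinuation

open AnalyticGerm unitInterval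

variable {W : Type*} [NormedAddCommGroup W] [NormedSpace ℂ W] {S : Set (ℂ × W)}
  {X : Set (AnalyticGerm (ℂ × W))}

/-- The germs over the line `ℂ × {w}` whose derivative in the first variable belongs to the closure
of `X`. -/
def verticalGerms (S : Set (ℂ × W)) (X : Set (AnalyticGerm (ℂ × W))) (w : W) :
    Set (AnalyticGerm (ℂ × W)) :=
  {g | g.pt.2 = w ∧ g.dx ∈ germClosure S X}

lemma sec_mem_verticalGerms {g : ℂ × W → ℂ} {q : ℂ × W} (hg : AnalyticAt ℂ g q)
    (h : sec (firstDeriv g) q ∈ germClosure S X) : sec g q ∈ verticalGerms S X q.2 :=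
  ⟨by rw [pt_sec], by rwa [dx_sec hg]⟩

lemma joinedIn_verticalGerms {c : ℂ} {r : ℝ} {w : W} {g : ℂ × W → ℂ}
    (hg : ∀ x ∈ Metric.ball c r, AnalyticAt ℂ g (x, w))
    (hgX : ∀ x ∈ Metric.ball c r, sec (firstDeriv g) (x, w) ∈ germClosure S X) {x y : ℂ}
    (hx : x ∈ Metric.ball c r) (hy : y ∈ Metric.ball c r) :
    JoinedIn (verticalGerms S X w) (sec g (x, w)) (sec g (y, w)) := by
  have h1 : ContinuousOn (fun x => sec g (x, w)) (Metric.ball c r) := fun x hx =>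
    ((continuousAt_sec (hg x hx)).comp (f := fun x => (x, w)) (by fun_prop)).continuousWithinAt
  have h2 := ((convex_ball c r).isPathConnected ⟨x, hx⟩).image' h1
  refine (h2.joinedIn _ (mem_image_of_mem _ hx) _ (mem_image_of_mem _ hy)).mono ?_
  rintro _ ⟨z, hz, rfl⟩
  exact sec_mem_verticalGerms (hg z hz) (hgX z hz)

/-- Paths of vertical germs can be moved off finitely many values of the first coordinate. -/
lemma joinedIn_verticalGerms_avoiding {w : W} {α β : AnalyticGerm (ℂ × W)}
    (h : JoinedIn (verticalGerms S X w) α β) {R : Set ℂ} (hR : R.Finite)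
    (hα : α.pt.1 ∉ R) (hβ : β.pt.1 ∉ R) :
    JoinedIn (verticalGerms S X w ∩ {g | g.pt.1 ∉ R}) α β := by
  set V := verticalGerms S X w ∩ {g | g.pt.1 ∉ R} with hV
  have hloc : ∀ y ∈ verticalGerms S X w, (∃ U ∈ 𝓝 y, ∀ z ∈ U ∩ V, ∀ z' ∈ U ∩ V, JoinedIn V z z') ∧
      ∃ᶠ z in 𝓝 y, z ∈ V := by
    rintro y ⟨hyw, hyX⟩
    have hyp : y.pt = (y.pt.1, w) := by rw [← hyw]
    have hya : AnalyticAt ℂ y.rep (y.pt.1, w) := by rw [← hyp]; exact y.analyticAt_rep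
    have hys : sec y.rep (y.pt.1, w) = y := by rw [← hyp, y.sec_rep]
    have hev : ∀ᶠ q in 𝓝 (y.pt.1, w), AnalyticAt ℂ y.rep q ∧
        sec (firstDeriv y.rep) q ∈ germClosure S X := by
      refine hya.eventually_analyticAt.and ?_
      refine isOpen_iff.1 isOpen_germClosure _ _ hya.firstDeriv ?_
      rwa [dx, hyp] at hyX
    obtain ⟨r, hr, hball⟩ := Metric.eventually_nhds_iff_ball.1 hev
    have hmem : ∀ x ∈ Metric.ball y.pt.1 r, (x, w) ∈ Metric.ball (y.pt.1, w) r := fun x hx => by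
      rw [← ball_prod_same]; exact ⟨hx, Metric.mem_ball_self hr⟩
    have hc : ContinuousOn (fun x => sec y.rep (x, w)) (Metric.ball y.pt.1 r) := fun x hx =>
      ((continuousAt_sec (hball _ (hmem x hx)).1).comp
        (f := fun x => (x, w)) (by fun_prop)).continuousWithinAt
    have hxV : ∀ x ∈ Metric.ball y.pt.1 r, x ∉ R → sec y.rep (x, w) ∈ V := fun x hx hxR =>
      ⟨sec_mem_verticalGerms (hball _ (hmem x hx)).1 (hball _ (hmem x hx)).2, by simpa using hxR⟩
    constructor
    · refine ⟨{z | z = sec y.rep z.pt ∧ z.pt ∈ Metric.ball (y.pt.1, w) r}, ?_, ?_⟩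
      · have h1 := eventually_eq_sec y.analyticAt_rep y.sec_rep
        have h2 : ∀ᶠ z : AnalyticGerm (ℂ × W) in 𝓝 y, z.pt ∈ Metric.ball (y.pt.1, w) r :=
          continuous_pt.continuousAt (by rw [← hyp]; exact Metric.ball_mem_nhds _ hr)
        filter_upwards [h1, h2] with z hz1 hz2 using ⟨hz1.1, hz2⟩
      · have hpc := ((isPathConnected_ball_diff_finite hr hR).image'
          (hc.mono (sdiff_subset (s := Metric.ball y.pt.1 r) (t := R))))
        have hin : ∀ z ∈ {z : AnalyticGerm (ℂ × W) | z = sec y.rep z.pt ∧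
            z.pt ∈ Metric.ball (y.pt.1, w) r} ∩ V,
            z ∈ (fun x => sec y.rep (x, w)) '' (Metric.ball y.pt.1 r \ R) := by
          rintro z ⟨⟨hz1, hz2⟩, ⟨hzw, -⟩, hzR⟩
          rw [← ball_prod_same] at hz2
          refine ⟨z.pt.1, ⟨hz2.1, hzR⟩, ?_⟩
          conv_rhs => rw [hz1]
          simp only
          rw [← hzw]
        intro z hz z' hz'
        refine (hpc.joinedIn z (hin z hz) z' (hin z' hz')).mono ?_
        rintro _ ⟨x, hx, rfl⟩
        exact hxV x hx.1 hx.2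
    · have hd : ∃ᶠ x in 𝓝 y.pt.1, x ∉ R :=
        mem_closure_iff_frequently.1 ((hR.countable.dense_compl ℝ) y.pt.1)
      have ht : Tendsto (fun x => sec y.rep (x, w)) (𝓝 y.pt.1) (𝓝 y) := by
        have := hc.continuousAt (Metric.ball_mem_nhds _ hr)
        rwa [ContinuousAt, hys] at this
      refine ht.frequently ((hd.and_eventually (Metric.ball_mem_nhds y.pt.1 hr)).mono ?_)
      exact fun x hx => hxV x hx.2 hx.1
  obtain ⟨Γ, hΓ⟩ := h
  have hαV : α ∈ V := ⟨by simpa using hΓ 0, hα⟩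
  have hβV : β ∈ V := ⟨by simpa using hΓ 1, hβ⟩
  -- `Γ s` itself may lie over `R`, so the clopen condition concerns its neighbours in `V`, which
  -- exist and are mutually joined because a punctured disc is connected.
  let P : Set I := {s | ∀ᶠ z in 𝓝 (Γ s), z ∈ V → JoinedIn V α z}
  have hPo : IsOpen P := by
    rw [isOpen_iff_mem_nhds]
    intro s hs
    exact Γ.continuous.continuousAt.eventually hs.eventually_nhds
  have hPc : IsClosed P := by
    refine isClosed_of_closure_subset fun s hs => ?_
    obtain ⟨⟨U, hU, hUV⟩, -⟩ := hloc _ (hΓ s)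
    obtain ⟨s', hs'U, hs'⟩ := mem_closure_iff_nhds.1 hs _
      (Γ.continuous.continuousAt.eventually (eventually_mem_nhds_iff.2 hU))
    obtain ⟨z, hz, hzα, hzU⟩ := ((hloc _ (hΓ s')).2.and_eventually
      (hs'.and (show ∀ᶠ z in 𝓝 (Γ s'), z ∈ U from hs'U))).exists
    have : ∀ᶠ z' in 𝓝 (Γ s), z' ∈ V → JoinedIn V α z' := by
      filter_upwards [hU] with z' hz' hz'V
      exact (hzα hz).trans (hUV z ⟨hzU, hz⟩ z' ⟨hz', hz'V⟩)
    exact this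
  have hP0 : (0 : I) ∈ P := by
    obtain ⟨⟨U, hU, hUV⟩, -⟩ := hloc _ (hΓ 0)
    have h0 : α ∈ U := by
      have := mem_of_mem_nhds hU
      rwa [Γ.source] at this
    have : ∀ᶠ z' in 𝓝 (Γ 0), z' ∈ V → JoinedIn V α z' := by
      filter_upwards [hU] with z' hz' hz'V
      exact hUV α ⟨h0, hαV⟩ z' ⟨hz', hz'V⟩
    exact this
  have hP1 : (1 : I) ∈ P := by
    rw [IsClopen.eq_univ ⟨hPc, hPo⟩ ⟨0, hP0⟩]; exact mem_univ _
  have := hP1.self_of_nhds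
  rw [Γ.target] at this
  exact this hβV

/-- The derivative extends over a ball off `S` whose size does not depend on the germ, and a
primitive extends over the whole disc on which its derivative does. -/
lemma IsContinuationSystem.exists_vertical_lift (hX : IsContinuationSystem S X) (H : C(I, ℂ)) (w : W)
    (hH : ∀ s, (H s, w) ∉ S) {e : AnalyticGerm (ℂ × W)} (he : e.dx ∈ X) (hp : e.pt = (H 0, w)) :
    ∃ Γ : C(I, AnalyticGerm (ℂ × W)), Γ 0 = e ∧ ∀ s, (Γ s).pt = (H s, w) ∧ (Γ s).dx ∈ X := by
  refine exists_continuousMap_of_local_extension (fun s => {g : AnalyticGerm (ℂ × W) | g.pt = (H s, w) ∧ g.dx ∈ X})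
    (fun t => ?_) ⟨hp, he⟩
  obtain ⟨r, hr, hball⟩ := hX.exists_ball (hH t)
  refine ⟨H ⁻¹' Metric.ball (H t) r, H.continuous.continuousAt (Metric.ball_mem_nhds _ hr),
    fun t₀ ht₀ g hg => ?_⟩
  have hmem : (H t₀, w) ∈ Metric.ball (H t, w) r := by
    rw [← ball_prod_same]; exact ⟨ht₀, Metric.mem_ball_self hr⟩
  obtain ⟨f, hf, hfg, hfX⟩ := hX.exists_extension g.dx hg.2 _ _ hball
    (by rw [pt_dx, hg.1]; exact hmem)
  rw [pt_dx, hg.1] at hfg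
  rw [← ball_prod_same] at hf hfX
  obtain ⟨N', Φ, hN'o, hwN', -, hΦ, hΦf, hΦg⟩ := exists_primitive_extending Metric.isOpen_ball hf
    ht₀ (Metric.mem_ball_self hr) hg.1 hfg.symm
  refine ⟨fun s => sec Φ (H s, w), fun s hs => ?_, hΦg, fun s hs => ⟨pt_sec _ _, ?_⟩⟩
  · exact ((continuousAt_sec (hΦ (H s, w) ⟨hs, hwN'⟩)).comp (f := fun s => (H s, w))
      (by fun_prop)).continuousWithinAt
  · have hev : firstDeriv Φ =ᶠ[𝓝 (H s, w)] f := by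
      filter_upwards [(Metric.isOpen_ball.prod hN'o).mem_nhds (show (H s, w) ∈
        Metric.ball (H t) r ×ˢ N' from ⟨hs, hwN'⟩)] with q hq using hΦf q hq
    rw [dx_sec (hΦ (H s, w) ⟨hs, hwN'⟩), sec_congr hev]
    exact hfX _ ⟨hs, Metric.mem_ball_self hr⟩

/-- Radial displacement of `x` away from the points of `P`, out of the discs of radius `r`. -/
noncomputable def radialPush (P : Finset ℂ) (r : ℝ) (x : ℂ) : ℂ :=
  ∑ p ∈ P, max 0 (r / ‖x - p‖ - 1) • (x - p)

lemma continuousOn_radialPush (P : Finset ℂ) (r : ℝ) :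
    ContinuousOn (radialPush P r) {x | x ∉ P} := by
  refine continuousOn_finsetSum _ fun p hp => ?_
  have h1 : ContinuousOn (fun x : ℂ => r / ‖x - p‖) {x | x ∉ P} := by
    refine continuousOn_const.div (by fun_prop) fun x hx h => ?_
    rw [norm_eq_zero, sub_eq_zero] at h
    exact hx (h ▸ hp)
  exact (continuousOn_const.sup (h1.sub continuousOn_const)).smul (by fun_prop)

lemma radialPush_eq_zero {P : Finset ℂ} {r : ℝ} {x : ℂ}
    (hx : ∀ p ∈ P, r ≤ dist x p) : radialPush P r x = 0 := by
  refine Finset.sum_eq_zero fun p hp => ?_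
  have h1 : r / ‖x - p‖ ≤ 1 := by
    rw [← dist_eq_norm]
    exact div_le_one_of_le₀ (hx p hp) dist_nonneg
  rw [max_eq_left (by linarith), zero_smul]

/-- Separation by `2r` leaves at most one point of `P` within distance less than `r`, so at most one
summand is nonzero and `x` moves straight away from that point without approaching another. -/
lemma radialPush_spec {P : Finset ℂ} {r : ℝ} (hr : 0 < r)
    (hP : ∀ p ∈ P, ∀ p' ∈ P, p ≠ p' → 2 * r ≤ dist p p') {x : ℂ} (hx : x ∉ P) :
    (∀ u ∈ Icc (0 : ℝ) 1, x + u • radialPush P r x ∉ P) ∧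
      ∀ p ∈ P, r ≤ dist (x + radialPush P r x) p := by
  by_cases h : ∀ p ∈ P, r ≤ dist x p
  · rw [radialPush_eq_zero h]
    simp only [smul_zero, add_zero]
    exact ⟨fun _ _ => hx, h⟩
  push Not at h
  obtain ⟨p, hp, hpr⟩ := h
  have hxp : x ≠ p := fun h => hx (h ▸ hp)
  have hd : 0 < dist x p := dist_pos.2 hxp
  have hsum : radialPush P r x = (r / dist x p - 1) • (x - p) := by
    rw [radialPush, Finset.sum_eq_single p]
    · rw [max_eq_right, dist_eq_norm]
      rw [← dist_eq_norm, sub_nonneg, one_le_div hd]; exact hpr.le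
    · intro p' hp' hne
      have h1 := hP p hp p' hp' (Ne.symm hne)
      have h2 := dist_triangle_left p p' x
      have h3 : r / ‖x - p'‖ ≤ 1 := by
        rw [← dist_eq_norm]
        exact div_le_one_of_le₀ (by linarith) dist_nonneg
      rw [max_eq_left (by linarith), zero_smul]
    · exact fun h => absurd hp h
  have hdist : ∀ u ∈ Icc (0 : ℝ) 1, dist (x + u • radialPush P r x) p = dist x p + u * (r - dist x p) := by
    intro u hu
    have h1 : x + u • radialPush P r x - p = (1 + u * (r / dist x p - 1)) • (x - p) := by
      rw [hsum, add_smul, one_smul, mul_smul]; ring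
    have h2 : 1 ≤ r / dist x p := by rw [one_le_div hd]; exact hpr.le
    have h3 : 0 ≤ 1 + u * (r / dist x p - 1) := by
      have := mul_nonneg hu.1 (sub_nonneg.2 h2); linarith
    rw [dist_eq_norm, h1, norm_smul, Real.norm_eq_abs, abs_of_nonneg h3, ← dist_eq_norm]
    field_simp
  have hfar : ∀ u ∈ Icc (0 : ℝ) 1, ∀ p' ∈ P, p' ≠ p → r ≤ dist (x + u • radialPush P r x) p' := by
    intro u hu p' hp' hne
    have h1 := hP p hp p' hp' (Ne.symm hne)
    have h2 := dist_triangle_left p p' (x + u • radialPush P r x)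
    have h3 := hdist u hu
    have h4 : u * (r - dist x p) ≤ r - dist x p := mul_le_of_le_one_left (by linarith) hu.2
    linarith
  refine ⟨fun u hu hmem => ?_, fun p' hp' => ?_⟩
  · by_cases h1 : x + u • radialPush P r x = p
    · have h2 := hdist u hu
      rw [h1, dist_self] at h2
      have := mul_nonneg hu.1 (show 0 ≤ r - dist x p by linarith)
      linarith
    · have := hfar u hu _ hmem h1
      rw [dist_self] at this
      linarith
  · have h1 : (1 : ℝ) ∈ Icc (0 : ℝ) 1 := ⟨zero_le_one, le_rfl⟩
    by_cases h : p' = p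
    · subst h
      have := hdist 1 h1
      rw [one_smul] at this
      rw [this]; linarith
    · have := hfar 1 h1 p' hp' h
      rwa [one_smul] at this

lemma sec_segmentPrimitive_zero {r : ℝ} {N : Set W} (hN : IsOpen N) {f : ℂ × W → ℂ}
    (hr : 0 < r) (hf : AnalyticOnNhd ℂ f (Metric.ball 0 r ×ˢ N)) {b : AnalyticGerm (ℂ × W)} {w₀ : W}
    (hw₀ : w₀ ∈ N) (hp : b.pt = (0, w₀)) (hb : b.dx = sec f (0, w₀))
    (hb₀ : ∀ᶠ w in 𝓝 w₀, b.rep (0, w) = 0) : sec (segmentPrimitive 0 f) (0, w₀) = b := by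
  have hmem : ((0 : ℂ), w₀) ∈ Metric.ball (0 : ℂ) r ×ˢ N := ⟨Metric.mem_ball_self hr, hw₀⟩
  have hbr : AnalyticAt ℂ b.rep (0, w₀) := hp ▸ b.analyticAt_rep
  rw [← b.sec_rep, hp]
  refine sec_congr (eventuallyEq_of_firstDeriv (analyticAt_segmentPrimitive hf _ hmem) hbr ?_ ?_)
  · have h1 : firstDeriv (segmentPrimitive 0 f) =ᶠ[𝓝 (0, w₀)] f := by
      filter_upwards [(Metric.isOpen_ball.prod hN).mem_nhds hmem] with q hq
        using firstDeriv_segmentPrimitive hf hq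
    have h2 : firstDeriv b.rep =ᶠ[𝓝 (0, w₀)] f := by
      refine (sec_eq_sec hbr.firstDeriv (hf _ hmem)).1 ?_
      rw [← hb, dx, hp]
    exact h1.trans h2.symm
  · filter_upwards [hb₀] with w hw
    rw [hw, segmentPrimitive_self]

end VerticalContinuation

/-! ### Local extension of the primitive in all variables. -/

section LocalExtension

open AnalyticGerm unitInterval

variable {W : Type*} [NormedAddCommGroup W] [NormedSpace ℂ W] {S : Set (ℂ × W)}
  {X : Set (AnalyticGerm (ℂ × W))}

/-- Two vertical germs which are joined off the points of `P` are joined by a lift of a path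
which stays at distance at least `r` from `P`. -/
lemma IsContinuationSystem.exists_lift_radialPush (hX : IsContinuationSystem S X) {w : W}
    {P : Finset ℂ} {r : ℝ} (hr : 0 < r)
    (hP : ∀ p ∈ P, ∀ p' ∈ P, p ≠ p' → 2 * r ≤ dist p p') (hPS : ∀ x, (x, w) ∈ S → x ∈ P)
    {α β : AnalyticGerm (ℂ × W)}
    (h : JoinedIn (verticalGerms S X w ∩ {g | g.pt.1 ∉ P}) α β)
    (hα : ∀ p ∈ P, r ≤ dist α.pt.1 p) (hβ : ∀ p ∈ P, r ≤ dist β.pt.1 p) :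
    ∃ (H : C(I, ℂ)) (Γ : C(I, AnalyticGerm (ℂ × W))), (∀ s, ∀ p ∈ P, r ≤ dist (H s) p) ∧
      (∀ s, (Γ s).pt = (H s, w)) ∧ Γ 0 = α ∧ Γ 1 = β := by
  obtain ⟨Γ, hΓ⟩ := h
  have hpt : ∀ s, (Γ s).pt = ((Γ s).pt.1, w) := fun s => by rw [← (hΓ s).1.1]
  have hΓP : ∀ s, (Γ s).pt.1 ∉ P := fun s => (hΓ s).2
  have hΓc : Continuous fun s => (Γ s).pt.1 :=
    continuous_fst.comp (continuous_pt.comp Γ.continuous)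
  have hpush : Continuous fun s => radialPush P r (Γ s).pt.1 :=
    (continuousOn_radialPush P r).comp_continuous hΓc hΓP
  -- A homotopy off `P` from the given path to the pushed one; its ends are fixed because the push
  -- vanishes at distance at least `r` from `P`.
  let K : I × I → ℂ := fun y => (Γ y.1).pt.1 + (y.2 : ℝ) • radialPush P r (Γ y.1).pt.1
  have hKc : Continuous K := by
    have h1 : Continuous fun y : I × I => (Γ y.1).pt.1 := hΓc.comp continuous_fst
    have h2 : Continuous fun y : I × I => radialPush P r (Γ y.1).pt.1 := hpush.comp continuous_fst
    fun_prop
  have hKP : ∀ s u, K (s, u) ∉ P := fun s u => (radialPush_spec hr hP (hΓP s)).1 u u.2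
  have hK0 : ∀ u, K (0, u) = α.pt.1 := fun u => by
    simp only [K, Γ.source, radialPush_eq_zero hα, smul_zero, add_zero]
  have hK1 : ∀ u, K (1, u) = β.pt.1 := fun u => by
    simp only [K, Γ.target, radialPush_eq_zero hβ, smul_zero, add_zero]
  have hαw : α.pt = (α.pt.1, w) := by have := hpt 0; rwa [Γ.source] at this
  have hβw : β.pt = (β.pt.1, w) := by have := hpt 1; rwa [Γ.target] at this
  have hαX : α.dx ∈ X := by
    have := (hΓ 0).1.2
    rw [Γ.source] at this
    refine mem_of_mem_germClosure this fun hS => ?_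
    rw [pt_dx, hαw] at hS
    have h2 := hΓP 0
    rw [Γ.source] at h2
    exact h2 (hPS _ hS)
  obtain ⟨G, hG0, hG⟩ := exists_homotopy_lift {g : AnalyticGerm (ℂ × W) | g.dx ∈ X}
    (⟨fun y => (K y, w), by fun_prop⟩ : C(I × I, ℂ × W)) (fun _ => α) continuous_const
    (fun u => hX.exists_vertical_lift ⟨fun s => K (s, u), by fun_prop⟩ w
      (fun s hs => hKP s u (hPS _ hs)) hαX (by simp only [ContinuousMap.coe_mk, hK0]; exact hαw))
  have hGp : ∀ y, (G y).pt = (K y, w) := fun y => (hG y).1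
  refine ⟨⟨fun s => K (s, 1), by fun_prop⟩, ⟨fun s => G (s, 1), by fun_prop⟩, fun s p hp => ?_,
    fun s => hGp _, hG0 _, ?_⟩
  · have := (radialPush_spec hr hP (hΓP s)).2 p hp
    simpa [K] using this
  · have h1 : EqOn (fun s => G (s, 0)) Γ univ := by
      refine eqOn_of_preconnected isPreconnected_univ (by fun_prop) Γ.continuous.continuousOn
        (fun s _ => ?_) (mem_univ 0) (by rw [hG0, Γ.source])
      rw [hGp, hpt s]; simp [K]
    -- The base point of `G (1, u)` does not move, so by uniqueness of lifts neither does the germ.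
    have h2 : EqOn (fun u => G (1, u)) (fun _ => β) univ := by
      refine eqOn_of_preconnected isPreconnected_univ (by fun_prop) continuousOn_const
        (fun u _ => ?_) (mem_univ 0) ?_
      · rw [hGp, hK1, ← hβw]
      · have := h1 (mem_univ 1)
        simp only [Γ.target] at this
        exact this
    exact h2 (mem_univ 1)

lemma exists_notMem_finset_of_ball (c : ℂ) {r : ℝ} (hr : 0 < r) (C : Finset ℂ) :
    ∃ a ∈ Metric.ball c r, a ∉ C := by
  obtain ⟨a, ha⟩ := (isPathConnected_ball_diff_finite (c := c) hr C.finite_toSet).nonempty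
  exact ⟨a, ha.1, ha.2⟩

lemma Finset.exists_pos_forall_le {ι : Type*} (s : Finset ι) (d : ι → ℝ) (hd : ∀ i ∈ s, 0 < d i) :
    ∃ r > 0, ∀ i ∈ s, r ≤ d i := by
  have hfin : ∀ᶠ r : ℝ in 𝓝[>] 0, ∀ i ∈ s, r ≤ d i := by
    rw [Finset.eventually_all]
    intro i hi
    filter_upwards [Ioo_mem_nhdsGT (hd i hi)] with η hη using hη.2.le
  obtain ⟨r, h1, h2⟩ := (hfin.and self_mem_nhdsWithin).exists
  exact ⟨r, h2, h1⟩

/-- Uniform local extension of the germs of `∫₀ˣ F` in all variables. -/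
lemma IsContinuationSystem.exists_extension_of_joinedIn (hX : IsContinuationSystem S X)
    {Z : Set (ℂ × W)} (hZ : IsClosed Z) (hSZ : S ⊆ Z) {w₁ : W} (hw₁ : HasSimpleFibers Z w₁)
    (x₁ : ℂ) :
    ∃ ρ > 0, ∃ η > 0, ∀ x₀ ∈ Metric.ball x₁ ρ, ∀ w₀ ∈ Metric.ball w₁ η,
      ((0, w₁) ∈ Z → (0, w₀) ∈ Z) → ((x₁, w₁) ∈ Z → (x₀, w₀) ∈ Z) →
      ∀ b e : AnalyticGerm (ℂ × W), b.pt = (0, w₀) → b.dx ∈ germClosure S X →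
      (∀ᶠ w in 𝓝 w₀, b.rep (0, w) = 0) → e.pt = (x₀, w₀) → JoinedIn (verticalGerms S X w₀) b e →
      ∃ Ψ Φ : ℂ × W → ℂ, AnalyticOnNhd ℂ Ψ (Metric.ball 0 ρ ×ˢ Metric.ball w₁ η) ∧
        sec Ψ (0, w₀) = b ∧ AnalyticOnNhd ℂ Φ (Metric.ball x₁ ρ ×ˢ Metric.ball w₁ η) ∧
        sec Φ (x₀, w₀) = e ∧ ∀ q ∈ Metric.ball x₁ ρ ×ˢ Metric.ball w₁ η,
          JoinedIn (verticalGerms S X q.2) (sec Ψ (0, q.2)) (sec Φ q) := by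
  obtain ⟨ρ₀, hρ₀, η₀, hη₀, hext₀⟩ := hX.exists_extension_of_hasSimpleFibers hZ hSZ hw₁ 0
  obtain ⟨ρ₁, hρ₁, η₁, hη₁, hext₁⟩ := hX.exists_extension_of_hasSimpleFibers hZ hSZ hw₁ x₁
  obtain ⟨C, hC⟩ := hw₁
  set ρ := min ρ₀ ρ₁ with hρdef
  have hρ : 0 < ρ := lt_min hρ₀ hρ₁
  -- The ends `0` and `x₀` may themselves be fibre points, so the path is made to run between
  -- auxiliary points `a`, `b'` off the fibre, within the discs where the derivative extends.
  obtain ⟨a, ha, haC⟩ := exists_notMem_finset_of_ball 0 hρ C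
  obtain ⟨b', hb', hbC⟩ := exists_notMem_finset_of_ball x₁ hρ C
  obtain ⟨ra, hra, hraC⟩ := C.exists_pos_forall_le (fun c => dist a c)
    fun c hc => dist_pos.2 fun h => haC (h ▸ hc)
  obtain ⟨rb, hrb, hrbC⟩ := C.exists_pos_forall_le (fun c => dist b' c)
    fun c hc => dist_pos.2 fun h => hbC (h ▸ hc)
  obtain ⟨rc, hrc, hrcC⟩ := C.offDiag.exists_pos_forall_le (fun c => dist c.1 c.2)
    fun c hc => dist_pos.2 (Finset.mem_offDiag.1 hc).2.2
  -- Fibre points will move by less than `r / 4`: over `w₀` they remain `2r` apart and at least `r`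
  -- from `a` and `b'`.
  obtain ⟨r, hr, hr1, hr2, hr3⟩ : ∃ r > 0, 2 * r ≤ ra ∧ 2 * r ≤ rb ∧ 4 * r ≤ rc := by
    refine ⟨min (ra / 2) (min (rb / 2) (rc / 4)), by positivity, ?_, ?_, ?_⟩
    · linarith [min_le_left (ra / 2) (min (rb / 2) (rc / 4))]
    · linarith [(min_le_right (ra / 2) (min (rb / 2) (rc / 4))).trans (min_le_left _ _)]
    · linarith [(min_le_right (ra / 2) (min (rb / 2) (rc / 4))).trans (min_le_right _ _)]
  obtain ⟨ξ, hξ⟩ := hC (r / 4) (by positivity)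
  obtain ⟨η₂, hη₂, hN₂⟩ := Metric.eventually_nhds_iff_ball.1 hξ
  set η := min (min η₀ η₁) η₂ with hηdef
  have hη : 0 < η := lt_min (lt_min hη₀ hη₁) hη₂
  set N := Metric.ball w₁ η with hNdef
  have hN0 : N ⊆ Metric.ball w₁ η₀ :=
    Metric.ball_subset_ball ((min_le_left _ _).trans (min_le_left _ _))
  have hN1 : N ⊆ Metric.ball w₁ η₁ :=
    Metric.ball_subset_ball ((min_le_left _ _).trans (min_le_right _ _))
  have hN : ∀ w ∈ N, (∀ c ∈ C, dist (ξ c w) c < r / 4) ∧ ∀ x, (x, w) ∈ Z ↔ ∃ c ∈ C, x = ξ c w :=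
    fun w hw => hN₂ w (Metric.ball_subset_ball (min_le_right _ _) hw)
  have hNo : IsOpen N := Metric.isOpen_ball
  have hD0 : Metric.ball (0 : ℂ) ρ ⊆ Metric.ball 0 ρ₀ := Metric.ball_subset_ball (min_le_left _ _)
  have hD1 : Metric.ball x₁ ρ ⊆ Metric.ball x₁ ρ₁ := Metric.ball_subset_ball (min_le_right _ _)
  refine ⟨ρ, hρ, η, hη, fun x₀ hx₀ w₀ hw₀ h0Z h1Z b e hb hbX hb₀ he hbe => ?_⟩
  have hbw : b ∈ verticalGerms S X w₀ := ⟨by rw [hb], hbX⟩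
  have heX : e.dx ∈ germClosure S X := hbe.target_mem.2
  obtain ⟨f₀, hf₀, hf₀b, hf₀X⟩ := hext₀ 0 (Metric.mem_ball_self hρ₀) w₀ (hN0 hw₀) h0Z b.dx hbX
    (by rw [pt_dx, hb])
  obtain ⟨f₁, hf₁, hf₁e, hf₁X⟩ := hext₁ x₀ (hD1 hx₀) w₀ (hN1 hw₀) h1Z e.dx heX (by rw [pt_dx, he])
  replace hf₀ : AnalyticOnNhd ℂ f₀ (Metric.ball 0 ρ ×ˢ N) := hf₀.mono (prod_mono hD0 hN0)
  replace hf₁ : AnalyticOnNhd ℂ f₁ (Metric.ball x₁ ρ ×ˢ N) := hf₁.mono (prod_mono hD1 hN1)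
  replace hf₀X : ∀ q ∈ Metric.ball 0 ρ ×ˢ N, sec f₀ q ∈ germClosure S X :=
    fun q hq => hf₀X q (prod_mono hD0 hN0 hq)
  replace hf₁X : ∀ q ∈ Metric.ball x₁ ρ ×ˢ N, sec f₁ q ∈ germClosure S X :=
    fun q hq => hf₁X q (prod_mono hD1 hN1 hq)
  -- germs of primitives
  have hprim : ∀ (c : ℂ) (N' : Set W) (g h : ℂ × W → ℂ), IsOpen N' →
      (∀ q ∈ Metric.ball c ρ ×ˢ N', firstDeriv g q = h q) →
      (∀ q ∈ Metric.ball c ρ ×ˢ N', sec h q ∈ germClosure S X) →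
      ∀ q ∈ Metric.ball c ρ ×ˢ N', sec (firstDeriv g) q ∈ germClosure S X := by
    intro c N' g h hN' hgh hh q hq
    have : firstDeriv g =ᶠ[𝓝 q] h := by
      filter_upwards [(Metric.isOpen_ball.prod hN').mem_nhds hq] with q hq using hgh q hq
    rw [sec_congr this]; exact hh q hq
  set Ψ := segmentPrimitive 0 f₀ with hΨdef
  have hΨ : AnalyticOnNhd ℂ Ψ (Metric.ball 0 ρ ×ˢ N) := analyticAt_segmentPrimitive hf₀
  have hΨX := hprim 0 N Ψ f₀ hNo (fun q hq => firstDeriv_segmentPrimitive hf₀ hq) hf₀X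
  have hΨb : sec Ψ (0, w₀) = b := sec_segmentPrimitive_zero hNo hρ hf₀ hw₀ hb hf₀b.symm hb₀
  obtain ⟨N', Φ₁, hN'o, hw₀N', hN'N, hΦ₁, hΦ₁f, hΦ₁e⟩ :=
    exists_primitive_extending hNo hf₁ hx₀ hw₀ he hf₁e.symm
  have hΦ₁X := hprim x₁ N' Φ₁ f₁ hN'o hΦ₁f fun q hq => hf₁X q ⟨hq.1, hN'N hq.2⟩
  -- a path avoiding the fibre of `Z`
  classical
  let P : Finset ℂ := C.image fun c => ξ c w₀
  obtain ⟨hξ₀, hZ₀⟩ := hN w₀ hw₀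
  have hPZ : ∀ x, (x, w₀) ∈ Z ↔ x ∈ P := fun x => by
    rw [hZ₀, Finset.mem_image]
    exact ⟨fun ⟨c, hc, h⟩ => ⟨c, hc, h.symm⟩, fun ⟨c, hc, h⟩ => ⟨c, hc, h.symm⟩⟩
  have hPsep : ∀ p ∈ P, ∀ p' ∈ P, p ≠ p' → 2 * r ≤ dist p p' := by
    intro p hp p' hp' hne
    obtain ⟨c, hc, rfl⟩ := Finset.mem_image.1 hp
    obtain ⟨c', hc', rfl⟩ := Finset.mem_image.1 hp'
    have hcc : c ≠ c' := fun h => hne (by rw [h])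
    have h1 := hrcC (c, c') (Finset.mem_offDiag.2 ⟨hc, hc', hcc⟩)
    have h2 := hξ₀ c hc
    have h3 := hξ₀ c' hc'
    have h4 := dist_triangle4 c (ξ c w₀) (ξ c' w₀) c'
    rw [dist_comm c (ξ c w₀)] at h4
    simp only at h1
    linarith
  have hfarP : ∀ y : ℂ, (∀ c ∈ C, 2 * r ≤ dist y c) → ∀ p ∈ P, r ≤ dist y p := by
    intro y hy p hp
    obtain ⟨c, hc, rfl⟩ := Finset.mem_image.1 hp
    have h1 := hy c hc
    have h2 := hξ₀ c hc
    have h3 := dist_triangle y (ξ c w₀) c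
    linarith
  have haP := hfarP a fun c hc => hr1.trans (hraC c hc)
  have hbP := hfarP b' fun c hc => hr2.trans (hrbC c hc)
  have hnotP : ∀ y, (∀ p ∈ P, r ≤ dist y p) → y ∉ P := fun y hy hyP => by
    have := hy y hyP
    rw [dist_self] at this
    linarith
  have hjoin : JoinedIn (verticalGerms S X w₀) (sec Ψ (a, w₀)) (sec Φ₁ (b', w₀)) := by
    have j1 := joinedIn_verticalGerms (fun x hx => hΨ (x, w₀) ⟨hx, hw₀⟩)
      (fun x hx => hΨX (x, w₀) ⟨hx, hw₀⟩) ha (Metric.mem_ball_self hρ)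
    have j2 := joinedIn_verticalGerms (fun x hx => hΦ₁ (x, w₀) ⟨hx, hw₀N'⟩)
      (fun x hx => hΦ₁X (x, w₀) ⟨hx, hw₀N'⟩) hx₀ hb'
    rw [hΨb] at j1
    rw [hΦ₁e] at j2
    exact (j1.trans hbe).trans j2
  have hjoin' := joinedIn_verticalGerms_avoiding hjoin P.finite_toSet
    (by rw [pt_sec]; exact hnotP _ haP) (by rw [pt_sec]; exact hnotP _ hbP)
  obtain ⟨H, Γ, hHP, hΓp, hΓ0, hΓ1⟩ := hX.exists_lift_radialPush hr hPsep
    (fun x hx => (hPZ x).1 (hSZ hx)) hjoin' (by rw [pt_sec]; exact haP) (by rw [pt_sec]; exact hbP)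
  have hH0 : H 0 = a := by
    have := hΓp 0
    rw [hΓ0, pt_sec] at this
    exact (congrArg Prod.fst this).symm
  have hH1 : H 1 = b' := by
    have := hΓp 1
    rw [hΓ1, pt_sec] at this
    exact (congrArg Prod.fst this).symm
  -- The path keeps distance `r` from the fibre over `w₀`, and corresponding points of the fibre
  -- over `w` are within `r / 2` of those.
  have hHZ : ∀ s, ∀ w ∈ N, (H s, w) ∉ Z := by
    intro s w hw hZm
    obtain ⟨h1, h2⟩ := hN w hw
    obtain ⟨c, hc, h3⟩ := (h2 _).1 hZm
    have h4 := hHP s (ξ c w₀) (Finset.mem_image.2 ⟨c, hc, rfl⟩)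
    have h5 := hξ₀ c hc
    have h6 := h1 c hc
    rw [h3] at h4
    have h7 := dist_triangle_right (ξ c w) (ξ c w₀) c
    linarith
  -- continuation of the primitive along this path, for all parameters
  obtain ⟨G, hGc, hG0, hG⟩ := exists_homotopy_lift_on (Y₀ := N)
    {g : AnalyticGerm (ℂ × W) | g.dx ∈ X} (fun y : I × W => (H y.1, y.2)) (by fun_prop)
    (fun w => sec Ψ (a, w))
    (fun w hw => ((continuousAt_sec (hΨ (a, w) ⟨ha, hw⟩)).comp
      (f := fun w => (a, w)) (by fun_prop)).continuousWithinAt)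
    (fun w hw => hX.exists_vertical_lift H w (fun s hs => hHZ s w hw (hSZ hs))
      (by
        rw [dx_sec (hΨ _ ⟨ha, hw⟩)]
        refine mem_of_mem_germClosure (hΨX _ ⟨ha, hw⟩) fun hS => hHZ 0 w hw (hSZ ?_)
        rw [pt_sec] at hS
        rwa [hH0])
      (by rw [pt_sec, hH0]))
  have hGp : ∀ s, ∀ w ∈ N, (G (s, w)).pt = (H s, w) := fun s w hw => (hG s w hw).1
  have hGs : ∀ w ∈ N, Continuous fun s => G (s, w) := fun w hw =>
    hGc.comp_continuous (by fun_prop) fun s => ⟨mem_univ _, hw⟩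
  have hG1c : ContinuousOn (fun w => G (1, w)) N :=
    hGc.comp (by fun_prop) fun w hw => ⟨mem_univ _, hw⟩
  have hG1p : ∀ w ∈ N, (G (1, w)).pt = (b', w) := fun w hw => by rw [hGp 1 w hw, hH1]
  have hG1 : G (1, w₀) = sec Φ₁ (b', w₀) := by
    rw [← hΓ1]
    have : EqOn (fun s => G (s, w₀)) Γ univ := by
      refine eqOn_of_preconnected isPreconnected_univ (hGs w₀ hw₀).continuousOn
        Γ.continuous.continuousOn (fun s _ => ?_) (mem_univ 0) (by rw [hG0 _ hw₀, hΓ0])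
      rw [hGp s w₀ hw₀, hΓp]
    exact this (mem_univ 1)
  have hGrep : ∀ w ∈ N, ∀ h : ℂ × W → ℂ, AnalyticAt ℂ h (b', w) → sec h (b', w) = G (1, w) →
      ∀ᶠ v in 𝓝 w, (G (1, v)).val = h (b', v) := by
    intro w hw h hh hhG
    have h1 := (hG1c.continuousAt (hNo.mem_nhds hw)).eventually
      (eventually_eq_sec (f := h) (by rw [hG1p w hw]; exact hh) (by rw [hG1p w hw]; exact hhG))
    filter_upwards [h1, hNo.mem_nhds hw] with v hv hvN
    rw [hG1p v hvN] at hv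
    rw [hv.1, val_sec hv.2]
  -- the extension
  set Ψ₁ := segmentPrimitive x₁ f₁ with hΨ₁def
  have hΨ₁ : AnalyticOnNhd ℂ Ψ₁ (Metric.ball x₁ ρ ×ˢ N) := analyticAt_segmentPrimitive hf₁
  -- The constant of integration, read off at `b'` from the continuation along `H`; it is defined on
  -- all of `N`, unlike the one in `Φ₁`.
  let k : W → ℂ := fun w => (G (1, w)).val - Ψ₁ (b', w)
  have hk : ∀ w ∈ N, AnalyticAt ℂ k w := by
    intro w hw
    have hsl : ∀ h : ℂ × W → ℂ, AnalyticAt ℂ h (b', w) → AnalyticAt ℂ (fun v => h (b', v)) w :=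
      fun h hh => AnalyticAt.fun_comp (f := fun v : W => (b', v)) hh
        (analyticAt_const.prod analyticAt_id)
    have h1 : AnalyticAt ℂ (G (1, w)).rep (b', w) := by
      rw [← hG1p w hw]; exact (G (1, w)).analyticAt_rep
    have h2 : sec (G (1, w)).rep (b', w) = G (1, w) := by
      conv_rhs => rw [← (G (1, w)).sec_rep, hG1p w hw]
    exact ((hsl _ h1).congr ((hGrep w hw _ h1 h2).mono fun v hv => hv.symm)).sub
      (hsl _ (hΨ₁ _ ⟨hb', hw⟩))
  let Φ : ℂ × W → ℂ := fun q => Ψ₁ q + k q.2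
  have hΦ : AnalyticOnNhd ℂ Φ (Metric.ball x₁ ρ ×ˢ N) := fun q hq =>
    (hΨ₁ q hq).add (AnalyticAt.fun_comp (g := k) (hk q.2 hq.2) analyticAt_snd)
  have hΦf : ∀ q ∈ Metric.ball x₁ ρ ×ˢ N, firstDeriv Φ q = f₁ q := fun q hq => by
    rw [← firstDeriv_segmentPrimitive hf₁ hq]
    have h1 := (hΦ q hq).hasDerivAt_slice
    have h2 := (hΨ₁ q hq).hasDerivAt_slice.add_const (k q.2)
    exact h1.unique h2
  have hΦX := hprim x₁ N Φ f₁ hNo hΦf hf₁X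
  have hΦb : ∀ w, Φ (b', w) = (G (1, w)).val := fun w => by simp [Φ, k]
  have hsecΦ₀ : sec Φ (b', w₀) = sec Φ₁ (b', w₀) := by
    have hm : (b', w₀) ∈ Metric.ball x₁ ρ ×ˢ N' := ⟨hb', hw₀N'⟩
    refine sec_congr (eventuallyEq_of_firstDeriv (hΦ _ ⟨hb', hw₀⟩) (hΦ₁ _ hm) ?_ ?_)
    · filter_upwards [(Metric.isOpen_ball.prod hN'o).mem_nhds hm] with q hq
      rw [hΦ₁f q hq, hΦf q ⟨hq.1, hN'N hq.2⟩]
    · filter_upwards [hGrep w₀ hw₀ Φ₁ (hΦ₁ _ hm) hG1.symm] with w hw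
      rw [hΦb, hw]
  have hsecΦ : ∀ w ∈ N, sec Φ (b', w) = G (1, w) := by
    have : EqOn (fun w => sec Φ (b', w)) (fun w => G (1, w)) N := by
      refine eqOn_of_preconnected (convex_ball w₁ η).isPreconnected
        (fun w hw => ((continuousAt_sec (hΦ (b', w) ⟨hb', hw⟩)).comp
          (f := fun w => (b', w)) (by fun_prop)).continuousWithinAt) hG1c
        (fun w hw => by rw [pt_sec, hG1p w hw]) hw₀ ?_
      rw [hsecΦ₀, hG1]
    exact fun w hw => this hw
  refine ⟨Ψ, Φ, hΨ, hΨb, hΦ, ?_, fun q hq => ?_⟩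
  · have : EqOn (fun x => sec Φ (x, w₀)) (fun x => sec Φ₁ (x, w₀)) (Metric.ball x₁ ρ) := by
      refine eqOn_of_preconnected (convex_ball x₁ ρ).isPreconnected
        (fun x hx => ((continuousAt_sec (hΦ (x, w₀) ⟨hx, hw₀⟩)).comp
          (f := fun x => (x, w₀)) (by fun_prop)).continuousWithinAt)
        (fun x hx => ((continuousAt_sec (hΦ₁ (x, w₀) ⟨hx, hw₀N'⟩)).comp
          (f := fun x => (x, w₀)) (by fun_prop)).continuousWithinAt)
        (fun x _ => by simp) hb' hsecΦ₀
    rw [← hΦ₁e]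
    exact this hx₀
  · obtain ⟨x, w⟩ := q
    obtain ⟨hx, hw⟩ := hq
    have j1 := joinedIn_verticalGerms (fun x hx => hΨ (x, w) ⟨hx, hw⟩)
      (fun x hx => hΨX (x, w) ⟨hx, hw⟩) (Metric.mem_ball_self hρ) ha
    have j2 : JoinedIn (verticalGerms S X w) (sec Ψ (a, w)) (G (1, w)) := by
      refine ⟨⟨⟨fun s => G (s, w), hGs w hw⟩, hG0 w hw, rfl⟩, fun s => ⟨?_, ?_⟩⟩
      · exact congrArg Prod.snd (hGp s w hw)
      · exact hX.subset_germClosure (hG s w hw).2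
    have j3 := joinedIn_verticalGerms (fun x hx => hΦ (x, w) ⟨hx, hw⟩)
      (fun x hx => hΦX (x, w) ⟨hx, hw⟩) hb' hx
    rw [hsecΦ w hw] at j3
    exact (j1.trans j2).trans j3

end LocalExtension

/-! ### Continuation along a whole path. -/

section LiftAlongPath

open AnalyticGerm unitInterval

variable {W : Type*} [NormedAddCommGroup W] [NormedSpace ℂ W] {S : Set (ℂ × W)}
  {X : Set (AnalyticGerm (ℂ × W))}

/-- The germs at `(0, w)` which vanish on `{0} × W` and whose derivative in the first variable
belongs to the closure of `X`. -/
def basePrimitiveGerms (S : Set (ℂ × W)) (X : Set (AnalyticGerm (ℂ × W))) (w : W) :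
    Set (AnalyticGerm (ℂ × W)) :=
  {b | b.pt = (0, w) ∧ b.dx ∈ germClosure S X ∧ ∀ᶠ v in 𝓝 w, b.rep (0, v) = 0}

lemma sec_segmentPrimitive_mem_basePrimitiveGerms {r : ℝ} {N : Set W} (hN : IsOpen N)
    {f : ℂ × W → ℂ} (hr : 0 < r) (hf : AnalyticOnNhd ℂ f (Metric.ball 0 r ×ˢ N)) {w : W}
    (hw : w ∈ N) (hX : sec f (0, w) ∈ germClosure S X) :
    sec (segmentPrimitive 0 f) (0, w) ∈ basePrimitiveGerms S X w := by
  have hmem : ((0 : ℂ), w) ∈ Metric.ball (0 : ℂ) r ×ˢ N := ⟨Metric.mem_ball_self hr, hw⟩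
  have ha := analyticAt_segmentPrimitive hf _ hmem
  refine ⟨pt_sec _ _, ?_, ?_⟩
  · rw [dx_sec ha]
    have h1 : firstDeriv (segmentPrimitive 0 f) =ᶠ[𝓝 (0, w)] f := by
      filter_upwards [(Metric.isOpen_ball.prod hN).mem_nhds hmem] with q hq
        using firstDeriv_segmentPrimitive hf hq
    rwa [sec_congr h1]
  · set b := sec (segmentPrimitive 0 f) (0, w) with hb
    have h1 : AnalyticAt ℂ b.rep (0, w) := by simpa [b] using b.analyticAt_rep
    have h2 : sec b.rep (0, w) = b := by simpa [b] using b.sec_rep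
    have h3 := (sec_eq_sec h1 ha).1 h2
    have h4 : Tendsto (fun v : W => ((0 : ℂ), v)) (𝓝 w) (𝓝 (0, w)) :=
      Continuous.tendsto (by fun_prop) w
    filter_upwards [h4.eventually h3] with v hv
    rw [hv, segmentPrimitive_self]

lemma unitInterval.exists_isPreconnected_mem_nhds_subset {T : Set I} {t : I} (hT : T ∈ 𝓝 t) :
    ∃ T' ∈ 𝓝 t, IsPreconnected T' ∧ T' ⊆ T := by
  obtain ⟨r, hr, hrT⟩ := Metric.mem_nhds_iff.1 hT
  refine ⟨Metric.ball t r, Metric.ball_mem_nhds t hr, ?_, hrT⟩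
  refine OrdConnected.isPreconnected ⟨fun x hx y hy z hz => ?_⟩
  simp only [Metric.mem_ball, Subtype.dist_eq, Real.dist_eq, abs_lt] at hx hy ⊢
  have h1 : (x : ℝ) ≤ z := hz.1
  have h2 : (z : ℝ) ≤ y := hz.2
  constructor <;> linarith

/-- The normalisation on `{0} × W` removes the constant of integration, so extending the derivative
near `(0, w)` determines the primitive there. The resulting `b t` fixes the branch of `F` at the
start of the integration path. -/
lemma IsContinuationSystem.exists_base_lift (hX : IsContinuationSystem S X) {ι : Type*}
    {Z : ι → Set (ℂ × W)} (hZ : ∀ J, IsClosed (Z J)) (hSZ : ∀ J, S ⊆ Z J) (ω : C(I, W))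
    (hω : ∀ t, ∃ J, HasSimpleFibers (Z J) (ω t) ∧ ((0, ω t) ∈ Z J → ∀ s, (0, ω s) ∈ Z J))
    {b₀ : AnalyticGerm (ℂ × W)} (hb₀ : b₀ ∈ basePrimitiveGerms S X (ω 0)) :
    ∃ b : C(I, AnalyticGerm (ℂ × W)), b 0 = b₀ ∧ ∀ t, b t ∈ basePrimitiveGerms S X (ω t) := by
  refine exists_continuousMap_of_local_extension (fun t => basePrimitiveGerms S X (ω t))
    (fun t => ?_) hb₀
  obtain ⟨J, hJ, hJ0⟩ := hω t
  obtain ⟨ρ, hρ, η, hη, hext⟩ := hX.exists_extension_of_hasSimpleFibers (hZ J) (hSZ J) hJ 0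
  refine ⟨ω ⁻¹' Metric.ball (ω t) η,
    ω.continuous.continuousAt.preimage_mem_nhds (Metric.ball_mem_nhds _ hη), ?_⟩
  rintro t₀ ht₀ e ⟨hep, hed, he0⟩
  obtain ⟨f, hf, hfe, hfX⟩ := hext 0 (Metric.mem_ball_self hρ) (ω t₀) ht₀ (fun h => hJ0 h t₀)
    e.dx hed (by rw [pt_dx, hep])
  refine ⟨fun s => sec (segmentPrimitive 0 f) (0, ω s), fun s hs => ?_,
    sec_segmentPrimitive_zero Metric.isOpen_ball hρ hf ht₀ hep hfe.symm he0, fun s hs => ?_⟩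
  · exact ((continuousAt_sec (analyticAt_segmentPrimitive hf (0, ω s)
      ⟨Metric.mem_ball_self hρ, hs⟩)).comp (f := fun s => ((0 : ℂ), ω s))
      (by fun_prop)).continuousWithinAt
  · exact sec_segmentPrimitive_mem_basePrimitiveGerms Metric.isOpen_ball hρ hf hs
      (hfX (0, ω s) ⟨Metric.mem_ball_self hρ, hs⟩)

/-- The germ of `∫₀ˣ F` continues along every path whose projection avoids, at each time, the
degenerate fibres of some `Z J`, provided that the paths `(0, w)` and `(x, w)` do not run into
`Z J`. -/
theorem IsContinuationSystem.exists_lift_segmentPrimitive (hX : IsContinuationSystem S X)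
    {ι : Type*} {Z : ι → Set (ℂ × W)} (hZ : ∀ J, IsClosed (Z J)) (hSZ : ∀ J, S ⊆ Z J)
    {F : ℂ × W → ℂ} {τ : ℝ} (hF : AnalyticOnNhd ℂ F (Metric.ball 0 τ))
    (hFX : ∀ q ∈ Metric.ball 0 τ, q ∉ S → sec F q ∈ X) (δ : C(I, ℂ × W))
    (hδ₀ : δ 0 ∈ Metric.ball 0 τ)
    (hδ : ∀ t, ∃ J, HasSimpleFibers (Z J) (δ t).2 ∧
      ((0, (δ t).2) ∈ Z J → ∀ s, (0, (δ s).2) ∈ Z J) ∧ (δ t ∈ Z J → ∀ s, δ s ∈ Z J)) :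
    ∃ Γ : C(I, AnalyticGerm (ℂ × W)), (∀ s, (Γ s).pt = δ s) ∧
      Γ 0 = sec (segmentPrimitive 0 F) (δ 0) := by
  have hball : Metric.ball (0 : ℂ × W) τ = Metric.ball 0 τ ×ˢ Metric.ball 0 τ :=
    (ball_prod_same _ _ _).symm
  have hFcl : ∀ q ∈ Metric.ball (0 : ℂ × W) τ, sec F q ∈ germClosure S X := fun q hq =>
    (sec_mem_germClosure (hF q hq)).2 <| by
      filter_upwards [Metric.isOpen_ball.mem_nhds hq] with p hp using hFX p hp
  have hF' : AnalyticOnNhd ℂ F (Metric.ball 0 τ ×ˢ Metric.ball 0 τ) := hball ▸ hF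
  have hδ₀' : δ 0 ∈ Metric.ball (0 : ℂ) τ ×ˢ Metric.ball (0 : W) τ := hball ▸ hδ₀
  have hτ : 0 < τ := dist_nonneg.trans_lt hδ₀
  have h0 : ((0 : ℂ), (δ 0).2) ∈ Metric.ball (0 : ℂ × W) τ :=
    hball ▸ ⟨Metric.mem_ball_self hτ, hδ₀'.2⟩
  let ω : C(I, W) := ⟨fun t => (δ t).2, by fun_prop⟩
  obtain ⟨b, hb0, hb⟩ := hX.exists_base_lift hZ hSZ ω
    (fun t => by obtain ⟨J, h1, h2, -⟩ := hδ t; exact ⟨J, h1, h2⟩)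
    (sec_segmentPrimitive_mem_basePrimitiveGerms Metric.isOpen_ball hτ hF' hδ₀'.2
      (hFcl (0, (δ 0).2) h0))
  have hprim := analyticAt_segmentPrimitive hF'
  -- Joinedness to `b t` does not refer to any `J`, so it survives a change of `J` between steps.
  suffices H : ∃ Γ : C(I, AnalyticGerm (ℂ × W)), Γ 0 = sec (segmentPrimitive 0 F) (δ 0) ∧
      ∀ t, Γ t ∈ {e | e.pt = δ t ∧ JoinedIn (verticalGerms S X (ω t)) (b t) e} by
    obtain ⟨Γ, hΓ0, hΓ⟩ := H
    exact ⟨Γ, fun s => (hΓ s).1, hΓ0⟩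
  refine exists_continuousMap_of_local_extension
    (fun t => {e | e.pt = δ t ∧ JoinedIn (verticalGerms S X (ω t)) (b t) e})
    (fun t => ?_) ⟨pt_sec _ _, ?_⟩
  · obtain ⟨J, hJ, hJ0, hJδ⟩ := hδ t
    obtain ⟨ρ, hρ, η, hη, hext⟩ :=
      hX.exists_extension_of_joinedIn (hZ J) (hSZ J) hJ (δ t).1
    have hT : δ ⁻¹' (Metric.ball (δ t).1 ρ ×ˢ Metric.ball (δ t).2 η) ∈ 𝓝 t :=
      δ.continuous.continuousAt.preimage_mem_nhds
        (prod_mem_nhds (Metric.ball_mem_nhds _ hρ) (Metric.ball_mem_nhds _ hη))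
    obtain ⟨T, hTt, hTc, hTsub⟩ := unitInterval.exists_isPreconnected_mem_nhds_subset hT
    refine ⟨T, hTt, ?_⟩
    rintro t₀ ht₀ e ⟨hep, hej⟩
    obtain ⟨Ψ, Φ, hΨ, hΨb, hΦ, hΦe, hj⟩ := hext (δ t₀).1 (hTsub ht₀).1 (δ t₀).2 (hTsub ht₀).2
      (fun h => hJ0 h t₀) (fun h => hJδ h t₀) (b t₀) e (hb t₀).1 (hb t₀).2.1 (hb t₀).2.2 hep hej
    -- The local extension has its own base germs; preconnectedness of `T` identifies them with the
    -- previously chosen `b`.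
    have hbΨ : EqOn (fun s => sec Ψ (0, ω s)) b T :=
      eqOn_of_preconnected hTc (fun s hs => ((continuousAt_sec (hΨ (0, ω s)
          ⟨Metric.mem_ball_self hρ, (hTsub hs).2⟩)).comp (f := fun s => ((0 : ℂ), ω s))
          (by fun_prop)).continuousWithinAt) b.continuous.continuousOn
        (fun s _ => by rw [pt_sec, (hb s).1]) ht₀ hΨb
    refine ⟨fun s => sec Φ (δ s), fun s hs => ?_, hΦe, fun s hs => ⟨pt_sec _ _, ?_⟩⟩
    · exact ((continuousAt_sec (hΦ (δ s) (hTsub hs))).comp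
        δ.continuous.continuousAt).continuousWithinAt
    · have := hj (δ s) (hTsub hs)
      rwa [show sec Ψ (0, (δ s).2) = b s from hbΨ hs] at this
  · rw [hb0]
    have hm : ∀ x ∈ Metric.ball (0 : ℂ) τ, (x, ω 0) ∈ Metric.ball (0 : ℂ) τ ×ˢ Metric.ball (0 : W) τ :=
      fun x hx => ⟨hx, hδ₀'.2⟩
    refine joinedIn_verticalGerms (c := 0) (r := τ) (fun x hx => hprim _ (hm x hx))
      (fun x hx => ?_) (Metric.mem_ball_self hτ) hδ₀'.1
    have h1 : firstDeriv (segmentPrimitive 0 F) =ᶠ[𝓝 (x, ω 0)] F := by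
      filter_upwards [(Metric.isOpen_ball.prod Metric.isOpen_ball).mem_nhds (hm x hx)] with q hq
        using firstDeriv_segmentPrimitive hF' hq
    rw [sec_congr h1]
    exact hFcl _ (hball ▸ hm x hx)

end LiftAlongPath

/-! ### Continuity of simple roots. -/

section SimpleRoots

/-- Near each root at `w₀` there is a root for nearby `w`; since the degree is locally constant and
the roots at `w₀` are simple, counting shows there are no others. -/
lemma hasSimpleFibers_of_nodup_roots {W : Type*} [NormedAddCommGroup W] {q : W → Polynomial ℂ}
    {w₀ : W} (hdeg : ∀ᶠ w in 𝓝 w₀, (q w).natDegree = (q w₀).natDegree)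
    (hlc : ContinuousAt (fun w => (q w).leadingCoeff) w₀)
    (hev : ∀ c, ContinuousAt (fun w => (q w).eval c) w₀) (h0 : q w₀ ≠ 0)
    (hnd : (q w₀).roots.Nodup) : HasSimpleFibers {p : ℂ × W | (q p.2).eval p.1 = 0} w₀ := by
  classical
  have hcard : ∀ p : Polynomial ℂ, p.roots.card = p.natDegree := fun p =>
    (IsAlgClosed.splits p).natDegree_eq_card_roots.symm
  set C := (q w₀).roots.toFinset with hCdef
  have hCcard : C.card = (q w₀).natDegree := by
    rw [hCdef, Multiset.toFinset_card_of_nodup hnd, hcard]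
  refine ⟨C, fun r hr => ?_⟩
  obtain ⟨s, hs, hsC⟩ := C.offDiag.exists_pos_forall_le (fun c => dist c.1 c.2)
    fun c hc => dist_pos.2 (Finset.mem_offDiag.1 hc).2.2
  -- At most half the separation, so that roots near different `c` are distinct.
  set r' := min r (s / 2) with hr'def
  have hr' : 0 < r' := by positivity
  let ξ : ℂ → W → ℂ := fun c w =>
    if h : ∃ x, (q w).eval x = 0 ∧ dist x c < r' then h.choose else 0
  have hlc0 : 0 < ‖(q w₀).leadingCoeff‖ := norm_pos_iff.2 (Polynomial.leadingCoeff_ne_zero.2 h0)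
  have hne : ∀ᶠ w in 𝓝 w₀, q w ≠ 0 := by
    filter_upwards [hlc.eventually_ne (Polynomial.leadingCoeff_ne_zero.2 h0)] with w hw
      using Polynomial.leadingCoeff_ne_zero.1 hw
  have hroot : ∀ᶠ w in 𝓝 w₀, ∀ c ∈ C, ∃ x, (q w).eval x = 0 ∧ dist x c < r' := by
    rw [Finset.eventually_all]
    intro c hc
    have hc0 : (q w₀).eval c = 0 := by simpa [hCdef, h0] using hc
    -- If every root were at distance at least `r'` from `c`, the factorisation would bound the
    -- value at `c` below by the right-hand side.
    have hlim : ∀ᶠ w in 𝓝 w₀, ‖(q w).eval c‖ <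
        ‖(q w).leadingCoeff‖ * r' ^ (q w₀).natDegree := by
      refine (hev c).norm.eventually_lt (hlc.norm.mul continuousAt_const) ?_
      rw [hc0, norm_zero]; positivity
    filter_upwards [hlim, hdeg] with w hw hwd
    by_contra! hcon
    refine hw.not_ge ?_
    rw [(IsAlgClosed.splits (q w)).eval_eq_prod_roots, norm_mul]
    refine mul_le_mul_of_nonneg_left ?_ (norm_nonneg _)
    rw [← hwd, ← hcard, ← Multiset.prod_replicate, ← Multiset.map_const']
    change _ ≤ (normHom : ℂ →*₀ ℝ) _
    rw [map_multiset_prod, Multiset.map_map]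
    refine Multiset.prod_map_le_prod_map₀ _ _ (fun _ _ => hr'.le) fun x hx => ?_
    have h1 := hcon x (Polynomial.isRoot_of_mem_roots hx)
    rwa [dist_comm, dist_eq_norm] at h1
  refine ⟨ξ, ?_⟩
  filter_upwards [hroot, hdeg, hne] with w hw hwd hwne
  have hξ : ∀ c ∈ C, (q w).eval (ξ c w) = 0 ∧ dist (ξ c w) c < r' := fun c hc => by
    have h := hw c hc
    simp only [ξ, dif_pos h]
    exact h.choose_spec
  refine ⟨fun c hc => (hξ c hc).2.trans_le (min_le_left _ _), fun x => ⟨fun hx => ?_, ?_⟩⟩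
  · have hinj : Set.InjOn (fun c => ξ c w) C := fun c hc d hd hcd => by
      by_contra hne
      have h1 := hsC (c, d) (Finset.mem_offDiag.2 ⟨hc, hd, hne⟩)
      have h2 := (hξ c hc).2
      have h3 := (hξ d hd).2
      simp only at hcd h1
      rw [hcd, dist_comm] at h2
      have h4 := dist_triangle c (ξ d w) d
      have h5 : r' ≤ s / 2 := min_le_right _ _
      linarith
    have himg : C.image (fun c => ξ c w) = (q w).roots.toFinset := by
      refine Finset.eq_of_subset_of_card_le (fun y hy => ?_) ?_
      · obtain ⟨c, hc, rfl⟩ := Finset.mem_image.1 hy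
        simpa [hwne] using (hξ c hc).1
      · rw [Finset.card_image_of_injOn hinj, hCcard, ← hwd, ← hcard]
        exact Multiset.toFinset_card_le _
    have hx' : x ∈ (q w).roots.toFinset := by
      have : (q w).eval x = 0 := hx
      simpa [hwne] using this
    rw [← himg] at hx'
    obtain ⟨c, hc, rfl⟩ := Finset.mem_image.1 hx'
    exact ⟨c, hc, rfl⟩
  · rintro ⟨c, hc, rfl⟩
    exact (hξ c hc).1

end SimpleRoots

/-! ### Equations of the avoided varieties. -/

section AvoidedVarieties

open MvPolynomial

lemma isProperAlgebraicSubvariety_iInter_polyZeros {n : ℕ} {ι : Type*} [Nonempty ι]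
    {G : ι → MvPolynomial (Fin n) ℂ} (hG : ∀ J, G J ≠ 0) :
    IsProperAlgebraicSubvariety (⋂ J, polyZeros (G J)) := by
  refine ⟨⟨Ideal.span (range G), ?_⟩, fun h => ?_⟩
  · ext z
    rw [zeroLocus_span]
    simp [polyZeros]
  · obtain ⟨J⟩ := ‹Nonempty ι›
    refine hG J (MvPolynomial.funext fun z => ?_)
    have : z ∈ ⋂ J, polyZeros (G J) := h ▸ mem_univ z
    simpa [polyZeros] using mem_iInter.1 this J

variable {m : ℕ} {Q : MvPolynomial (Fin (m + 1)) ℂ}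

lemma separable_map_of_isFirstVarSimple (hQ : IsFirstVarSimple Q) :
    ((finSuccEquiv ℂ m Q).map
      (algebraMap _ (FractionRing (MvPolynomial (Fin m) ℂ)))).Separable := by
  have h0 : finSuccEquiv ℂ m Q ≠ 0 := by simpa using hQ.1
  have h1 : (finSuccEquiv ℂ m Q).map
      (algebraMap _ (FractionRing (MvPolynomial (Fin m) ℂ))) ≠ 0 := by
    rwa [Ne, Polynomial.map_eq_zero_iff (IsFractionRing.injective _ _)]
  rw [← Polynomial.nodup_aroots_iff_of_splits
    (K := AlgebraicClosure (FractionRing (MvPolynomial (Fin m) ℂ))) h1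
    (IsAlgClosed.splits _)]
  have := hQ.2
  rwa [Polynomial.aroots_def, IsScalarTower.algebraMap_eq _
    (FractionRing (MvPolynomial (Fin m) ℂ)), ← Polynomial.map_map] at this

lemma isFirstVarSimple_of_separable (h0 : Q ≠ 0) (h : ((finSuccEquiv ℂ m Q).map
      (algebraMap _ (FractionRing (MvPolynomial (Fin m) ℂ)))).Separable) :
    IsFirstVarSimple Q := by
  have h1 : (finSuccEquiv ℂ m Q).map
      (algebraMap _ (FractionRing (MvPolynomial (Fin m) ℂ))) ≠ 0 := h.ne_zero
  rw [← Polynomial.nodup_aroots_iff_of_splits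
    (K := AlgebraicClosure (FractionRing (MvPolynomial (Fin m) ℂ))) h1
    (IsAlgClosed.splits _)] at h
  refine ⟨h0, ?_⟩
  rwa [Polynomial.aroots_def, IsScalarTower.algebraMap_eq _
    (FractionRing (MvPolynomial (Fin m) ℂ)), ← Polynomial.map_map]

/-- A polynomial which, off the zeros of the leading coefficient, vanishes exactly where
the specialization of `Q` has a multiple root. -/
lemma exists_multipleRoot_iff (hQ : IsFirstVarSimple Q) :
    ∃ D : MvPolynomial (Fin m) ℂ, D ≠ 0 ∧ ∀ w, eval w (finSuccEquiv ℂ m Q).leadingCoeff ≠ 0 →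
      (eval w D = 0 ↔
        ∃ x : ℂ, (specialize Q w).IsRoot x ∧ (specialize Q w).derivative.IsRoot x) := by
  set q := finSuccEquiv ℂ m Q with hq
  have hq0 : q ≠ 0 := by simpa [hq] using hQ.1
  by_cases hd : q.natDegree = 0
  -- In degree zero the specialization is a nonzero constant, which has no root.
  · refine ⟨1, one_ne_zero, fun w hw => ?_⟩
    simp only [map_one, one_ne_zero, false_iff]
    rintro ⟨x, hx, -⟩
    rw [Polynomial.eq_C_of_natDegree_eq_zero hd] at hw
    rw [specialize, ← hq, Polynomial.eq_C_of_natDegree_eq_zero hd] at hx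
    simp at hw hx
    exact hw hx
  -- Where the leading coefficient does not vanish, specialization preserves the degrees of `q` and
  -- `q'`, so the resultant detects common roots of the specializations.
  refine ⟨q.resultant q.derivative, ?_, fun w hw => ?_⟩
  · intro h
    have hK := congrArg (algebraMap _ (FractionRing (MvPolynomial (Fin m) ℂ))) h
    have hinj := IsFractionRing.injective (MvPolynomial (Fin m) ℂ)
      (FractionRing (MvPolynomial (Fin m) ℂ))
    rw [map_zero, ← Polynomial.resultant_map_map, ← Polynomial.natDegree_map_eq_of_injective hinj q,
      ← Polynomial.natDegree_map_eq_of_injective hinj q.derivative,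
      Polynomial.resultant_eq_zero_iff, ← Polynomial.derivative_map] at hK
    exact hK.2 (separable_map_of_isFirstVarSimple hQ)
  · have hnd : (q.map (eval w)).natDegree = q.natDegree :=
      Polynomial.natDegree_map_of_leadingCoeff_ne_zero _ hw
    have hnd' : (q.map (eval w)).derivative.natDegree = q.derivative.natDegree := by
      rw [Polynomial.natDegree_derivative, Polynomial.natDegree_derivative, hnd]
    rw [← Polynomial.resultant_map_map, ← hnd, ← Polynomial.derivative_map, ← hnd',
      Polynomial.resultant_eq_zero_iff, specialize, ← hq,
      Polynomial.isCoprime_iff_aeval_ne_zero_of_isAlgClosed ℂ ℂ]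
    have hne : q.map (eval w) ≠ 0 := fun h => hd (by rw [← hnd, h, Polynomial.natDegree_zero])
    simp only [Polynomial.coe_aeval_eq_eval, Polynomial.IsRoot.def]
    push Not
    exact ⟨fun h => h.2, fun h => ⟨Or.inl hne, h⟩⟩

/-- The polynomial `p(P) ∈ ℂ[z]`, for `p` with coefficients in `ℂ[w]` and a substitution of
polynomials in `z` for `w`. -/
lemma exists_eval_eq_zero_iff {n : ℕ} (π : (Fin n → ℂ) → Fin m → ℂ)
    (φ : MvPolynomial (Fin m) ℂ →+* MvPolynomial (Fin n) ℂ)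
    (hφ : ∀ z p, eval z (φ p) = eval (π z) p) (P : MvPolynomial (Fin n) ℂ)
    (Q : MvPolynomial (Fin (m + 1)) ℂ) :
    ∃ G : MvPolynomial (Fin n) ℂ, G ≠ 0 ∧ ∀ z, eval z G = 0 ↔
      (∃ y, (specialize Q (π y)).eval (eval y P) ≠ 0) ∧
        (specialize Q (π z)).eval (eval z P) = 0 := by
  set H := (finSuccEquiv ℂ m Q).eval₂ φ P with hH
  have hev : ∀ z, eval z H = (specialize Q (π z)).eval (eval z P) := fun z => by
    rw [hH, Polynomial.hom_eval₂, specialize, Polynomial.eval_map]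
    congr 1
    exact RingHom.ext fun p => hφ z p
  by_cases h : ∃ y, (specialize Q (π y)).eval (eval y P) ≠ 0
  · refine ⟨H, ?_, fun z => by rw [hev]; simp [h]⟩
    rintro h0
    obtain ⟨y, hy⟩ := h
    rw [← hev, h0, map_zero] at hy
    exact hy rfl
  -- The dropped condition corresponds to the factor `1`, with no zeros.
  · exact ⟨1, one_ne_zero, fun z => by simp [h]⟩

lemma exists_rootDegeneracyLocus_eq (hQ : IsFirstVarSimple Q) :
    ∃ G : MvPolynomial (Fin m) ℂ, G ≠ 0 ∧ rootDegeneracyLocus Q = polyZeros G := by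
  obtain ⟨D, hD, hDiff⟩ := exists_multipleRoot_iff hQ
  obtain ⟨G, hG, hGiff⟩ := exists_eval_eq_zero_iff id (RingHom.id _) (fun _ _ => rfl) 0 Q
  have hlc : (finSuccEquiv ℂ m Q).leadingCoeff ≠ 0 := by simpa using hQ.1
  refine ⟨(finSuccEquiv ℂ m Q).leadingCoeff * D * G, mul_ne_zero (mul_ne_zero hlc hD) hG, ?_⟩
  ext w
  simp only [map_zero, id] at hGiff
  simp only [rootDegeneracyLocus, polyZeros, mem_ofPred_eq, map_mul, mul_eq_zero, ← hGiff, or_assoc]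
  by_cases h : eval w (finSuccEquiv ℂ m Q).leadingCoeff = 0
  · simp [h]
  · rw [hDiff w h]

/-- Treats both kinds of `P` together, with `π` the tail map or the identity; surjectivity of `π`
keeps the pulled-back equation nonzero. -/
lemma exists_avoided_eq (hQ : IsFirstVarSimple Q) {n : ℕ} (π : (Fin n → ℂ) → Fin m → ℂ)
    (hπ : Function.Surjective π) (φ : MvPolynomial (Fin m) ℂ →+* MvPolynomial (Fin n) ℂ)
    (hφ : ∀ z p, eval z (φ p) = eval (π z) p) (P : MvPolynomial (Fin n) ℂ) :
    ∃ G : MvPolynomial (Fin n) ℂ, G ≠ 0 ∧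
      {z | π z ∈ rootDegeneracyLocus Q ∨ ((∃ y, (specialize Q (π y)).eval (eval y P) ≠ 0) ∧
        (specialize Q (π z)).eval (eval z P) = 0)} = polyZeros G := by
  obtain ⟨G₁, h₁, hG₁⟩ := exists_rootDegeneracyLocus_eq hQ
  obtain ⟨G₂, h₂, hG₂⟩ := exists_eval_eq_zero_iff π φ hφ P Q
  refine ⟨φ G₁ * G₂, mul_ne_zero (fun h => h₁ (MvPolynomial.funext fun w => ?_)) h₂, ?_⟩
  · obtain ⟨z, rfl⟩ := hπ w
    rw [← hφ, h, map_zero, map_zero]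
  · ext z
    simp [hG₁, polyZeros, hφ, hG₂]

lemma isProperAlgebraicSubvariety_avoidedVariety {ι : Type*} [Nonempty ι]
    {Q : ι → MvPolynomial (Fin (m + 1)) ℂ} (hQ : ∀ J, IsFirstVarSimple (Q J))
    (P : MvPolynomial (Fin (m + 1)) ℂ) :
    IsProperAlgebraicSubvariety (⋂ J, avoidedVariety (Q J) P) := by
  choose G hG hGeq using fun J => exists_avoided_eq (hQ J) (Fin.tail (α := fun _ => ℂ))
    (fun w => ⟨Fin.cons 0 w, Fin.tail_cons _ _⟩) (rename Fin.succ).toRingHom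
    (fun z p => eval_rename _ _ _) P
  have : ∀ J, avoidedVariety (Q J) P = polyZeros (G J) := hGeq
  simp only [this]
  exact isProperAlgebraicSubvariety_iInter_polyZeros hG

lemma isProperAlgebraicSubvariety_avoidedVarietyTail {ι : Type*} [Nonempty ι]
    {Q : ι → MvPolynomial (Fin (m + 1)) ℂ} (hQ : ∀ J, IsFirstVarSimple (Q J))
    (P : MvPolynomial (Fin m) ℂ) :
    IsProperAlgebraicSubvariety (⋂ J, avoidedVarietyTail (Q J) P) := by
  choose G hG hGeq using fun J => exists_avoided_eq (hQ J) id Function.surjective_id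
    (RingHom.id _) (fun _ _ => rfl) P
  have : ∀ J, avoidedVarietyTail (Q J) P = polyZeros (G J) := hGeq
  simp only [this]
  exact isProperAlgebraicSubvariety_iInter_polyZeros hG

lemma IsProperAlgebraicSubvariety.exists_subset_polyZeros {n : ℕ} {V : Set (Fin n → ℂ)}
    (hV : IsProperAlgebraicSubvariety V) :
    ∃ g : MvPolynomial (Fin n) ℂ, g ≠ 0 ∧ V ⊆ polyZeros g := by
  obtain ⟨⟨I, rfl⟩, hne⟩ := hV
  obtain ⟨z, hz⟩ := (ne_univ_iff_exists_notMem _).1 hne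
  simp only [mem_zeroLocus_iff, not_forall] at hz
  obtain ⟨g, hg, hgz⟩ := hz
  refine ⟨g, fun h => hgz (by rw [h, map_zero]), fun y hy => ?_⟩
  simpa [polyZeros] using (mem_zeroLocus_iff.1 hy) g hg

/-- Every hypersurface is contained in the zero set of a polynomial which is simple in the first
variable. -/
lemma exists_isFirstVarSimple_polyZeros_subset {g : MvPolynomial (Fin (m + 1)) ℂ} (hg : g ≠ 0) :
    ∃ Q : MvPolynomial (Fin (m + 1)) ℂ, IsFirstVarSimple Q ∧ polyZeros g ⊆ polyZeros Q := by
  let R := MvPolynomial (Fin m) ℂ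
  let L := FractionRing R
  have hinj : Function.Injective (Polynomial.map (algebraMap R L)) :=
    Polynomial.map_injective _ (IsFractionRing.injective R L)
  set e := finSuccEquiv ℂ m
  set gL := (e g).map (algebraMap R L) with hgL
  have hgL0 : gL ≠ 0 := by
    rw [hgL, Ne, Polynomial.map_eq_zero_iff (IsFractionRing.injective _ _)]
    simpa [e] using hg
  classical
  -- Over the fraction field, of characteristic zero, the squarefree radical is separable and has a
  -- power divisible by `gL`; denominators are then cleared.
  set p := UniqueFactorizationMonoid.radical gL
  have hp : p.Separable :=
    PerfectField.separable_iff_squarefree.2 UniqueFactorizationMonoid.squarefree_radical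
  obtain ⟨N, h, hN⟩ := UniqueFactorizationMonoid.exists_dvd_radical_self_pow hgL0
  obtain ⟨b, hb, hbp⟩ := IsLocalization.integerNormalization_spec (nonZeroDivisors R) p
  obtain ⟨c, hc, hch⟩ := IsLocalization.integerNormalization_spec (nonZeroDivisors R) h
  set p' := IsLocalization.integerNormalization (nonZeroDivisors R) p
  set h' := IsLocalization.integerNormalization (nonZeroDivisors R) h
  have hb0 : algebraMap R L b ≠ 0 := by
    simpa using nonZeroDivisors.ne_zero hb
  have hc0 : algebraMap R L c ≠ 0 := by
    simpa using nonZeroDivisors.ne_zero hc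
  have hsm : ∀ (r : R) (f : Polynomial L), r • f = Polynomial.C (algebraMap R L r) * f :=
    fun r f => by rw [← Polynomial.smul_eq_C_mul, algebraMap_smul]
  rw [hsm] at hbp hch
  have hid : Polynomial.C c * p' ^ N = Polynomial.C (b ^ N) * (e g * h') := by
    apply hinj
    simp only [Polynomial.map_mul, Polynomial.map_pow, Polynomial.map_C, hbp, hch, ← hgL]
    rw [mul_pow, hN]
    simp only [map_pow]
    ring
  have hsep : ((Polynomial.C c * p').map (algebraMap R L)).Separable := by
    rw [Polynomial.map_mul, Polynomial.map_C, hbp, ← mul_assoc, ← Polynomial.C_mul]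
    exact (hp.unit_mul ((Polynomial.isUnit_C.2 (mul_ne_zero hc0 hb0).isUnit)))
  -- The denominator `c` of the cofactor is kept in `Q`: by `hid`, a zero of `g` is only known to be
  -- a zero of `c` or of `p'`. Over the fraction field `c` is a unit, so separability is unaffected.
  refine ⟨e.symm (Polynomial.C c * p'), isFirstVarSimple_of_separable ?_ ?_, ?_⟩
  · intro h0
    rw [EmbeddingLike.map_eq_zero_iff] at h0
    rw [h0, Polynomial.map_zero] at hsep
    exact hsep.ne_zero rfl
  · simpa [e] using hsep
  · intro z hz
    have hψ := congrArg (fun f => eval z (e.symm f)) hid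
    have hz' : eval z g = 0 := hz
    simp only [map_mul, map_pow, AlgEquiv.symm_apply_apply, hz', zero_mul, mul_zero,
      mul_eq_zero] at hψ
    change eval z (e.symm (Polynomial.C c * p')) = 0
    rw [map_mul, map_mul, mul_eq_zero]
    exact hψ.imp_right fun h => eq_zero_of_pow_eq_zero h

end AvoidedVarieties

/-! ### Application to algebro-resurgent germs. -/

section Continuability

open AnalyticGerm unitInterval

lemma ContinuesAlong.comp_analytic {E E' : Type*} [NormedAddCommGroup E] [NormedSpace ℂ E]
    [NormedAddCommGroup E'] [NormedSpace ℂ E'] {f : E' → ℂ} {p : E → E'} {γ : ℝ → E}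
    (h : ContinuesAlong f (p ∘ γ)) (hp : ∀ z, AnalyticAt ℂ p z) : ContinuesAlong (f ∘ p) γ := by
  obtain ⟨g, hg, hg0, hgc⟩ := h
  refine ⟨fun t => g t ∘ p, fun t ht => AnalyticAt.comp (x := γ t) (hg t ht) (hp _),
    hg0.comp_tendsto (hp _).continuousAt.tendsto, fun t ht => ?_⟩
  filter_upwards [hgc t ht] with s hs using hs.comp_tendsto (hp _).continuousAt.tendsto

lemma IsContinuableAvoiding.mono {n : ℕ} {f : (Fin n → ℂ) → ℂ} {V V' : Set (Fin n → ℂ)}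
    (h : IsContinuableAvoiding f V) (hV : V ⊆ V') : IsContinuableAvoiding f V' := by
  obtain ⟨τ, hτ, hf, hc⟩ := h
  exact ⟨τ, hτ, hf, fun γ hγ h0 hγV => hc γ hγ h0 fun t ht hm => hγV t ht (hV hm)⟩

variable {m : ℕ}

/-- The hypersurface `Q⁻¹(0)`, as a subset of `ℂ × ℂᵐ`. -/
def splitZeros (Q : MvPolynomial (Fin (m + 1)) ℂ) : Set (ℂ × (Fin m → ℂ)) :=
  {p | (specialize Q p.2).eval p.1 = 0}

lemma cons_mem_polyZeros (Q : MvPolynomial (Fin (m + 1)) ℂ) (p : ℂ × (Fin m → ℂ)) :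
    (Fin.cons p.1 p.2 : Fin (m + 1) → ℂ) ∈ polyZeros Q ↔ p ∈ splitZeros Q := by
  simp only [polyZeros, splitZeros, mem_ofPred_eq, MvPolynomial.eval_eq_eval_mv_eval', specialize]

lemma isClosed_splitZeros (Q : MvPolynomial (Fin (m + 1)) ℂ) : IsClosed (splitZeros Q) := by
  have h : splitZeros Q = (fun p : ℂ × (Fin m → ℂ) => (Fin.cons p.1 p.2 : Fin (m + 1) → ℂ)) ⁻¹'
      polyZeros Q := ext fun p => (cons_mem_polyZeros Q p).symm
  rw [h]
  refine (isClosed_eq (MvPolynomial.continuous_eval Q) continuous_const).preimage ?_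
  exact (Fin.consEquivL ℂ fun _ => ℂ).continuous

lemma hasSimpleFibers_splitZeros {Q : MvPolynomial (Fin (m + 1)) ℂ} {w : Fin m → ℂ}
    (hw : w ∉ rootDegeneracyLocus Q) : HasSimpleFibers (splitZeros Q) w := by
  simp only [rootDegeneracyLocus, mem_ofPred_eq, not_or] at hw
  obtain ⟨hlc, hmult, -⟩ := hw
  set q := MvPolynomial.finSuccEquiv ℂ m Q with hq
  have hlcw : ∀ v, MvPolynomial.eval v q.leadingCoeff ≠ 0 →
      (specialize Q v).natDegree = q.natDegree ∧
        (specialize Q v).leadingCoeff = MvPolynomial.eval v q.leadingCoeff := fun v hv =>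
    ⟨Polynomial.natDegree_map_of_leadingCoeff_ne_zero _ hv,
      Polynomial.leadingCoeff_map_of_leadingCoeff_ne_zero _ hv⟩
  have hev : ∀ᶠ v in 𝓝 w, MvPolynomial.eval v q.leadingCoeff ≠ 0 :=
    (MvPolynomial.continuous_eval q.leadingCoeff).continuousAt.eventually_ne hlc
  have h0 : specialize Q w ≠ 0 := by
    rw [← Polynomial.leadingCoeff_ne_zero, (hlcw w hlc).2]; exact hlc
  refine hasSimpleFibers_of_nodup_roots ?_ ?_ (fun c => ?_) h0 ?_
  · filter_upwards [hev] with v hv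
    rw [(hlcw v hv).1, (hlcw w hlc).1]
  · refine (MvPolynomial.continuous_eval q.leadingCoeff).continuousAt.congr ?_
    filter_upwards [hev] with v hv using (hlcw v hv).2.symm
  · have h1 : (fun v => (specialize Q v).eval c) = fun v =>
        MvPolynomial.eval (Fin.cons c v : Fin (m + 1) → ℂ) Q :=
      funext fun v => (MvPolynomial.eval_eq_eval_mv_eval' v c Q).symm
    rw [h1]
    refine ((MvPolynomial.continuous_eval Q).comp
      ((Fin.consEquivL ℂ fun _ : Fin (m + 1) => ℂ).continuous.comp
        (f := fun v : Fin m → ℂ => (c, v)) (by fun_prop))).continuousAt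
  · rw [Polynomial.nodup_roots_iff_of_splits h0 (IsAlgClosed.splits _), Polynomial.Separable,
      Polynomial.isCoprime_iff_aeval_ne_zero_of_isAlgClosed ℂ ℂ]
    simp only [Polynomial.coe_aeval_eq_eval]
    intro x
    by_contra! h
    exact hmult ⟨x, h⟩

lemma cons_mem_ball {τ : ℝ} {p : ℂ × (Fin m → ℂ)} (hp : p ∈ Metric.ball 0 τ) :
    (Fin.cons p.1 p.2 : Fin (m + 1) → ℂ) ∈ Metric.ball 0 τ := by
  have hτ : 0 < τ := dist_nonneg.trans_lt hp
  rw [mem_ball_zero_iff, Prod.norm_def, max_lt_iff] at hp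
  rw [mem_ball_zero_iff, pi_norm_lt_iff hτ]
  refine Fin.cases (by simpa using hp.1) fun i => ?_
  simpa using (norm_le_pi_norm p.2 i).trans_lt hp.2

/-- Pull-back of `∫₀ˣ F` by an analytic map `p`. -/
theorem IsContinuableAvoiding.segmentPrimitive_comp {F : (Fin (m + 1) → ℂ) → ℂ} {ι : Type*}
    {Q : ι → MvPolynomial (Fin (m + 1)) ℂ} (hF : IsContinuableAvoiding F (⋂ J, polyZeros (Q J)))
    {n : ℕ} {p : (Fin n → ℂ) → ℂ × (Fin m → ℂ)} (hp : ∀ z, AnalyticAt ℂ p z) (hp0 : p 0 = 0)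
    {V : Set (Fin n → ℂ)}
    (hV : ∀ z ∉ V, ∃ J, HasSimpleFibers (splitZeros (Q J)) (p z).2 ∧
      ((0, (p z).2) ∈ splitZeros (Q J) → ∀ y, (0, (p y).2) ∈ splitZeros (Q J)) ∧
      (p z ∈ splitZeros (Q J) → ∀ y, p y ∈ splitZeros (Q J))) :
    IsContinuableAvoiding (segmentPrimitive 0 (fun q => F (Fin.cons q.1 q.2)) ∘ p) V := by
  obtain ⟨τ, hτ, hFa, hFc⟩ := hF
  set L : ℂ × (Fin m → ℂ) → Fin (m + 1) → ℂ := fun q => Fin.cons q.1 q.2 with hL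
  have hLd : ContDiff ℝ 1 L :=
    (Fin.consEquivL ℝ fun _ : Fin (m + 1) => ℂ).contDiff
  have hLa : ∀ q, AnalyticAt ℂ L q := fun q =>
    (Fin.consEquivL ℂ fun _ : Fin (m + 1) => ℂ).toContinuousLinearMap.analyticAt q
  set S : Set (ℂ × (Fin m → ℂ)) := ⋂ J, splitZeros (Q J)
  have hS : ∀ q, L q ∈ ⋂ J, polyZeros (Q J) ↔ q ∈ S := fun q => by
    simp only [S, mem_iInter, hL, cons_mem_polyZeros]
  have hFL : AnalyticOnNhd ℂ (F ∘ L) (Metric.ball 0 τ) := fun q hq =>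
    AnalyticAt.comp (f := L) (hFa _ (cons_mem_ball hq)) (hLa q)
  have hcont : ∀ γ : ℝ → ℂ × (Fin m → ℂ), ContDiffOn ℝ 1 γ (Icc 0 1) → γ 0 ∈ Metric.ball 0 τ →
      (∀ t ∈ Icc (0 : ℝ) 1, γ t ∉ S) → ContinuesAlong (F ∘ L) γ := fun γ hγ h0 hγS =>
    ContinuesAlong.comp_analytic (hFc (L ∘ γ) (hLd.comp_contDiffOn hγ) (cons_mem_ball h0)
      fun t ht h => hγS t ht ((hS _).1 h)) hLa
  have hX : IsContinuationSystem S (reachableGerms (F ∘ L) τ S) :=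
    { isClosed := isClosed_iInter fun J => isClosed_splitZeros (Q J)
      pt_notMem := fun e he => pt_notMem_of_mem_reachableGerms he
      exists_extension := fun e he p r hb hep =>
        exists_extension_of_mem_reachableGerms hcont he hb hep }
  -- The condition `p 0 = 0` makes `p` carry a small polydisc into the one where `F` is holomorphic.
  obtain ⟨τ', hτ', hpτ⟩ : ∃ τ' > 0, ∀ z ∈ Metric.ball 0 τ', p z ∈ Metric.ball 0 τ :=
    Metric.eventually_nhds_iff_ball.1 ((hp 0).continuousAt.eventually
      (hp0.symm ▸ Metric.ball_mem_nhds (0 : ℂ × (Fin m → ℂ)) hτ))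
  have hprim : AnalyticOnNhd ℂ (segmentPrimitive 0 (F ∘ L)) (Metric.ball 0 τ) := by
    have hball : Metric.ball (0 : ℂ × (Fin m → ℂ)) τ = Metric.ball 0 τ ×ˢ Metric.ball 0 τ :=
      (ball_prod_same _ _ _).symm
    rw [hball] at hFL ⊢
    exact analyticAt_segmentPrimitive hFL
  refine ⟨τ', hτ', fun z hz => (hprim _ (hpτ z hz)).comp (hp z), fun γ hγ h0 hγV => ?_⟩
  have hpc : Continuous p := continuous_iff_continuousAt.2 fun z => (hp z).continuousAt
  obtain ⟨Γ, hΓ, hΓ0⟩ := hX.exists_lift_segmentPrimitive (fun J => isClosed_splitZeros (Q J))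
    (fun J => iInter_subset _ J) hFL (fun q hq hqS => sec_mem_reachableGerms hq hqS)
    ⟨fun t => p (γ t), hpc.comp (hγ.continuousOn.comp_continuous continuous_subtype_val
      fun t => t.2)⟩ (hpτ _ h0) (fun t => by
        obtain ⟨J, h1, h2, h3⟩ := hV _ (hγV t t.2)
        exact ⟨J, h1, fun h s => h2 h _, fun h s => h3 h _⟩)
  refine ContinuesAlong.comp_analytic (f := segmentPrimitive 0 (F ∘ L)) ?_ hp
  refine ContinuesAlong.of_lift (Γ := IccExtend zero_le_one Γ) ?_ ?_ (hprim _ (hpτ _ h0)) ?_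
  · exact (Γ.continuous.Icc_extend' (h := zero_le_one)).continuousOn
  · rw [IccExtend_of_mem _ _ ⟨le_rfl, zero_le_one⟩]
    exact hΓ0
  · intro t ht
    rw [IccExtend_of_mem _ _ ht]
    exact hΓ _

lemma firstVarIntegral_eq_segmentPrimitive (F : (Fin (m + 1) → ℂ) → ℂ) (c : ℂ) (w : Fin m → ℂ) :
    firstVarIntegral F c w = segmentPrimitive 0 (fun q => F (Fin.cons q.1 q.2)) (c, w) := by
  simp [firstVarIntegral, segmentPrimitive]

/-- Off the degeneracy locus, `0` can be a root only when the third condition has been dropped. -/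
lemma zero_mem_splitZeros_of_notMem_rootDegeneracyLocus {Q : MvPolynomial (Fin (m + 1)) ℂ} {w : Fin m → ℂ}
    (hw : w ∉ rootDegeneracyLocus Q) (h : (0, w) ∈ splitZeros Q) (v : Fin m → ℂ) :
    (0, v) ∈ splitZeros Q := by
  by_contra hv
  exact hw (Or.inr (Or.inr ⟨⟨v, hv⟩, h⟩))

variable {F : (Fin (m + 1) → ℂ) → ℂ} {ι : Type*} {Q : ι → MvPolynomial (Fin (m + 1)) ℂ}

theorem IsContinuableAvoiding.convolution (hF : IsContinuableAvoiding F (⋂ J, polyZeros (Q J)))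
    {P : MvPolynomial (Fin (m + 1)) ℂ} (hP : MvPolynomial.eval 0 P = 0) :
    IsContinuableAvoiding (convolution F P) (⋂ J, avoidedVariety (Q J) P) := by
  have heq : _root_.convolution F P = segmentPrimitive 0 (fun q => F (Fin.cons q.1 q.2)) ∘
      fun z => (MvPolynomial.eval z P, Fin.tail z) :=
    funext fun z => firstVarIntegral_eq_segmentPrimitive _ _ _
  rw [heq]
  refine hF.segmentPrimitive_comp (fun z => (AnalyticOnNhd.eval_mvPolynomial P z (mem_univ z)).prod ?_) ?_ fun z hz => ?_
  · exact (ContinuousLinearMap.pi fun i : Fin m =>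
      (ContinuousLinearMap.proj i.succ : (Fin (m + 1) → ℂ) →L[ℂ] ℂ)).analyticAt z
  · exact Prod.ext hP rfl
  · simp only [mem_iInter, not_forall] at hz
    obtain ⟨J, hJ⟩ := hz
    have h1 : Fin.tail z ∉ rootDegeneracyLocus (Q J) := fun h => hJ (Or.inl h)
    refine ⟨J, hasSimpleFibers_splitZeros h1,
      fun h y => zero_mem_splitZeros_of_notMem_rootDegeneracyLocus h1 h _, fun h y => ?_⟩
    -- Otherwise the fourth condition is in force, and it excludes that `P` is a root at `z`.
    by_contra hy
    exact hJ (Or.inr ⟨⟨y, hy⟩, h⟩)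

theorem IsContinuableAvoiding.convolutionTail (hF : IsContinuableAvoiding F (⋂ J, polyZeros (Q J)))
    {P : MvPolynomial (Fin m) ℂ} (hP : MvPolynomial.eval 0 P = 0) :
    IsContinuableAvoiding (convolutionTail F P) (⋂ J, avoidedVarietyTail (Q J) P) := by
  have heq : _root_.convolutionTail F P = segmentPrimitive 0 (fun q => F (Fin.cons q.1 q.2)) ∘
      fun w => (MvPolynomial.eval w P, w) :=
    funext fun w => firstVarIntegral_eq_segmentPrimitive _ _ _
  rw [heq]
  refine hF.segmentPrimitive_comp (fun w => (AnalyticOnNhd.eval_mvPolynomial P w (mem_univ w)).prod analyticAt_id) ?_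
    fun w hw => ?_
  · exact Prod.ext hP rfl
  · simp only [mem_iInter, not_forall] at hw
    obtain ⟨J, hJ⟩ := hw
    have h1 : w ∉ rootDegeneracyLocus (Q J) := fun h => hJ (Or.inl h)
    refine ⟨J, hasSimpleFibers_splitZeros h1,
      fun h y => zero_mem_splitZeros_of_notMem_rootDegeneracyLocus h1 h _, fun h y => ?_⟩
    by_contra hy
    exact hJ (Or.inr ⟨⟨y, hy⟩, h⟩)

lemma IsAlgebroResurgent.exists_isFirstVarSimple (hF : IsAlgebroResurgent F) :
    ∃ Q : MvPolynomial (Fin (m + 1)) ℂ, IsFirstVarSimple Q ∧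
      IsContinuableAvoiding F (⋂ _ : Fin 1, polyZeros Q) := by
  obtain ⟨V, hV, hFV⟩ := hF
  obtain ⟨g, hg, hVg⟩ := hV.exists_subset_polyZeros
  obtain ⟨Q, hQ, hgQ⟩ := exists_isFirstVarSimple_polyZeros_subset hg
  exact ⟨Q, hQ, hFV.mono (subset_iInter fun _ => hVg.trans hgQ)⟩

end Continuability

theorem mainTheorem5 (m : ℕ) (F : (Fin (m + 1) → ℂ) → ℂ) :
    -- membership
    (IsAlgebroResurgent F →
      (∀ P : MvPolynomial (Fin (m + 1)) ℂ, MvPolynomial.eval 0 P = 0 →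
        IsAlgebroResurgent (convolution F P)) ∧
      (∀ P : MvPolynomial (Fin m) ℂ, MvPolynomial.eval 0 P = 0 →
        IsAlgebroResurgent (convolutionTail F P))) ∧
    -- explicit avoided varieties
    (∀ (K : ℕ) (Q : Fin (K + 1) → MvPolynomial (Fin (m + 1)) ℂ),
      (∀ J, IsFirstVarSimple (Q J)) →
      IsContinuableAvoiding F (⋂ J, polyZeros (Q J)) →
      (∀ P : MvPolynomial (Fin (m + 1)) ℂ, MvPolynomial.eval 0 P = 0 →
        IsProperAlgebraicSubvariety (⋂ J, avoidedVariety (Q J) P) ∧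
        IsContinuableAvoiding (convolution F P) (⋂ J, avoidedVariety (Q J) P)) ∧
      (∀ P : MvPolynomial (Fin m) ℂ, MvPolynomial.eval 0 P = 0 →
        IsProperAlgebraicSubvariety (⋂ J, avoidedVarietyTail (Q J) P) ∧
        IsContinuableAvoiding (convolutionTail F P) (⋂ J, avoidedVarietyTail (Q J) P))) := by
  refine ⟨fun hF => ?_, fun K Q hQ hF => ⟨fun P hP =>
    ⟨isProperAlgebraicSubvariety_avoidedVariety hQ P, hF.convolution hP⟩, fun P hP =>
    ⟨isProperAlgebraicSubvariety_avoidedVarietyTail hQ P, hF.convolutionTail hP⟩⟩⟩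
  obtain ⟨Q, hQ, hFQ⟩ := hF.exists_isFirstVarSimple
  exact ⟨fun P hP => ⟨_, isProperAlgebraicSubvariety_avoidedVariety (fun _ => hQ) P,
      hFQ.convolution hP⟩,
    fun P hP => ⟨_, isProperAlgebraicSubvariety_avoidedVarietyTail (fun _ => hQ) P,
      hFQ.convolutionTail hP⟩⟩
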